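/- Let $G$ be a finite group. For a positive multiple $n$ of $|G|$, the Galois group of the $n$-th cyclotomic field $\mathbb{Q}_n\subseteq\mathbb{C}$ over $\mathbb{Q}$ acts on the set $\mathrm{Irr}(G)$ of irreducible complex characters of $G$ by $\chi^{\alpha}(g)=\chi(g)^{\alpha}$; two irreducible characters are called Galois conjugate if they lie in the same orbit for some such $n$ (this does not depend on $n$). Call $G$ a $\mathbf{GC}^*$-group if any two non-linear irreducible characters of $G$ of the same degree are Galois conjugate. Let $G_\infty$ denote the nilpotent residual of $G$, i.e. the smallest term of its lower central series. A non-abelian $2$-group $K$ is a Suzuki $2$-group if it has more than one involution and there is a soluble group of automorphisms of $K$ that is transitive on the set of involutions of $K$. **Theorem.** Let $G=KL$ be a finite solvable Frobenius group with Frobenius kernel $K$ and complement $L$. Assume that $G$ is a $\mathbf{GC}^*$-group and that $K=G_\infty$. Then either 1. $K$ is an elementary abelian $q$-group for some prime $q$; or 2. $K$ is a Suzuki $2$-group such that $|K|=|K'|^2$, and $L$ is cyclic of order $|K'|-1$, where $K'$ is the commutator subgroup of $K$. -/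

import Mathlib

/-- `χ : G → ℂ` is an irreducible complex character of `G`: it is the trace function of an
irreducible representation of `G` on some `ℂⁿ`. -/
def IsIrreducibleCharacter {G : Type*} [Group G] (χ : G → ℂ) : Prop :=
  ∃ (n : ℕ) (ρ : Representation ℂ G (Fin n → ℂ)), ρ.IsIrreducible ∧ ρ.character = χ

/-- The `n`-th cyclotomic field, as a subfield of `ℂ`. -/
noncomputable def cyclotomicSubfield (n : ℕ) : IntermediateField ℚ ℂ :=
  IntermediateField.adjoin ℚ {z : ℂ | z ^ n = 1}

/-- `ψ = χ^α` for some `α` in the Galois group over `ℚ` of the `n`-th cyclotomic field (both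
functions taking their values in that field). -/
def GaloisConjugateIn {G : Type*} (n : ℕ) (χ ψ : G → ℂ) : Prop :=
  ∃ α : cyclotomicSubfield n ≃ₐ[ℚ] cyclotomicSubfield n,
    ∀ g : G, ∃ z : cyclotomicSubfield n, (z : ℂ) = χ g ∧ (α z : ℂ) = ψ g

/-- Two characters of `G` are Galois conjugate if they are so in the `n`-th cyclotomic field for
some positive multiple `n` of `|G|`. -/
def GaloisConjugate {G : Type*} [Group G] (χ ψ : G → ℂ) : Prop :=
  ∃ n : ℕ, 0 < n ∧ Nat.card G ∣ n ∧ GaloisConjugateIn n χ ψ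

/-- `GC*`-groups: any two non-linear irreducible characters of the same degree are Galois
conjugate. -/
def IsGCStar (G : Type*) [Group G] : Prop :=
  ∀ χ ψ : G → ℂ, IsIrreducibleCharacter χ → IsIrreducibleCharacter ψ →
    χ 1 ≠ 1 → ψ 1 ≠ 1 → χ 1 = ψ 1 → GaloisConjugate χ ψ

/-- The nilpotent residual: the intersection (for finite `G`, the smallest term) of the lower
central series of `G`. -/
def nilpotentResidual (G : Type*) [Group G] : Subgroup G :=
  ⨅ n : ℕ, (⊤ : Subgroup G).lowerCentralSeries n

/-- `G` is a Frobenius group with complement `L` and kernel `K`: `L` is a proper nontrivial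
subgroup meeting each of its conjugates `g L g⁻¹`, `g ∉ L`, trivially, and `K` consists of the
identity and the elements lying in no conjugate of `L`. -/
structure IsFrobeniusGroup {G : Type*} [Group G] (K L : Subgroup G) : Prop where
  ne_bot : L ≠ ⊥
  ne_top : L ≠ ⊤
  inf_conj : ∀ g : G, g ∉ L → L ⊓ L.map (MulAut.conj g).toMonoidHom = ⊥
  mem_kernel : ∀ x : G, x ∈ K ↔ x = 1 ∨ ∀ g : G, x ∉ L.map (MulAut.conj g).toMonoidHom

/-- Elementary abelian `q`-groups. -/
def IsElementaryAbelian (q : ℕ) (K : Type*) [Group K] : Prop :=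
  (∀ x y : K, x * y = y * x) ∧ ∀ x : K, x ^ q = 1

/-- Suzuki `2`-groups: non-abelian `2`-groups with more than one involution that have a soluble
group of automorphisms transitive on the involutions. -/
structure IsSuzukiTwoGroup (K : Type*) [Group K] : Prop where
  isPGroup : IsPGroup 2 K
  nonabelian : ∃ x y : K, x * y ≠ y * x
  involutions : ∃ x y : K, orderOf x = 2 ∧ orderOf y = 2 ∧ x ≠ y
  transitive : ∃ A : Subgroup (MulAut K), Group.IsSolvable A ∧
    ∀ x y : K, orderOf x = 2 → orderOf y = 2 → ∃ a ∈ A, a x = y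

/-!
If an `L`-invariant normal subgroup of `K` acts on an irreducible representation of `K` through a
nontrivial linear character, the induced character of `G = KL` is irreducible and non-linear. The
condition `GC*` therefore says that two such characters of `K` of the same degree agree up to the
action of `L` and a power map `k ↦ k ^ t` with `t` prime to `|K|`. For linear characters this makes
`K / K'` elementary abelian for a prime `p`; as `K` is solvable and `L` acts without fixed points,
`K` is then a `p`-group. Suppose that it is not abelian, so that `|L|` is odd.

* Let `p` be odd and divide out `γ₃(K)`. Then `x ↦ x ^ p` induces an isomorphism `K / K' → K'`, and
  `[x, K]` has index `p` in `K'` and generates `K'` together with `x ^ p` whenever `x ∉ K'`. But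
  `x ↦ [x, ·]` becomes a linear family of endomorphisms of `K'` with one-dimensional kernels,
  spanned by `x ^ p`. By the Chevalley-Warning theorem the linear coefficient of the characteristic
  polynomial vanishes for some `x ∉ K'`; the kernel is then contained in the image, so that `x ^ p`
  lies in `[x, K]`, a contradiction.
* Let `p = 2` and suppose that the class is at least three; divide out `γ₄(K)`. Then `[x ^ 2, K]`
  has index two in `γ₃(K)` for `x ∉ K'`. A linear character of `K'` which is nontrivial on `γ₃(K)`
  but trivial on `[x ^ 2, K]` gives an invariant character of `γ₃(K)⟨x ^ 2⟩` of order four at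
  `x ^ 2`, over which there are two distinct irreducible characters of the same degree. They are
  conjugate under a power map with exponent `1` modulo `4`, and since `g ^ 5` is conjugate to `g`,
  they coincide, a contradiction.

Hence `K` is a `2`-group of class two, and counting characters gives `|K / K'| = |K'| = |L| + 1`.
The involutions are the nontrivial elements of `K'`, on which `L` is transitive. Finally `L` is
nilpotent, because it meets the nilpotent residual trivially, and a nilpotent group of odd order
which acts without fixed points is cyclic.
-/

namespace GaloisFrobenius

open Representation
open scoped commutatorElement IsMulCommutative

/-! ### Representations and characters -/

section Irreducible

variable {k G V W : Type*} [Field k] [AddCommGroup V] [Module k V] [AddCommGroup W] [Module k W]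

theorem isIrreducible_iff [Monoid G] (ρ : Representation k G V) :
    ρ.IsIrreducible ↔ Nontrivial V ∧ ∀ U : Submodule k V,
      (∀ g, ∀ v ∈ U, ρ g v ∈ U) → U = ⊥ ∨ U = ⊤ := by
  refine ⟨fun h => ⟨?_, fun U hU => ?_⟩, fun ⟨hV, h⟩ =>
    { exists_pair_ne := ⟨⊥, ⊤, fun hbot => ?_⟩, eq_bot_or_eq_top := fun U => ?_ }⟩
  · by_contra hV
    rw [not_nontrivial_iff_subsingleton] at hV
    exact bot_ne_top (α := Subrepresentation ρ)
      (Subrepresentation.toSubmodule_injective (Subsingleton.elim _ _))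
  · exact (h.eq_bot_or_eq_top ⟨U, hU⟩).imp (congrArg Subrepresentation.toSubmodule)
      (congrArg Subrepresentation.toSubmodule)
  · exact bot_ne_top (α := Submodule k V) (congrArg Subrepresentation.toSubmodule hbot)
  · exact (h U.toSubmodule fun g v hv => U.apply_mem_toSubmodule g hv).imp
      (fun hU => Subrepresentation.toSubmodule_injective hU)
      (fun hU => Subrepresentation.toSubmodule_injective hU)

theorem isIrreducible_of_linearEquiv {H : Type*} [Monoid G] [Monoid H] {ρ : Representation k G V}
    (hρ : ρ.IsIrreducible) {σ : Representation k H W} {f : H →* G} (hf : Function.Surjective f)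
    (e : V ≃ₗ[k] W) (he : ∀ h v, σ h (e v) = e (ρ (f h) v)) : σ.IsIrreducible := by
  obtain ⟨hV, hsub⟩ := (isIrreducible_iff ρ).mp hρ
  refine (isIrreducible_iff σ).mpr ⟨e.symm.toEquiv.nontrivial, fun U hU => ?_⟩
  have hcomap : ∀ g, ∀ v ∈ U.comap e.toLinearMap, ρ g v ∈ U.comap e.toLinearMap := by
    intro g v hv
    obtain ⟨h, rfl⟩ := hf g
    simpa only [Submodule.mem_comap, LinearEquiv.coe_coe, he] using hU h (e v) hv
  have hU_eq : U = (U.comap e.toLinearMap).map e.toLinearMap :=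
    (Submodule.map_comap_eq_of_surjective e.surjective U).symm
  refine (hsub _ hcomap).imp (fun h => ?_) (fun h => ?_) <;> rw [hU_eq, h]
  · exact Submodule.map_bot _
  · exact (Submodule.map_top _).trans (LinearMap.range_eq_top.mpr e.surjective)

theorem isIrreducible_of_surjective_asAlgebraHom [Monoid G] [Nontrivial V]
    {ρ : Representation k G V} (hρ : Function.Surjective ρ.asAlgebraHom) : ρ.IsIrreducible := by
  refine (isIrreducible_iff ρ).mpr
    ⟨inferInstance, fun U hU => or_iff_not_imp_left.mpr fun hbot => ?_⟩
  have hmem : ∀ a : MonoidAlgebra k G, ∀ v ∈ U, ρ.asAlgebraHom a v ∈ U := by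
    intro a v hv
    induction a using MonoidAlgebra.induction_linear with
    | zero => simp
    | add x y hx hy => simpa using U.add_mem hx hy
    | single g c => simpa using U.smul_mem c (hU g v hv)
  obtain ⟨v, hv, hv0⟩ := U.ne_bot_iff.mp hbot
  refine eq_top_iff.mpr fun w _ => ?_
  obtain ⟨φ, hφ⟩ := not_forall.mp (mt (Module.forall_dual_apply_eq_zero_iff k v).mp hv0)
  obtain ⟨a, ha⟩ := hρ (φ.smulRight ((φ v)⁻¹ • w))
  simpa [ha, smul_smul, hφ] using hmem a v hv

theorem trace_asAlgebraHom_eq [Monoid G] {ρ : Representation k G V} {σ : Representation k G W}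
    (h : ρ.character = σ.character) (a : MonoidAlgebra k G) :
    LinearMap.trace k V (ρ.asAlgebraHom a) = LinearMap.trace k W (σ.asAlgebraHom a) := by
  induction a using MonoidAlgebra.induction_linear with
  | zero => simp
  | add x y hx hy => simp [hx, hy]
  | single g c =>
    have hg : LinearMap.trace k V (ρ g) = LinearMap.trace k W (σ g) := congrFun h g
    simp [hg]

theorem isIrreducibleCharacter_character {G V : Type*} [Group G] [AddCommGroup V] [Module ℂ V]
    [FiniteDimensional ℂ V] {ρ : Representation ℂ G V} (hρ : ρ.IsIrreducible) :
    IsIrreducibleCharacter ρ.character := by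
  let e : V ≃ₗ[ℂ] (Fin (Module.finrank ℂ V) → ℂ) := (Module.finBasis ℂ V).equivFun
  refine ⟨_, (e.conjAlgEquiv ℂ : Module.End ℂ V →* _).comp ρ,
    isIrreducible_of_linearEquiv hρ (f := .id G) Function.surjective_id e fun g v => ?_, ?_⟩
  · simp
  · exact funext fun g => LinearMap.trace_conj' (ρ g) e

end Irreducible

section Scalars

variable {k G V : Type*} [Field k] [Group G] [AddCommGroup V] [Module k V]

/-- The subgroup `M` acts by scalars in the representation `ρ`, through the linear character
`lam`: for irreducible `ρ` the character of `ρ` then *lies over* `lam`. -/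
def ActsByScalars (ρ : Representation k G V) (M : Subgroup G) (lam : M →* kˣ) : Prop :=
  ∀ m : M, ρ m = (lam m : k) • (1 : Module.End k V)

theorem exists_sum_smul_eq_smul_one [IsAlgClosed k] [FiniteDimensional k V] [Fintype G]
    {ρ : Representation k G V} (hρ : ρ.IsIrreducible) {c : G → k}
    (hc : ∀ g h, c (h * g * h⁻¹) = c g) : ∃ w : k, ∑ g, c g • ρ g = w • 1 := by
  have hcomm : ∀ h, (∑ g, c g • ρ g) * ρ h = ρ h * ∑ g, c g • ρ g := by
    intro h
    rw [Finset.sum_mul, Finset.mul_sum]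
    refine Fintype.sum_equiv (MulAut.conj h⁻¹).toEquiv _ _ fun g => ?_
    have hcg : c (h⁻¹ * (g * h)) = c g := by simpa [mul_assoc] using hc g h⁻¹
    simp [hcg, ← map_mul, mul_assoc]
  let f : IntertwiningMap ρ ρ := ⟨∑ g, c g • ρ g, fun h => hcomm h⟩
  obtain ⟨w, hw⟩ := (IsIrreducible.algebraMap_intertwiningMap_bijective_of_isAlgClosed (ρ := ρ)).2 f
  exact ⟨w, congrArg IntertwiningMap.toLinearMap hw.symm⟩

/-- `∑ ν(m)⁻¹ ρ(m)` is `|N|` times the projection onto the `ν`-isotypic part, which is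
`G`-invariant because `ν` is. -/
theorem trace_sum_inv_smul [FiniteDimensional k V] {ρ : Representation k G V}
    (hρ : ρ.IsIrreducible) (N : Subgroup G) [N.Normal] [Fintype N] {ν : N →* kˣ}
    (hν : ∀ g n, ν (MulAut.conjNormal g n) = ν n)
    [Decidable (ActsByScalars ρ N ν)] :
    LinearMap.trace k V (∑ m : N, ((ν m)⁻¹ : kˣ) • ρ m) =
      if ActsByScalars ρ N ν then (Nat.card N : k) * Module.finrank k V else 0 := by
  set E : Module.End k V := ∑ m : N, ((ν m)⁻¹ : kˣ) • ρ m with hE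
  have hmE : ∀ m : N, ρ m * E = (ν m : k) • E := by
    intro m
    rw [hE, Finset.mul_sum, Finset.smul_sum]
    refine Fintype.sum_equiv (Equiv.mulLeft m) _ _ fun n => ?_
    simp [Units.smul_def, smul_smul, mul_comm]
  have hgE : ∀ g, ρ g * E = E * ρ g := by
    intro g
    rw [hE, Finset.mul_sum, Finset.sum_mul]
    refine Fintype.sum_equiv (MulAut.conjNormal g).toEquiv _ _ fun n => ?_
    rw [mul_smul_comm, smul_mul_assoc, ← map_mul, ← map_mul]
    simp [hν]
  split_ifs with h
  · have hE_eq : E = (Nat.card N : k) • 1 := by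
      simp [hE, h _, Units.smul_def, smul_smul, Nat.cast_smul_eq_nsmul]
    rw [hE_eq, map_smul, LinearMap.trace_one, smul_eq_mul]
  · have hrange := ((isIrreducible_iff ρ).mp hρ).2 (LinearMap.range E) <| by
      rintro g _ ⟨v, rfl⟩
      exact ⟨ρ g v, (LinearMap.congr_fun (hgE g) v).symm⟩
    rcases hrange with hbot | htop
    · rw [LinearMap.range_eq_bot.mp hbot, map_zero]
    · refine absurd (fun m => LinearMap.ext fun v => ?_) h
      obtain ⟨w, rfl⟩ := LinearMap.range_eq_top.mp htop v
      exact LinearMap.congr_fun (hmE m) w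

end Scalars

section RootsOfUnity

theorem iSup_eigenspace_eq_top_of_pow_eq_one {K V : Type*} [Field K] [IsAlgClosed K]
    [AddCommGroup V] [Module K V] [FiniteDimensional K V] {A : Module.End K V} {n : ℕ}
    (hn : (n : K) ≠ 0) (hA : A ^ n = 1) : ⨆ μ, A.eigenspace μ = ⊤ :=
  (Module.End.isSemisimple_of_squarefree_aeval_eq_zero
    (Polynomial.X_pow_sub_one_separable_iff.mpr hn).squarefree
    (by simp [hA])).iSup_eigenspace_eq_top

theorem trace_pow_eq_sum_eigenvalues {K V : Type*} [Field K] [IsAlgClosed K]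
    [AddCommGroup V] [Module K V] [FiniteDimensional K V] {A : Module.End K V} {n : ℕ}
    (hn : (n : K) ≠ 0) (hA : A ^ n = 1) :
    ∃ (S : Finset K) (r : K → ℕ), (∀ μ ∈ S, μ ^ n = 1) ∧
      ∀ t : ℕ, LinearMap.trace K V (A ^ t) = ∑ μ ∈ S, (r μ : K) * μ ^ t := by
  classical
  have hint : DirectSum.IsInternal A.eigenspace :=
    DirectSum.isInternal_submodule_of_iSupIndep_of_iSup_eq_top A.eigenspaces_iSupIndep
      (iSup_eigenspace_eq_top_of_pow_eq_one hn hA)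
  have hfin : {μ | A.eigenspace μ ≠ ⊥}.Finite :=
    WellFoundedGT.finite_ne_bot_of_iSupIndep A.eigenspaces_iSupIndep
  have hpow : ∀ (t : ℕ) (μ : K), ∀ v ∈ A.eigenspace μ, (A ^ t) v = μ ^ t • v := by
    intro t μ v hv
    induction t with
    | zero => simp
    | succ t ih =>
      rw [pow_succ, Module.End.mul_apply, Module.End.mem_eigenspace_iff.mp hv, map_smul, ih,
        smul_smul, pow_succ']
  refine ⟨hfin.toFinset, fun μ => Module.finrank K (A.eigenspace μ), fun μ hμ => ?_, fun t => ?_⟩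
  · obtain ⟨v, hv, hv0⟩ := (Submodule.ne_bot_iff _).mp (hfin.mem_toFinset.mp hμ)
    have hv_eq : μ ^ n • v = (1 : K) • v := by
      rw [← hpow n μ v hv, hA, Module.End.one_apply, one_smul]
    exact smul_left_injective K hv0 hv_eq
  · have hmaps : ∀ μ, Set.MapsTo (A ^ t) (A.eigenspace μ) (A.eigenspace μ) := fun μ v hv => by
      rw [hpow t μ v hv]
      exact Submodule.smul_mem _ _ hv
    rw [LinearMap.trace_eq_sum_trace_restrict' hint hfin hmaps]
    refine Finset.sum_congr rfl fun μ _ => ?_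
    have hrestrict : (A ^ t).restrict (hmaps μ) = μ ^ t • 1 :=
      LinearMap.ext fun v => Subtype.ext (hpow t μ v v.2)
    rw [hrestrict, map_smul, LinearMap.trace_one, smul_eq_mul, mul_comm]

theorem isIntegral_character {G V : Type*} [Group G] [Finite G] [AddCommGroup V] [Module ℂ V]
    [FiniteDimensional ℂ V] (ρ : Representation ℂ G V) (g : G) :
    IsIntegral ℤ (ρ.character g) := by
  have hG : Nat.card G ≠ 0 := Nat.card_pos.ne'
  obtain ⟨S, r, hS, htrace⟩ := trace_pow_eq_sum_eigenvalues (A := ρ g)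
    (Nat.cast_ne_zero.mpr hG) (by rw [← map_pow, pow_card_eq_one', map_one])
  rw [Representation.character, ← pow_one (ρ g), htrace]
  refine IsIntegral.sum _ fun μ hμ => .mul ?_ ?_
  · exact isIntegral_algebraMap (R := ℤ) (x := (r μ : ℤ))
  · rw [pow_one]
    exact .of_pow (Nat.pos_of_ne_zero hG) (hS μ hμ ▸ isIntegral_one)

theorem exists_coprime_of_galoisConjugate {G : Type*} [Group G] [Finite G] {χ ψ : G → ℂ}
    (hχ : IsIrreducibleCharacter χ) (h : GaloisConjugate χ ψ) :
    ∃ t : ℕ, t.Coprime (Nat.card G) ∧ ∀ g, ψ g = χ (g ^ t) := by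
  obtain ⟨n, hn, hdvd, α, hα⟩ := h
  obtain ⟨d, ρ, -, rfl⟩ := hχ
  have : NeZero n := ⟨hn.ne'⟩
  let F := cyclotomicSubfield n
  have hroot : ∀ μ : ℂ, μ ^ n = 1 → μ ∈ F := fun μ hμ => IntermediateField.subset_adjoin _ _ hμ
  have hζ := Complex.isPrimitiveRoot_exp n hn.ne'
  set ζ := Complex.exp (2 * Real.pi * Complex.I / n)
  let z : F := ⟨ζ, hroot ζ hζ.pow_eq_one⟩
  have hz : IsPrimitiveRoot z n := .of_map_of_injective (f := F.val) hζ F.val.injective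
  have hαz : IsPrimitiveRoot ((α z : F) : ℂ) n :=
    (hz.map_of_injective (f := α) α.injective).map_of_injective (f := F.val) F.val.injective
  obtain ⟨t, -, ht, hzt⟩ := hζ.isPrimitiveRoot_iff.mp hαz
  have hα_root : ∀ w : F, (w : ℂ) ^ n = 1 → (α w : ℂ) = (w : ℂ) ^ t := by
    intro w hw
    obtain ⟨i, -, hi⟩ := hζ.eq_pow_of_pow_eq_one hw
    have hwz : w = z ^ i := Subtype.ext (by simp [z, hi])
    rw [hwz, map_pow]
    push_cast
    rw [← hzt, ← pow_mul, ← pow_mul, mul_comm]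
  refine ⟨t, ht.coprime_dvd_right hdvd, fun g => ?_⟩
  have hg : g ^ n = 1 := orderOf_dvd_iff_pow_eq_one.mp ((orderOf_dvd_natCard g).trans hdvd)
  obtain ⟨S, r, hS, htrace⟩ := trace_pow_eq_sum_eigenvalues (A := ρ g)
    (Nat.cast_ne_zero.mpr hn.ne') (by rw [← map_pow, hg, map_one])
  obtain ⟨w, hw, hαw⟩ := hα g
  have hw_sum : w = ∑ μ : S, (r μ : F) * ⟨μ, hroot μ (hS μ μ.2)⟩ := by
    refine Subtype.ext ?_
    rw [hw, Representation.character, ← pow_one (ρ g), htrace, ← Finset.sum_coe_sort]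
    simp
  rw [← hαw, hw_sum, Representation.character, map_pow, htrace, ← Finset.sum_coe_sort S]
  simp only [map_sum, map_mul, map_natCast]
  push_cast
  exact Finset.sum_congr rfl fun μ _ => by rw [hα_root _ (hS μ μ.2)]

end RootsOfUnity

/-! ### Degrees of irreducible characters -/

theorem dvd_of_isIntegral_div {a b : ℕ} (hb : b ≠ 0) (h : IsIntegral ℤ ((a : ℂ) / b)) : b ∣ a := by
  have hcast : (a : ℂ) / b = algebraMap ℚ ℂ ((a : ℚ) / b) := by simp
  rw [hcast, isIntegral_algebraMap_iff (algebraMap ℚ ℂ).injective,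
    IsIntegrallyClosed.isIntegral_iff] at h
  obtain ⟨m, hm⟩ := h
  rw [eq_intCast, eq_div_iff (Nat.cast_ne_zero.mpr hb)] at hm
  exact Int.natCast_dvd_natCast.mp ⟨m, by exact_mod_cast hm.symm.trans (mul_comm _ _)⟩

theorem isIntegral_of_sum_smul_eq_smul_one {G V : Type*} [Group G] [Fintype G] [AddCommGroup V]
    [Module ℂ V] [Nontrivial V] (ρ : Representation ℂ G V) {c : G → ℂ}
    (hc : ∀ g, IsIntegral ℤ (c g)) {w : ℂ} (hw : ∑ g, c g • ρ g = w • 1) : IsIntegral ℤ w := by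
  let A := integralClosure ℤ ℂ
  let φ : MonoidAlgebra A G →ₐ[A] Module.End ℂ V := MonoidAlgebra.lift A (Module.End ℂ V) G ρ
  let z : MonoidAlgebra A G := ∑ g, MonoidAlgebra.single g (⟨c g, hc g⟩ : A)
  have hφz : φ z = (Algebra.ofId ℂ (Module.End ℂ V)).restrictScalars A w := by
    have hsum : φ z = ∑ g, c g • ρ g := by
      simp only [z, φ, map_sum, MonoidAlgebra.lift_single]
      rfl
    rw [hsum, hw]
    exact (Algebra.algebraMap_eq_smul_one w).symm
  have hint : IsIntegral A (φ z) := (IsIntegral.of_finite A z).map φ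
  rw [hφz, isIntegral_algHom_iff _ (algebraMap ℂ (Module.End ℂ V)).injective] at hint
  exact isIntegral_trans w hint

theorem finrank_dvd_card {G V : Type*} [Group G] [Finite G] [AddCommGroup V] [Module ℂ V]
    [FiniteDimensional ℂ V] {ρ : Representation ℂ G V} (hρ : ρ.IsIrreducible) :
    Module.finrank ℂ V ∣ Nat.card G := by
  have := Fintype.ofFinite G
  have : Nontrivial V := ((isIrreducible_iff ρ).mp hρ).1
  have hd : Module.finrank ℂ V ≠ 0 := Module.finrank_pos.ne'
  have hG : (Nat.card G : ℂ) ≠ 0 := Nat.cast_ne_zero.mpr Nat.card_pos.ne'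
  have : Invertible (Nat.card G : ℂ) := invertibleOfNonzero hG
  obtain ⟨w, hw⟩ := exists_sum_smul_eq_smul_one hρ (c := fun g => ρ.character g⁻¹)
    fun g h => by simpa [mul_assoc] using ρ.char_conj g⁻¹ h
  have hw_eq : w = (Nat.card G : ℂ) / Module.finrank ℂ V := by
    have horth := char_orthonormal ρ ρ
    rw [if_pos ⟨Representation.Equiv.refl ρ⟩, inv_mul_eq_one₀ hG] at horth
    have htrace := congrArg (LinearMap.trace ℂ V) hw
    simp only [map_sum, map_smul, LinearMap.trace_one, smul_eq_mul] at htrace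
    rw [eq_div_iff (Nat.cast_ne_zero.mpr hd), ← htrace, horth]
    exact Finset.sum_congr rfl fun g _ => mul_comm _ _
  exact dvd_of_isIntegral_div hd (hw_eq ▸ isIntegral_of_sum_smul_eq_smul_one ρ
    (fun g => isIntegral_character ρ g⁻¹) hw)

section Wedderburn

theorem trace_mulLeft_pi_matrix {R ι : Type*} [CommRing R] [Fintype ι] {n : ι → Type*}
    [∀ i, Fintype (n i)] (x : Π i, Matrix (n i) (n i) R) :
    LinearMap.trace R _ (LinearMap.mulLeft R x) = ∑ i, (Fintype.card (n i) : R) * (x i).trace := by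
  classical
  let b := Pi.basis fun i => Matrix.stdBasis R (n i) (n i)
  have hdiag : ∀ i j k,
      (LinearMap.toMatrix b b (LinearMap.mulLeft R x)).diag ⟨i, j, k⟩ = x i j j := by
    intro i j k
    have hrepr : (Matrix.stdBasis R (n i) (n i)).repr (x i * Matrix.single j k 1) (j, k) =
      (x i * Matrix.single j k 1 : Matrix (n i) (n i) R) j k := rfl
    rw [Matrix.diag_apply, LinearMap.toMatrix_apply, LinearMap.mulLeft_apply]
    simp [b, Pi.basis_apply, Pi.basis_repr, Matrix.stdBasis_eq_single, hrepr]
  rw [LinearMap.trace_eq_matrix_trace R b, Matrix.trace, Fintype.sum_sigma]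
  refine Finset.sum_congr rfl fun i _ => ?_
  simp only [Fintype.sum_prod_type, hdiag, Matrix.trace, Finset.mul_sum, Finset.sum_const,
    Finset.card_univ, nsmul_eq_mul, Matrix.diag_apply]

theorem trace_mulLeft_single {R G : Type*} [CommRing R] [Group G] [Finite G] [DecidableEq G]
    (g : G) : LinearMap.trace R _ (LinearMap.mulLeft R (MonoidAlgebra.single g (1 : R))) =
      if g = 1 then (Nat.card G : R) else 0 := by
  have := Fintype.ofFinite G
  let b := MonoidAlgebra.basis G R
  have hdiag : ∀ h, (LinearMap.toMatrix b b
      (LinearMap.mulLeft R (MonoidAlgebra.single g (1 : R)))).diag h = if g = 1 then 1 else 0 := by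
    intro h
    rw [Matrix.diag_apply, LinearMap.toMatrix_apply, LinearMap.mulLeft_apply,
      MonoidAlgebra.basis_apply, MonoidAlgebra.single_mul_single, mul_one,
      ← MonoidAlgebra.basis_apply, Module.Basis.repr_self, Finsupp.single_apply]
    simp only [mul_eq_right]
  rw [LinearMap.trace_eq_matrix_trace R b, Matrix.trace, Finset.sum_congr rfl fun h _ => hdiag h]
  split_ifs <;> simp

variable {k G ι : Type*} [Field k] [Group G] {n : ι → Type*} [∀ i, Fintype (n i)]
  [∀ i, DecidableEq (n i)] (e : MonoidAlgebra k G ≃ₐ[k] Π i, Matrix (n i) (n i) k)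

/-- The representation of `G` on the column vectors of the `i`-th matrix block of a Wedderburn
decomposition of the group algebra. -/
noncomputable def wedderburnRep (i : ι) : Representation k G (n i → k) :=
  (MonoidAlgebra.lift k _ G).symm <|
    ((Matrix.toLinAlgEquiv' : Matrix (n i) (n i) k ≃ₐ[k] _) : _ →ₐ[k] _).comp <|
      (Pi.evalAlgHom k (fun i => Matrix (n i) (n i) k) i).comp (e : _ →ₐ[k] _)

theorem asAlgebraHom_wedderburnRep (i : ι) (a : MonoidAlgebra k G) :
    (wedderburnRep e i).asAlgebraHom a = Matrix.toLin' (e a i) := by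
  rw [asAlgebraHom_def, wedderburnRep, Equiv.apply_symm_apply]
  rfl

theorem wedderburnRep_apply (i : ι) (g : G) :
    wedderburnRep e i g = Matrix.toLin' (e (MonoidAlgebra.single g 1) i) := by
  rw [← asAlgebraHom_wedderburnRep, asAlgebraHom_single_one]

theorem isIrreducible_wedderburnRep (i : ι) [Nonempty (n i)] :
    (wedderburnRep e i).IsIrreducible := by
  classical
  refine isIrreducible_of_surjective_asAlgebraHom fun f =>
    ⟨e.symm (Pi.single i (LinearMap.toMatrix' f)), ?_⟩
  rw [asAlgebraHom_wedderburnRep, e.apply_symm_apply, Pi.single_eq_same, Matrix.toLin'_toMatrix']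

theorem injective_character_wedderburnRep [CharZero k] [∀ i, Nonempty (n i)] :
    Function.Injective fun i => (wedderburnRep e i).character := by
  classical
  intro i j hij
  by_contra hne
  have htrace := trace_asAlgebraHom_eq hij (e.symm (Pi.single i 1))
  rw [asAlgebraHom_wedderburnRep, asAlgebraHom_wedderburnRep, e.apply_symm_apply,
    Pi.single_eq_same, Pi.single_eq_of_ne (Ne.symm hne)] at htrace
  simp at htrace

theorem sum_card_mul_character_wedderburnRep [Fintype ι] [Finite G] [DecidableEq G] (g : G) :
    ∑ i, (Fintype.card (n i) : k) * (wedderburnRep e i).character g =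
      if g = 1 then (Nat.card G : k) else 0 := by
  have hconj : e.toLinearEquiv.conj (LinearMap.mulLeft k (MonoidAlgebra.single g (1 : k))) =
      LinearMap.mulLeft k (e (MonoidAlgebra.single g 1)) :=
    LinearMap.ext fun v => by simp [LinearEquiv.conj_apply]
  rw [← trace_mulLeft_single, ← LinearMap.trace_conj' _ e.toLinearEquiv, hconj,
    trace_mulLeft_pi_matrix]
  simp only [Representation.character, wedderburnRep_apply, Matrix.trace_toLin'_eq]

end Wedderburn

/-- `χ` is an irreducible character of `K` lying over the linear character `lam` of `M`. The
representation is required to restrict to `M` as a multiple of `lam`, which is the case of interest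
here: `lam` will be invariant under `K`. -/
def IrrOver {K : Type*} [Group K] (M : Subgroup K) (lam : M →* ℂˣ) (χ : K → ℂ) : Prop :=
  ∃ (d : ℕ) (ρ : Representation ℂ K (Fin d → ℂ)), ρ.IsIrreducible ∧ ρ.character = χ ∧
    ActsByScalars ρ M lam

/-- Multiplying the regular character by `ν⁻¹` and summing over `N` leaves only the irreducible
characters over `ν`. -/
theorem exists_finset_irrOver_sum_sq {G : Type*} [Group G] [Finite G] (N : Subgroup G) [N.Normal]
    {ν : N →* ℂˣ} (hν : ∀ g n, ν (MulAut.conjNormal g n) = ν n) :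
    ∃ S : Finset (G → ℂ), (∀ χ ∈ S, IrrOver N ν χ) ∧ ∑ χ ∈ S, χ 1 ^ 2 = (N.index : ℂ) := by
  classical
  have := Fintype.ofFinite G
  have : NeZero (Nat.card G : ℂ) := ⟨Nat.cast_ne_zero.mpr Nat.card_pos.ne'⟩
  obtain ⟨n, d, hd, ⟨e⟩⟩ :=
    IsSemisimpleRing.exists_algEquiv_pi_matrix_of_isAlgClosed ℂ (MonoidAlgebra ℂ G)
  let ρ := wedderburnRep e
  have hirr : ∀ i, (ρ i).IsIrreducible := fun i => isIrreducible_wedderburnRep e i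
  refine ⟨({i | ActsByScalars (ρ i) N ν} : Finset _).image fun i => (ρ i).character, ?_, ?_⟩
  · simp only [Finset.mem_image, Finset.mem_filter_univ]
    rintro _ ⟨i, hi, rfl⟩
    exact ⟨d i, ρ i, hirr i, rfl, hi⟩
  have hproj : ∀ i, ∑ m : N, (((ν m)⁻¹ : ℂˣ) : ℂ) * (ρ i).character m =
      if ActsByScalars (ρ i) N ν then (Nat.card N : ℂ) * d i else 0 := by
    intro i
    have htrace := trace_sum_inv_smul (hirr i) N hν
    rw [Module.finrank_fin_fun] at htrace
    rw [← htrace, map_sum]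
    exact Finset.sum_congr rfl fun m _ => (map_smul (LinearMap.trace ℂ _) _ _).symm
  have hcount : (Nat.card N : ℂ) * ∑ i, (if ActsByScalars (ρ i) N ν then (d i : ℂ) ^ 2 else 0) =
      Nat.card N * N.index := by
    calc _ = ∑ i, (d i : ℂ) * ∑ m : N, (((ν m)⁻¹ : ℂˣ) : ℂ) * (ρ i).character m := by
          simp only [hproj, Finset.mul_sum, mul_ite, mul_zero]
          exact Finset.sum_congr rfl fun i _ => by congr 1; ring
      _ = ∑ m : N, (((ν m)⁻¹ : ℂˣ) : ℂ) * ∑ i, (d i : ℂ) * (ρ i).character m := by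
          simp only [Finset.mul_sum]
          rw [Finset.sum_comm]
          exact Finset.sum_congr rfl fun m _ => Finset.sum_congr rfl fun i _ => by ring
      _ = ∑ m : N, (((ν m)⁻¹ : ℂˣ) : ℂ) * if (m : G) = 1 then (Nat.card G : ℂ) else 0 := by
          simp only [ρ, ← sum_card_mul_character_wedderburnRep e, Fintype.card_fin]
      _ = Nat.card N * N.index := by
          simp only [OneMemClass.coe_eq_one, mul_ite, mul_zero, Finset.sum_ite_eq',
            Finset.mem_univ, if_true, map_one, inv_one, Units.val_one, one_mul,
            ← N.card_mul_index, Nat.cast_mul]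
  rw [Finset.sum_image fun i _ j _ h => injective_character_wedderburnRep e h,
    Finset.sum_filter, ← mul_left_cancel₀ (Nat.cast_ne_zero.mpr Nat.card_pos.ne') hcount]
  exact Finset.sum_congr rfl fun i _ => by rw [char_one, Module.finrank_fin_fun]

namespace IrrOver

variable {K : Type*} [Group K] {M : Subgroup K} {lam : M →* ℂˣ} {χ : K → ℂ}

theorem mono {N : Subgroup K} (hN : N ≤ M) (h : IrrOver M lam χ) :
    IrrOver N (lam.comp (Subgroup.inclusion hN)) χ := by
  obtain ⟨d, ρ, hρ, hχ, hscalar⟩ := h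
  exact ⟨d, ρ, hρ, hχ, fun m => hscalar (Subgroup.inclusion hN m)⟩

theorem apply_mul_pow (h : IrrOver M lam χ) (g : K) (m : M) (t : ℕ) :
    χ ((g * m) ^ t) = (lam m : ℂ) ^ t * χ (g ^ t) := by
  obtain ⟨d, ρ, -, rfl, hscalar⟩ := h
  have hgm : ρ (g * m) = (lam m : ℂ) • ρ g := by rw [map_mul, hscalar, mul_smul_comm, mul_one]
  rw [character, character, map_pow, hgm, smul_pow, map_smul, smul_eq_mul, map_pow ρ]

theorem apply_mul (h : IrrOver M lam χ) (g : K) (m : M) : χ (g * m) = lam m * χ g := by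
  simpa using h.apply_mul_pow g m 1

theorem apply_coe (h : IrrOver M lam χ) (m : M) : χ m = lam m * χ 1 := by
  simpa using h.apply_mul 1 m

theorem apply_conj (h : IrrOver M lam χ) (g k : K) : χ (k * g * k⁻¹) = χ g := by
  obtain ⟨d, ρ, -, rfl, -⟩ := h
  exact ρ.char_conj g k

theorem exists_degree [Finite K] (h : IrrOver M lam χ) :
    ∃ d : ℕ, 0 < d ∧ χ 1 = d ∧ d ∣ Nat.card K := by
  obtain ⟨d, ρ, hρ, rfl, -⟩ := h
  have := ((isIrreducible_iff ρ).mp hρ).1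
  exact ⟨Module.finrank ℂ (Fin d → ℂ), Module.finrank_pos, ρ.char_one, finrank_dvd_card hρ⟩

theorem apply_one_ne_zero [Finite K] (h : IrrOver M lam χ) : χ 1 ≠ 0 := by
  obtain ⟨d, hd, hχ, -⟩ := h.exists_degree
  rw [hχ]
  exact_mod_cast hd.ne'

theorem sum_mul_inv [Fintype K] (h : IrrOver M lam χ) : ∑ g, χ g * χ g⁻¹ = Nat.card K := by
  obtain ⟨d, ρ, hρ, rfl, -⟩ := h
  have hcard : (Nat.card K : ℂ) ≠ 0 := by exact_mod_cast Nat.card_pos.ne'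
  have : Invertible (Nat.card K : ℂ) := invertibleOfNonzero hcard
  have horth := char_orthonormal ρ ρ
  rw [if_pos ⟨Representation.Equiv.refl ρ⟩, inv_mul_eq_one₀ hcard] at horth
  exact horth.symm

theorem comp {H : Type*} [Group H] (h : IrrOver M lam χ) (f : H →* K)
    (hf : Function.Surjective f) :
    IrrOver (M.comap f) (lam.comp (f.subgroupComap M)) (χ ∘ f) := by
  obtain ⟨d, ρ, hρ, rfl, hscalar⟩ := h
  exact ⟨d, ρ.comp f, isIrreducible_of_linearEquiv hρ hf (.refl ℂ _) fun _ _ => rfl, rfl,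
    fun m => hscalar (f.subgroupComap M m)⟩

end IrrOver

section LinearCharacters

variable {M : Type*} [Group M]

theorem eq_of_pow_eq_pow_of_coprime [Finite M] {A : Type*} [CommGroup A] {t : ℕ}
    (ht : t.Coprime (Nat.card M)) {α β : M →* A} (h : α ^ t = β ^ t) : α = β := by
  refine mul_inv_eq_one.mp (MonoidHom.ext fun m => ?_)
  have hpow : (α * β⁻¹) m ^ t.gcd (Nat.card M) = 1 :=
    pow_gcd_eq_one.mpr ⟨by rw [← MonoidHom.pow_apply, mul_pow, inv_pow, h, mul_inv_cancel]; rfl,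
      by rw [← map_pow, pow_card_eq_one', map_one]⟩
  rwa [ht.gcd_eq_one, pow_one] at hpow

variable [DecidableEq (M →* ℂˣ)]

theorem sum_mul_inv_eq_ite [Fintype M] (α β : M →* ℂˣ) :
    ∑ m : M, (α m : ℂ) * ((β m)⁻¹ : ℂˣ) = if α = β then (Nat.card M : ℂ) else 0 := by
  have htrivial : (Units.coeHom ℂ).comp (α * β⁻¹) = 1 ↔ α = β := by
    rw [← mul_inv_eq_one (a := α)]
    exact ⟨fun h => MonoidHom.ext fun m => Units.ext (DFunLike.congr_fun h m),
      fun h => by rw [h]; rfl⟩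
  simpa [htrivial] using sum_hom_units ((Units.coeHom ℂ).comp (α * β⁻¹))

theorem sum_ite_eq_of_sum_mul_eq [Finite M] {ι : Type*} [Fintype ι] {α β : ι → M →* ℂˣ}
    {a b : ι → ℂ} (h : ∀ m, ∑ i, (α i m : ℂ) * a i = ∑ i, (β i m : ℂ) * b i) (μ : M →* ℂˣ) :
    (∑ i, if α i = μ then a i else 0) = ∑ i, if β i = μ then b i else 0 := by
  have := Fintype.ofFinite M
  have hproj : ∀ (γ : ι → M →* ℂˣ) (c : ι → ℂ),
      ∑ m, (∑ i, (γ i m : ℂ) * c i) * ((μ m)⁻¹ : ℂˣ) =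
        Nat.card M * ∑ i, if γ i = μ then c i else 0 := by
    intro γ c
    simp_rw [Finset.sum_mul, mul_right_comm _ (c _)]
    rw [Finset.sum_comm, Finset.mul_sum]
    refine Finset.sum_congr rfl fun i _ => ?_
    rw [← Finset.sum_mul, sum_mul_inv_eq_ite, ite_mul, zero_mul, mul_ite, mul_zero]
  have hM : (Nat.card M : ℂ) ≠ 0 := by exact_mod_cast Nat.card_pos.ne'
  refine mul_left_cancel₀ hM ?_
  rw [← hproj α a, ← hproj β b]
  exact Finset.sum_congr rfl fun m _ => by rw [h]

end LinearCharacters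

section Action

variable (L K : Type*) [Group L] [Group K] [MulDistribMulAction L K]

/-- Only the identity of `K` is fixed by a nontrivial element of `L`. -/
def IsFixedPointFree : Prop := ∀ l : L, l ≠ 1 → ∀ k : K, l • k = k → k = 1

variable {K} in
/-- Subgroups of `K` mapped into themselves by `L`. -/
def IsInvariant (M : Subgroup K) : Prop := ∀ l : L, ∀ m ∈ M, l • m ∈ M

/-- Irreducible characters of `K` of the same degree, lying over nontrivial linear characters of
`L`-invariant normal subgroups, are conjugate under `L` and power maps; this is what remains on
`K` of the condition `GC*` for `K ⋊ L`. -/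
def IsGaloisTransitive : Prop :=
  ∀ M : Subgroup K, M.Normal → IsInvariant L M → ∀ lam₁ lam₂ : M →* ℂˣ, lam₁ ≠ 1 → lam₂ ≠ 1 →
    ∀ χ₁ χ₂ : K → ℂ, IrrOver M lam₁ χ₁ → IrrOver M lam₂ χ₂ → χ₁ 1 = χ₂ 1 →
      ∃ (l : L) (t : ℕ), t.Coprime (Nat.card K) ∧ ∀ g, χ₂ g = χ₁ (l • g ^ t)

variable {L K}

/-- The endomorphism of an `L`-invariant subgroup given by an element of `L`. -/
def IsInvariant.toMonoidHom {M : Subgroup K} (hM : IsInvariant L M) (l : L) : M →* M :=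
  ((MulDistribMulAction.toMonoidHom K l).comp M.subtype).codRestrict M fun m => hM l m m.2

/-- The conjugate by `x : L` of a linear character of an `L`-invariant subgroup. -/
def twist {M : Subgroup K} (hM : IsInvariant L M) (lam : M →* ℂˣ) (x : L) : M →* ℂˣ :=
  lam.comp (hM.toMonoidHom x)

theorem twist_apply {M : Subgroup K} (hM : IsInvariant L M) (lam : M →* ℂˣ) (x : L) (m : M) :
    twist hM lam x m = lam (hM.toMonoidHom x m) := rfl

theorem twist_one {M : Subgroup K} (hM : IsInvariant L M) (lam : M →* ℂˣ) :
    twist hM lam 1 = lam := by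
  ext m
  exact congrArg (fun n => (lam n : ℂ)) (Subtype.ext (one_smul L (m : K)))

theorem IrrOver.sum_apply_smul_mul_pow [Fintype L] {M : Subgroup K} (hM : IsInvariant L M)
    {lam : M →* ℂˣ} {χ : K → ℂ} (h : IrrOver M lam χ) (k : K) (m : M) (t : ℕ) :
    ∑ x : L, χ (x • (k * m) ^ t) = ∑ x : L, ((twist hM lam x ^ t) m : ℂ) * χ (x • k ^ t) := by
  refine Finset.sum_congr rfl fun x _ => ?_
  rw [smul_pow', smul_mul', smul_pow', MonoidHom.pow_apply, Units.val_pow_eq_pow_val]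
  exact h.apply_mul_pow (x • k) (hM.toMonoidHom x m) t

section FixedPointFree

variable [Finite K] (h : IsFixedPointFree L K)
include h

theorem IsFixedPointFree.exists_div_smul_eq {l : L} (hl : l ≠ 1) {M : Subgroup K}
    (hM : IsInvariant L M) {m : K} (hm : m ∈ M) : ∃ k ∈ M, k / l • k = m := by
  have hfixed : MonoidHom.FixedPointFree (hM.toMonoidHom l) := fun k hk =>
    Subtype.ext (h l hl k (congrArg Subtype.val hk))
  obtain ⟨k, hk⟩ := hfixed.commutatorMap_surjective ⟨m, hm⟩
  exact ⟨k, k.2, congrArg Subtype.val hk⟩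

theorem IsFixedPointFree.eq_one_of_twist_eq {M : Subgroup K} (hM : IsInvariant L M)
    {lam : M →* ℂˣ} (hlam : lam ≠ 1) {l : L} (hl : twist hM lam l = lam) : l = 1 := by
  by_contra hne
  refine hlam (MonoidHom.ext fun ⟨m, hm⟩ => ?_)
  obtain ⟨k, hk, rfl⟩ := h.exists_div_smul_eq hne hM hm
  have hdiv : (⟨k / l • k, hm⟩ : M) = ⟨k, hk⟩ / hM.toMonoidHom l ⟨k, hk⟩ := rfl
  rw [hdiv, map_div, ← twist_apply, hl, div_self', MonoidHom.one_apply]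

theorem IsFixedPointFree.twist_injective {M : Subgroup K} (hM : IsInvariant L M) {lam : M →* ℂˣ}
    (hlam : lam ≠ 1) : Function.Injective (twist hM lam) := by
  intro x y hxy
  refine mul_inv_eq_one.mp (h.eq_one_of_twist_eq hM hlam (MonoidHom.ext fun m => ?_))
  have hy : hM.toMonoidHom (x * y⁻¹) m = hM.toMonoidHom x (hM.toMonoidHom y⁻¹ m) :=
    Subtype.ext (mul_smul x y⁻¹ (m : K))
  rw [twist_apply, hy, ← twist_apply, hxy, twist_apply]
  exact congrArg lam (Subtype.ext (smul_inv_smul y (m : K)))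

theorem IsFixedPointFree.of_surjective {H : Type*} [Group H] [MulDistribMulAction L H]
    {f : K →* H} (hf : Function.Surjective f) (hfl : ∀ (l : L) k, f (l • k) = l • f k) :
    IsFixedPointFree L H := by
  intro l hl h' hh'
  obtain ⟨k, rfl⟩ := hf h'
  have hker : IsInvariant L f.ker := fun l m hm => by
    rw [MonoidHom.mem_ker] at hm ⊢
    rw [hfl, hm, smul_one]
  have hk : k⁻¹ / l • k⁻¹ ∈ f.ker := by
    rw [MonoidHom.mem_ker, map_div, hfl, map_inv, smul_inv', hh', div_self']
  obtain ⟨n, hn, hnk⟩ := h.exists_div_smul_eq hl hker hk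
  have hfixed : l • (k * n) = k * n := by
    have := congrArg (k * · * l • n) hnk
    simpa [div_eq_mul_inv, smul_inv', mul_assoc, eq_comm] using this
  rw [eq_inv_of_mul_eq_one_left (h l hl _ hfixed)]
  exact f.ker.inv_mem hn

end FixedPointFree

theorem IsGaloisTransitive.of_surjective {H : Type*} [Group H] [Finite K]
    [MulDistribMulAction L H] (h : IsGaloisTransitive L K) {f : K →* H}
    (hf : Function.Surjective f) (hfl : ∀ (l : L) k, f (l • k) = l • f k) :
    IsGaloisTransitive L H := by
  intro M hM hML lam₁ lam₂ h₁ h₂ χ₁ χ₂ hχ₁ hχ₂ hdeg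
  have hne : ∀ lam : M →* ℂˣ, lam ≠ 1 → lam.comp (f.subgroupComap M) ≠ 1 := by
    intro lam hlam hcomp
    refine hlam (MonoidHom.ext fun m => ?_)
    obtain ⟨x, rfl⟩ := f.subgroupComap_surjective_of_surjective M hf m
    exact DFunLike.congr_fun hcomp x
  have hinv : IsInvariant L (M.comap f) := fun l m hm => by
    rw [Subgroup.mem_comap] at hm ⊢
    exact hfl l m ▸ hML l _ hm
  obtain ⟨l, t, ht, hconj⟩ := h (M.comap f) (hM.comap f) hinv _ _ (hne _ h₁) (hne _ h₂) _ _
    (hχ₁.comp f hf) (hχ₂.comp f hf) (by simpa using hdeg)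
  refine ⟨l, t, ht.coprime_dvd_right (Subgroup.card_dvd_of_surjective f hf), fun g => ?_⟩
  obtain ⟨k, rfl⟩ := hf g
  simpa [hfl] using hconj k

end Action

section Induction

variable {k L K V : Type*} [Field k] [Group L] [Group K] [MulDistribMulAction L K]
  [AddCommGroup V] [Module k V]

/-- The representation of `K ⋊ L` induced from a representation of `K`, realised on the functions
on `L`. -/
def indRep (ρ : Representation k K V) :
    Representation k (K ⋊[MulDistribMulAction.toMulAut L K] L) (L → V) where
  toFun g :=
    { toFun := fun f x => ρ (x • g.left) (f (x * g.right))
      map_add' := fun f f' => by ext x; simp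
      map_smul' := fun c f => by ext x; simp }
  map_one' := by ext f x; simp
  map_mul' g h := by
    refine LinearMap.ext fun f => funext fun x => ?_
    simp [mul_smul, mul_assoc]

theorem indRep_apply (ρ : Representation k K V) (g : K ⋊[MulDistribMulAction.toMulAut L K] L)
    (f : L → V) (x : L) : indRep ρ g f x = ρ (x • g.left) (f (x * g.right)) := rfl

theorem indRep_inl_single [DecidableEq L] (ρ : Representation k K V) (g : K) (x : L) (v : V) :
    indRep ρ (SemidirectProduct.inl g) (Pi.single x v) = Pi.single x (ρ (x • g) v) := by
  ext y
  rcases eq_or_ne y x with rfl | hyx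
  · simp [indRep_apply]
  · simp [indRep_apply, hyx]

theorem indRep_inr_single [DecidableEq L] (ρ : Representation k K V) (l x : L) (v : V) :
    indRep ρ (SemidirectProduct.inr l) (Pi.single x v) = Pi.single (x * l⁻¹) v := by
  ext y
  rcases eq_or_ne y (x * l⁻¹) with rfl | hyx
  · simp [indRep_apply]
  · simp [indRep_apply, hyx, mt eq_mul_inv_of_mul_eq hyx]

theorem character_indRep_inl [Fintype L] [FiniteDimensional k V] (ρ : Representation k K V)
    (g : K) :
    (indRep (L := L) ρ).character (SemidirectProduct.inl g) = ∑ x : L, ρ.character (x • g) := by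
  classical
  let b := Module.Free.chooseBasis k V
  rw [character, LinearMap.trace_eq_matrix_trace k (Pi.basis fun _ : L => b), Matrix.trace,
    Fintype.sum_sigma]
  refine Finset.sum_congr rfl fun x _ => ?_
  rw [character, LinearMap.trace_eq_matrix_trace k b, Matrix.trace]
  refine Finset.sum_congr rfl fun i _ => ?_
  rw [Matrix.diag_apply, Matrix.diag_apply, LinearMap.toMatrix_apply, LinearMap.toMatrix_apply,
    Pi.basis_repr, indRep_apply]
  simp [Pi.basis_apply]

end Induction

section Irreducible

variable {L K V : Type*} [Group L] [Group K] [MulDistribMulAction L K] [AddCommGroup V]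
  [Module ℂ V] {ρ : Representation ℂ K V} {M : Subgroup K} (hM : IsInvariant L M)
  {lam : M →* ℂˣ} (hρM : ActsByScalars ρ M lam) (htwist : Function.Injective (twist hM lam))
  {U : Submodule ℂ (L → V)} (hU : ∀ g, ∀ f ∈ U, indRep ρ g f ∈ U)
include hρM htwist hU

theorem single_mem_of_indRep_mem [Finite K] [DecidableEq L] {f : L → V} (hf : f ∈ U) (x : L) :
    Pi.single x (f x) ∈ U := by
  have := Fintype.ofFinite M
  have hmem : ∑ m : M, ((twist hM lam x m)⁻¹ : ℂˣ) • indRep ρ (SemidirectProduct.inl (m : K)) f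
      ∈ U := U.sum_mem fun m _ => U.smul_mem _ (hU _ _ hf)
  have hsum : ∑ m : M, ((twist hM lam x m)⁻¹ : ℂˣ) • indRep ρ (SemidirectProduct.inl (m : K)) f =
      (Nat.card M : ℂ) • Pi.single x (f x) := by
    ext y
    have hterm : ∀ m : M, (((twist hM lam x m)⁻¹ : ℂˣ) •
        indRep ρ (SemidirectProduct.inl (m : K)) f) y =
          ((twist hM lam y m : ℂ) * ((twist hM lam x m)⁻¹ : ℂˣ)) • f y := by
      intro m
      have hscalar : ρ (y • (m : K)) = (twist hM lam y m : ℂ) • 1 := hρM (hM.toMonoidHom y m)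
      rw [Pi.smul_apply, indRep_apply, mul_comm, mul_smul]
      simp only [SemidirectProduct.left_inl, SemidirectProduct.right_inl, mul_one, hscalar]
      rfl
    simp_rw [Finset.sum_apply, hterm]
    classical
    rw [← Finset.sum_smul, sum_mul_inv_eq_ite, Pi.smul_apply]
    rcases eq_or_ne y x with rfl | hyx
    · simp
    · simp [hyx, htwist.ne hyx]
  rw [hsum] at hmem
  exact (U.smul_mem_iff (by exact_mod_cast Nat.card_pos.ne')).mp hmem

theorem eq_bot_or_eq_top_of_indRep_mem [Finite K] [Finite L] (hρ : ρ.IsIrreducible) :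
    U = ⊥ ∨ U = ⊤ := by
  classical
  have := Fintype.ofFinite L
  refine or_iff_not_imp_left.mpr fun hbot => ?_
  obtain ⟨f, hf, hf0⟩ := U.ne_bot_iff.mp hbot
  obtain ⟨x, hx⟩ := Function.ne_iff.mp hf0
  let Ux : Submodule ℂ V := U.comap (LinearMap.single ℂ (fun _ : L => V) x)
  have hUx : ∀ g, ∀ v ∈ Ux, ρ g v ∈ Ux := fun g v hv => by
    simpa [Ux, indRep_inl_single] using hU (SemidirectProduct.inl (x⁻¹ • g)) _ hv
  have hUx_top : Ux = ⊤ := by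
    refine (((isIrreducible_iff ρ).mp hρ).2 Ux hUx).resolve_left fun h => hx ?_
    have hfx : f x ∈ Ux := single_mem_of_indRep_mem hM hρM htwist hU hf x
    rwa [h, Submodule.mem_bot] at hfx
  have hsingle : ∀ y v, Pi.single y v ∈ U := fun y v => by
    have hxv : v ∈ Ux := hUx_top ▸ Submodule.mem_top
    have hxv_mem := hU (SemidirectProduct.inr (y⁻¹ * x)) _ hxv
    rwa [LinearMap.single_apply, indRep_inr_single, mul_inv_rev, inv_inv,
      mul_inv_cancel_left] at hxv_mem
  refine eq_top_iff.mpr fun w _ => ?_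
  rw [← Finset.univ_sum_single w]
  exact U.sum_mem fun y _ => hsingle y _

omit hU in
theorem isIrreducible_indRep [Finite K] [Finite L] (hρ : ρ.IsIrreducible) :
    (indRep (L := L) ρ).IsIrreducible := by
  have := ((isIrreducible_iff ρ).mp hρ).1
  exact (isIrreducible_iff _).mpr ⟨inferInstance, fun U hU =>
    eq_bot_or_eq_top_of_indRep_mem hM hρM htwist hU hρ⟩

end Irreducible

section GCStar

variable {L K : Type*} [Group L] [Group K] [MulDistribMulAction L K]

theorem exists_sum_smul_eq_of_isGCStar [Fintype L] [Finite K] [Nontrivial L]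
    (hfpf : IsFixedPointFree L K) (hGC : IsGCStar (K ⋊[MulDistribMulAction.toMulAut L K] L))
    {M : Subgroup K} (hM : IsInvariant L M) {lam₁ lam₂ : M →* ℂˣ} (h₁ : lam₁ ≠ 1) (h₂ : lam₂ ≠ 1)
    {χ₁ χ₂ : K → ℂ} (hχ₁ : IrrOver M lam₁ χ₁) (hχ₂ : IrrOver M lam₂ χ₂) (hdeg : χ₁ 1 = χ₂ 1) :
    ∃ t : ℕ, t.Coprime (Nat.card K) ∧
      ∀ k : K, ∑ x : L, χ₂ (x • k) = ∑ x : L, χ₁ (x • k ^ t) := by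
  have : Finite (K ⋊[MulDistribMulAction.toMulAut L K] L) :=
    Finite.of_equiv _ SemidirectProduct.equivProd.symm
  obtain ⟨d₁, ρ₁, hρ₁, rfl, hscalar₁⟩ := hχ₁
  obtain ⟨d₂, ρ₂, hρ₂, rfl, hscalar₂⟩ := hχ₂
  have hirr₁ := isIrreducibleCharacter_character
    (isIrreducible_indRep hM hscalar₁ (hfpf.twist_injective hM h₁) hρ₁)
  have hirr₂ := isIrreducibleCharacter_character
    (isIrreducible_indRep hM hscalar₂ (hfpf.twist_injective hM h₂) hρ₂)
  have hone : ∀ {d : ℕ} (ρ : Representation ℂ K (Fin d → ℂ)),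
      (indRep (L := L) ρ).character 1 = Nat.card L * ρ.character 1 := fun ρ => by
    simpa using character_indRep_inl (L := L) ρ 1
  have hnonlinear : ∀ {d : ℕ} (ρ : Representation ℂ K (Fin d → ℂ)),
      (indRep (L := L) ρ).character 1 ≠ 1 := fun ρ h => by
    rw [hone, char_one, ← Nat.cast_mul, Nat.cast_eq_one, mul_eq_one] at h
    exact Finite.one_lt_card.ne' h.1
  obtain ⟨t, ht, hconj⟩ := exists_coprime_of_galoisConjugate hirr₁
    (hGC _ _ hirr₁ hirr₂ (hnonlinear ρ₁) (hnonlinear ρ₂) (by rw [hone, hone, hdeg]))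
  refine ⟨t, ht.coprime_dvd_right (Subgroup.card_dvd_of_injective SemidirectProduct.inl
    SemidirectProduct.inl_injective), fun k => ?_⟩
  simpa only [← map_pow, character_indRep_inl] using hconj (SemidirectProduct.inl k)

theorem isGaloisTransitive_of_isGCStar [Finite L] [Finite K] [Nontrivial L]
    (hfpf : IsFixedPointFree L K) (hGC : IsGCStar (K ⋊[MulDistribMulAction.toMulAut L K] L)) :
    IsGaloisTransitive L K := by
  classical
  have := Fintype.ofFinite L
  rintro M - hM lam₁ lam₂ h₁ h₂ χ₁ χ₂ hχ₁ hχ₂ hdeg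
  obtain ⟨t, ht, hsum⟩ := exists_sum_smul_eq_of_isGCStar hfpf hGC hM h₁ h₂ hχ₁ hχ₂ hdeg
  -- compare the components over `lam₂` of the two sides of `hsum`
  have hχ₂_eq : ∀ k, χ₂ k = ∑ x : L, if twist hM lam₁ x ^ t = lam₂ then χ₁ (x • k ^ t) else 0 := by
    intro k
    rw [← sum_ite_eq_of_sum_mul_eq (α := twist hM lam₂) (a := fun x => χ₂ (x • k)),
      Finset.sum_eq_single 1]
    · rw [if_pos (twist_one hM lam₂), one_smul]
    · intro x _ hx
      exact if_neg fun h => hx (hfpf.eq_one_of_twist_eq hM h₂ h)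
    · simp
    · intro m
      have h₂sum := hχ₂.sum_apply_smul_mul_pow hM k m 1
      simp only [pow_one, MonoidHom.pow_apply] at h₂sum
      rw [← h₂sum, hsum, hχ₁.sum_apply_smul_mul_pow hM k m t]
  obtain ⟨x, hx⟩ : ∃ x, twist hM lam₁ x ^ t = lam₂ := by
    by_contra! h
    exact hχ₂.apply_one_ne_zero (by simp [hχ₂_eq, h])
  refine ⟨x, t, ht, fun k => ?_⟩
  rw [hχ₂_eq, Finset.sum_eq_single x (fun y _ hy => if_neg fun h => hy ?_) (by simp), if_pos hx]
  exact hfpf.twist_injective hM h₁ (eq_of_pow_eq_pow_of_coprime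
    (ht.coprime_dvd_right M.card_subgroup_dvd_card) (h.trans hx.symm))

end GCStar

/-! ### Commutators and linear characters -/

section Commutators

variable {G : Type*} [Group G]

theorem pow_mul_eq_of_commutatorElement_central {x y : G} (h : ∀ z, Commute ⁅y, x⁆ z) (n : ℕ) :
    y ^ n * x = x * y ^ n * ⁅y, x⁆ ^ n := by
  have hconj : x⁻¹ * y * x = y * ⁅y, x⁆ := by
    rw [← (h y).eq, ← mul_right_inj x, ← mul_assoc x ⁅y, x⁆, ← (h x).eq, commutatorElement_def]
    group
  rw [mul_assoc, ← ((h y).symm.mul_pow n), ← hconj]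
  simpa [mul_assoc] using congrArg (x * ·) (conj_pow (i := n) (a := x⁻¹) (b := y)).symm

theorem mul_pow_of_commutatorElement_central {x y : G} (h : ∀ z, Commute ⁅y, x⁆ z) (n : ℕ) :
    (x * y) ^ n = x ^ n * y ^ n * ⁅y, x⁆ ^ n.choose 2 := by
  induction n with
  | zero => simp
  | succ n ih =>
    calc (x * y) ^ (n + 1) = x ^ n * y ^ n * (⁅y, x⁆ ^ n.choose 2 * (x * y)) := by
          rw [pow_succ, ih, mul_assoc]
      _ = x ^ n * (y ^ n * x) * y * ⁅y, x⁆ ^ n.choose 2 := by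
          rw [((h (x * y)).pow_left _).eq]; simp only [mul_assoc]
      _ = x ^ n * x * y ^ n * (⁅y, x⁆ ^ n * y) * ⁅y, x⁆ ^ n.choose 2 := by
          rw [pow_mul_eq_of_commutatorElement_central h]; simp only [mul_assoc]
      _ = x ^ (n + 1) * y ^ (n + 1) * ⁅y, x⁆ ^ (n + 1).choose 2 := by
          rw [((h y).pow_left n).eq, Nat.choose_succ_succ' n 1, Nat.choose_one_right,
            pow_add ⁅y, x⁆, pow_succ x n, pow_succ y n]
          simp only [mul_assoc]

theorem map_commutator_of_surjective {H : Type*} [Group H] {f : G →* H}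
    (hf : Function.Surjective f) : (commutator G).map f = commutator H := by
  rw [commutator_def, commutator_def, Subgroup.map_commutator, Subgroup.map_top_of_surjective f hf]

variable [Finite G]

theorem exists_extension {D : Subgroup G} {lam : D →* ℂˣ}
    (h : ∀ d : D, (d : G) ∈ commutator G → lam d = 1) : ∃ μ : G →* ℂˣ, ∀ d : D, μ d = lam d := by
  let toAbelianization : D →* Abelianization G := Abelianization.of.comp D.subtype
  have hker : toAbelianization.rangeRestrict.ker ≤ lam.ker := fun d hd => by
    refine h d ?_
    rwa [MonoidHom.ker_rangeRestrict, MonoidHom.mem_ker, MonoidHom.comp_apply,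
      ← MonoidHom.mem_ker, Abelianization.ker_of] at hd
  have : Finite (Abelianization G) := Quotient.finite _
  have : NeZero (Monoid.exponent (Abelianization G) : ℂ) :=
    ⟨by exact_mod_cast Monoid.exponent_ne_zero_of_finite⟩
  obtain ⟨μ, hμ⟩ := MonoidHom.domRestrict_surjective (M := ℂ) toAbelianization.range <|
    toAbelianization.rangeRestrict.liftOfSurjective toAbelianization.rangeRestrict_surjective
      ⟨lam, hker⟩
  refine ⟨μ.comp Abelianization.of, fun d => ?_⟩
  exact (DFunLike.congr_fun hμ (toAbelianization.rangeRestrict d)).trans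
    (MonoidHom.liftOfRightInverse_comp_apply _ _ _ _ d)

theorem exists_apply_ne_one {D : Subgroup G} (hD : commutator G ≤ D) {x : G} (hx : x ∉ D) :
    ∃ μ : G →* ℂˣ, (∀ d ∈ D, μ d = 1) ∧ μ x ≠ 1 := by
  have := Subgroup.Normal.of_commutator_le _ hD
  have := Subgroup.Normal.quotient_commutative_iff_commutator_le.mpr hD
  have : NeZero (Monoid.exponent (G ⧸ D) : ℂ) :=
    ⟨by exact_mod_cast Monoid.exponent_ne_zero_of_finite⟩
  obtain ⟨φ, hφ⟩ := CommGroup.exists_apply_ne_one_of_hasEnoughRootsOfUnity (G ⧸ D) ℂ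
    (a := (x : G ⧸ D)) (by rwa [Ne, QuotientGroup.eq_one_iff])
  refine ⟨φ.comp (QuotientGroup.mk' D), fun d hd => ?_, hφ⟩
  rw [MonoidHom.comp_apply, QuotientGroup.mk'_apply, (QuotientGroup.eq_one_iff d).mpr hd, map_one]

end Commutators

/-! ### Linear families of endomorphisms over a finite field -/

section LinearFamilies

variable {k V U : Type*} [Field k] [AddCommGroup V] [AddCommGroup U] [Module k V] [Module k U]

theorem maxGenEigenspace_zero_eq_ker {f : Module.End k U} (h : ∀ u, f (f u) = 0 → f u = 0) :
    f.maxGenEigenspace 0 = LinearMap.ker f := by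
  have hker : LinearMap.ker (f ^ 1) = LinearMap.ker (f ^ 2) := by
    refine le_antisymm (fun u hu => ?_) fun u hu => ?_
    · rw [pow_one, LinearMap.mem_ker] at hu
      rw [LinearMap.mem_ker, pow_two, Module.End.mul_apply, hu, map_zero]
    · rw [pow_one, LinearMap.mem_ker]
      exact h u (by rwa [pow_two, LinearMap.mem_ker] at hu)
  ext u
  simp only [Module.End.mem_maxGenEigenspace, zero_smul, sub_zero]
  refine ⟨fun ⟨n, hn⟩ => ?_, fun hu => ⟨1, by rwa [pow_one]⟩⟩
  rw [← pow_one f, Module.End.ker_pow_constant hker n, LinearMap.mem_ker, pow_add,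
    Module.End.mul_apply, hn, map_zero]

variable [Module.Finite k V] [Module.Finite k U]

theorem exists_ne_zero_charpoly_coeff_eq_zero [Finite k] (φ : V →ₗ[k] Module.End k U) {i : ℕ}
    (hi : i < Module.finrank k U) (hUV : Module.finrank k U < Module.finrank k V + i) :
    ∃ v ≠ 0, (φ v).charpoly.coeff i = 0 := by
  classical
  have := Fintype.ofFinite k
  obtain ⟨p, hp⟩ := CharP.exists k
  have : Fact p.Prime := ⟨CharP.char_is_prime k p⟩
  let b := Module.finBasis k V
  let f := (φ.polyCharpoly b).coeff i
  have hhom : f.IsHomogeneous (Module.finrank k U - i) :=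
    φ.polyCharpoly_coeff_isHomogeneous b i _ (by omega)
  have hdvd : p ∣ Fintype.card {x : Fin (Module.finrank k V) → k // MvPolynomial.eval x f = 0} :=
    char_dvd_card_solutions p (hhom.totalDegree_le.trans_lt (by rw [Fintype.card_fin]; omega))
  have h0 : MvPolynomial.eval (0 : Fin _ → k) f = 0 := by
    rw [MvPolynomial.eval_zero, MvPolynomial.constantCoeff_eq]
    exact hhom.coeff_eq_zero (by rw [map_zero]; omega)
  obtain ⟨⟨x, hx⟩, hx0⟩ := Fintype.exists_ne_of_one_lt_card
    ((Fact.out (p := p.Prime)).one_lt.trans_le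
      (Nat.le_of_dvd (Fintype.card_pos_iff.mpr ⟨⟨0, h0⟩⟩) hdvd)) ⟨0, h0⟩
  refine ⟨b.equivFun.symm x, ?_, ?_⟩
  · rw [Ne, LinearEquiv.map_eq_zero_iff]
    exact fun h => hx0 (Subtype.ext h)
  · rw [← φ.polyCharpoly_coeff_eval b, ← Module.Basis.equivFun_apply, LinearEquiv.apply_symm_apply]
    exact hx

-- If the kernel of `φ v` met its range trivially, zero would be an eigenvalue of `φ v` of
-- algebraic multiplicity one, contrary to the vanishing of the linear coefficient of the
-- characteristic polynomial.
theorem exists_apply_apply_eq_zero [Finite k] (φ : V →ₗ[k] Module.End k U)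
    (hU : 1 < Module.finrank k U) (hUV : Module.finrank k U ≤ Module.finrank k V)
    (hker : ∀ v ≠ 0, Module.finrank k (LinearMap.ker (φ v)) = 1) :
    ∃ v ≠ 0, ∃ u, φ v u ≠ 0 ∧ φ v (φ v u) = 0 := by
  obtain ⟨v, hv, hcoeff⟩ := exists_ne_zero_charpoly_coeff_eq_zero φ hU (Nat.lt_succ_of_le hUV)
  refine ⟨v, hv, ?_⟩
  by_contra! hcon
  have htrailing := (φ v).finrank_maxGenEigenspace_zero_eq
  rw [maxGenEigenspace_zero_eq_ker fun u hu => by_contra fun h => hcon u h hu, hker v hv]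
    at htrailing
  exact Polynomial.coeff_natTrailingDegree_ne_zero.mpr (φ v).charpoly_monic.ne_zero
    (by rwa [← htrailing])

end LinearFamilies

theorem card_eq_pow_finrank_zmod (p : ℕ) [Fact p.Prime] (V : Type*) [AddCommGroup V]
    [Module (ZMod p) V] [Module.Finite (ZMod p) V] :
    Nat.card V = p ^ Module.finrank (ZMod p) V := by
  rw [Module.natCard_eq_pow_finrank (K := ZMod p), Nat.card_zmod]

theorem exists_apply_apply_eq_one {p : ℕ} [hp : Fact p.Prime] {A M : Type*} [CommGroup M]
    [Finite M] [CommGroup A] [Finite A] (hM : ∀ m : M, m ^ p = 1) (hA : ∀ a : A, a ^ p = 1)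
    (act : A →* (M →* M)) (hpM : p < Nat.card M) (hMA : Nat.card M ≤ Nat.card A)
    (hker : ∀ a ≠ 1, Nat.card (act a).ker = p) :
    ∃ a ≠ 1, ∃ u, act a u ≠ 1 ∧ act a (act a u) = 1 := by
  let _ : Module (ZMod p) (Additive M) := AddCommGroup.zmodModule (n := p) fun x => hM x.toMul
  let _ : Module (ZMod p) (Additive A) := AddCommGroup.zmodModule (n := p) fun x => hA x.toMul
  let φ : Additive A →ₗ[ZMod p] Module.End (ZMod p) (Additive M) :=
    AddMonoidHom.toZModLinearMap p
      { toFun := fun a => AddMonoidHom.toZModLinearMap p (MonoidHom.toAdditive (act a.toMul))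
        map_zero' := by rw [toMul_zero, map_one]; rfl
        map_add' := fun a b => by rw [toMul_add, map_mul]; rfl }
  have hpow {m n : ℕ} : p ^ m < p ^ n ↔ m < n := Nat.pow_lt_pow_iff_right hp.out.one_lt
  obtain ⟨v, hv, u, hu, huu⟩ := exists_apply_apply_eq_zero φ
    (by rw [← hpow, pow_one, ← card_eq_pow_finrank_zmod]; exact hpM)
    (by rw [← not_lt, ← hpow, not_lt, ← card_eq_pow_finrank_zmod, ← card_eq_pow_finrank_zmod]
        exact hMA)
    fun v hv => Nat.pow_right_injective hp.out.two_le <| by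
      beta_reduce
      rw [← card_eq_pow_finrank_zmod, pow_one]
      exact hker v.toMul hv
  exact ⟨v.toMul, hv, u.toMul, hu, huu⟩

/-! ### Groups with a fixed-point-free action -/

section Action

variable {L K : Type*} [Group L] [Group K] [MulDistribMulAction L K]

/-- The action on the quotient by an invariant normal subgroup. -/
abbrev quotientAction {N : Subgroup K} [N.Normal] (hN : IsInvariant L N) :
    MulDistribMulAction L (K ⧸ N) where
  smul l := QuotientGroup.map N N (MulDistribMulAction.toMonoidHom K l) fun n hn => hN l n hn
  one_smul x := by
    obtain ⟨x, rfl⟩ := QuotientGroup.mk_surjective x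
    exact congrArg _ (one_smul L x)
  mul_smul a b x := by
    obtain ⟨x, rfl⟩ := QuotientGroup.mk_surjective x
    exact congrArg _ (mul_smul a b x)
  smul_one a := map_one (QuotientGroup.map N N (MulDistribMulAction.toMonoidHom K a) _)
  smul_mul a x y := map_mul (QuotientGroup.map N N (MulDistribMulAction.toMonoidHom K a) _) x y

/-- The action on an invariant subgroup. -/
abbrev restrictAction {N : Subgroup K} (hN : IsInvariant L N) : MulDistribMulAction L N where
  smul l n := ⟨l • (n : K), hN l n n.2⟩
  one_smul x := Subtype.ext (one_smul L (x : K))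
  mul_smul a b x := Subtype.ext (mul_smul a b (x : K))
  smul_one a := Subtype.ext (smul_one a)
  smul_mul a x y := Subtype.ext (smul_mul' a (x : K) y)

variable (L) in
theorem isInvariant_of_characteristic (N : Subgroup K) [hN : N.Characteristic] :
    IsInvariant L N := fun l n hn =>
  Subgroup.characteristic_iff_map_le.mp hN (MulDistribMulAction.toMulAut L K l) ⟨n, hn, rfl⟩

theorem IsFixedPointFree.quotient [Finite K] (h : IsFixedPointFree L K) {N : Subgroup K}
    [N.Normal] (hN : IsInvariant L N) :
    let _ := quotientAction hN; IsFixedPointFree L (K ⧸ N) :=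
  let _ := quotientAction hN
  h.of_surjective (QuotientGroup.mk'_surjective N) fun _ _ => rfl

theorem IsFixedPointFree.restrict (h : IsFixedPointFree L K) {N : Subgroup K}
    (hN : IsInvariant L N) : let _ := restrictAction hN; IsFixedPointFree L N :=
  let _ := restrictAction hN
  fun l hl n hn => Subtype.ext (h l hl n (congrArg Subtype.val hn))

theorem IsFixedPointFree.prod_smul_eq_one [Fintype L] [Nontrivial L] {A : Type*} [CommGroup A]
    [MulDistribMulAction L A] (h : IsFixedPointFree L A) (a : A) : ∏ l : L, l • a = 1 := by
  obtain ⟨x, hx⟩ := exists_ne (1 : L)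
  refine h x hx _ ?_
  rw [Finset.smul_prod']
  exact Fintype.prod_equiv (Equiv.mulLeft x) _ _ fun l => smul_smul x l a

-- In the double product of `α h (l • α h⁻¹ a)` over `l` and `h`, the terms with `l ≠ 1` contribute
-- the same as `α h (l • a)`, since `h ↦ h / l • h` is a bijection.
theorem prod_apply_eq_pow_card [Finite L] [Nontrivial L] [Fintype K] {A : Type*} [CommGroup A]
    [MulDistribMulAction L A] (α : K →* MulAut A)
    (hα : ∀ (l : L) h a, l • α h a = α (l • h) (l • a)) (hA : IsFixedPointFree L A)
    (hK : IsFixedPointFree L K) (a : A) : ∏ h, α h a = a ^ Fintype.card K := by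
  classical
  have := Fintype.ofFinite L
  have hprod (b : K → A) : ∏ l : L, ∏ h, α h (l • b h) = 1 := by
    rw [Finset.prod_comm]
    exact Finset.prod_eq_one fun h _ => by rw [← map_prod, hA.prod_smul_eq_one, map_one]
  have hne : ∀ l : L, l ≠ 1 → ∏ h, α h (l • α h⁻¹ a) = ∏ h, α h (l • a) := fun l hl => by
    have hbij : Function.Bijective fun h : K => h / l • h :=
      Finite.injective_iff_bijective.mp <| MonoidHom.FixedPointFree.commutatorMap_injective
        (φ := MulDistribMulAction.toMonoidHom K l) (hK l hl)
    refine Fintype.prod_equiv (Equiv.ofBijective _ hbij) _ _ fun h => ?_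
    rw [hα, Equiv.ofBijective_apply, div_eq_mul_inv, ← smul_inv', map_mul, MulAut.mul_apply]
  have hself := (hprod fun h => α h⁻¹ a).trans (hprod fun _ => a).symm
  rw [← Finset.mul_prod_erase Finset.univ _ (Finset.mem_univ 1),
    ← Finset.mul_prod_erase Finset.univ (fun l : L => ∏ h, α h (l • a)) (Finset.mem_univ 1),
    Finset.prod_congr rfl fun l hl => hne l (Finset.ne_of_mem_erase hl)] at hself
  have hone := mul_right_cancel hself
  simpa only [one_smul, ← MulAut.mul_apply, ← map_mul, mul_inv_cancel, map_one, MulAut.one_apply,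
    Finset.prod_const, Finset.card_univ] using hone.symm

variable [Finite L] [Nontrivial L] [Finite K]

theorem IsFixedPointFree.pow_index_mem_center (h : IsFixedPointFree L K) {A : Subgroup K}
    [A.Normal] [IsMulCommutative A] (hA : IsInvariant L A) {a : K} (ha : a ∈ A) :
    a ^ A.index ∈ Subgroup.center K := by
  have := Fintype.ofFinite (K ⧸ A)
  let _ := quotientAction hA
  let _ := restrictAction hA
  let conj : K ⧸ A →* MulAut A := QuotientGroup.lift A MulAut.conjNormal fun x hx => by
    ext y
    exact mul_inv_eq_of_eq_mul (congrArg Subtype.val (mul_comm (⟨x, hx⟩ : A) y))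
  have hprod := prod_apply_eq_pow_card (L := L) conj
    (fun l h b => by
      obtain ⟨k, rfl⟩ := QuotientGroup.mk_surjective h
      refine Subtype.ext ?_
      change l • (k * b * k⁻¹) = (l • k) * (l • (b : K)) * (l • k)⁻¹
      rw [smul_mul', smul_mul', smul_inv'])
    (h.restrict hA) (h.quotient hA) ⟨a, ha⟩
  rw [Subgroup.mem_center_iff]
  intro k
  have hfix : conj k (∏ x, conj x ⟨a, ha⟩) = ∏ x, conj x ⟨a, ha⟩ := by
    rw [map_prod]
    refine Fintype.prod_equiv (Equiv.mulLeft (k : K ⧸ A)) _ _ fun x => ?_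
    rw [Equiv.coe_mulLeft, map_mul, MulAut.mul_apply]
  rw [hprod, ← Nat.card_eq_fintype_card] at hfix
  exact mul_inv_eq_iff_eq_mul.mp (congrArg Subtype.val hfix)

end Action

theorem isPGroup_of_isNilpotent {p : ℕ} [hp : Fact p.Prime] {K : Type*} [Group K] [Finite K]
    [Group.IsNilpotent K] (h : ∀ x : K, ∃ n, x ^ p ^ n ∈ commutator K) : IsPGroup p K := by
  obtain ⟨P⟩ : Nonempty (Sylow p K) := inferInstance
  suffices hP : (P : Subgroup K) = ⊤ from (hP ▸ P.isPGroup').of_equiv Subgroup.topEquiv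
  rw [← QuotientGroup.subsingleton_iff]
  by_contra hnontrivial
  rw [not_subsingleton_iff_nontrivial] at hnontrivial
  refine (Group.IsSolvable.commutator_lt_top_of_nontrivial (K ⧸ (P : Subgroup K))).ne
    (eq_top_iff.mpr fun x _ => ?_)
  obtain ⟨y, rfl⟩ := QuotientGroup.mk_surjective x
  obtain ⟨n, hn⟩ := h y
  have hcoprime : (p ^ n).Coprime (Nat.card (K ⧸ (P : Subgroup K))) :=
    ((Nat.Prime.coprime_iff_not_dvd hp.out).mpr P.not_dvd_index).pow_left n
  obtain ⟨m, hm⟩ := exists_pow_eq_self_of_coprime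
    (hcoprime.coprime_dvd_right (orderOf_dvd_natCard (y : K ⧸ (P : Subgroup K))))
  rw [← hm, ← QuotientGroup.mk_pow,
    ← map_commutator_of_surjective (QuotientGroup.mk'_surjective (P : Subgroup K))]
  exact Subgroup.pow_mem _ (Subgroup.mem_map_of_mem _ hn) m

theorem exists_characteristic_isMulCommutative_ne_bot (K : Type*) [Group K] [Nontrivial K]
    [hK : Group.IsSolvable K] :
    ∃ A : Subgroup K, A.Characteristic ∧ IsMulCommutative A ∧ A ≠ ⊥ := by
  classical
  have hpos : Nat.find hK.solvable ≠ 0 := fun h =>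
    top_ne_bot (α := Subgroup K) (by simpa only [h] using! Nat.find_spec hK.solvable)
  obtain ⟨n, hn⟩ := Nat.exists_eq_succ_of_ne_zero hpos
  refine ⟨derivedSeries K n, derivedSeries_characteristic K n, ?_,
    Nat.find_min hK.solvable (by omega)⟩
  rw [← Subgroup.commutator_self_eq_bot_iff, ← derivedSeries_succ, ← Nat.succ_eq_add_one, ← hn]
  exact Nat.find_spec hK.solvable

theorem IsFixedPointFree.isPGroup {p : ℕ} [hp : Fact p.Prime] {L : Type*} [Group L] [Finite L]
    [Nontrivial L] {K : Type*} [Group K] [Finite K] [MulDistribMulAction L K]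
    (h : IsFixedPointFree L K) (hK : Group.IsSolvable K)
    (hpow : ∀ x : K, ∃ n, x ^ p ^ n ∈ commutator K) : IsPGroup p K := by
  induction hcard : Nat.card K using Nat.strong_induction_on generalizing K with
  | _ n ih =>
  rcases subsingleton_or_nontrivial K with hsubsingleton | hnontrivial
  · exact IsPGroup.of_subsingleton p K
  obtain ⟨A, hchar, hcomm, hne⟩ := exists_characteristic_isMulCommutative_ne_bot K
  have hA := isInvariant_of_characteristic L A
  let _ := quotientAction hA
  have hKA : IsPGroup p (K ⧸ A) := by
    refine ih (Nat.card (K ⧸ A)) ?_ (h.quotient hA) inferInstance (fun x => ?_) rfl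
    · rw [← hcard, A.card_eq_card_quotient_mul_card_subgroup]
      exact lt_mul_of_one_lt_right Nat.card_pos (A.one_lt_card_iff_ne_bot.mpr hne)
    · obtain ⟨x, rfl⟩ := QuotientGroup.mk_surjective x
      obtain ⟨m, hm⟩ := hpow x
      refine ⟨m, ?_⟩
      rw [← map_commutator_of_surjective (QuotientGroup.mk'_surjective A)]
      exact ⟨_, hm, rfl⟩
  obtain ⟨n, hn⟩ := IsPGroup.iff_card.mp hKA
  have hcenter : IsPGroup p (K ⧸ Subgroup.center K) := fun x => by
    obtain ⟨x, rfl⟩ := QuotientGroup.mk_surjective x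
    obtain ⟨m, hm⟩ := hKA x
    rw [← QuotientGroup.mk_pow, QuotientGroup.eq_one_iff] at hm
    refine ⟨m + n, ?_⟩
    rw [← QuotientGroup.mk_pow, QuotientGroup.eq_one_iff, pow_add, pow_mul, ← hn]
    exact h.pow_index_mem_center hA hm
  have : Group.IsNilpotent (K ⧸ Subgroup.center K) := hcenter.isNilpotent
  have : Group.IsNilpotent K := Group.of_quotient_center_nilpotent this
  exact isPGroup_of_isNilpotent hpow

/-! ### Orbits under the action and power maps -/

theorem irrOver_top {K : Type*} [Group K] (μ : K →* ℂˣ) :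
    IrrOver ⊤ (μ.comp (Subgroup.subtype ⊤)) fun g => (μ g : ℂ) := by
  let ρ : Representation ℂ K (Fin 1 → ℂ) :=
    (algebraMap ℂ (Module.End ℂ (Fin 1 → ℂ)) : ℂ →* _).comp ((Units.coeHom ℂ).comp μ)
  have hρ : ∀ g, ρ g = (μ g : ℂ) • 1 := fun g => Algebra.algebraMap_eq_smul_one (μ g : ℂ)
  refine ⟨1, ρ, ?_, ?_, fun m => hρ m⟩
  · have : IsSimpleModule ℂ (Fin 1 → ℂ) :=
      isSimpleModule_iff_finrank_eq_one.mpr (Module.finrank_fin_fun ℂ)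
    exact (isIrreducible_iff ρ).mpr ⟨inferInstance, fun W _ => eq_bot_or_eq_top W⟩
  · ext g
    simp [Representation.character, hρ]

section LinearCharacters

variable {K : Type*} [Group K]

theorem pow_eq_pow_of_natCast_eq {s t : ℕ} (h : (s : ZMod (Nat.card K)) = t) (g : K) :
    g ^ s = g ^ t :=
  pow_eq_pow_iff_modEq.mpr
    (((ZMod.natCast_eq_natCast_iff _ _ _).mp h).of_dvd (orderOf_dvd_natCard g))

variable [Finite K]

variable (K) in
theorem exists_pow_mul_eq_self {t : ℕ} (ht : t.Coprime (Nat.card K)) :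
    ∃ s : ℕ, ∀ g : K, g ^ (t * s) = g := by
  refine ⟨((ZMod.unitOfCoprime t ht)⁻¹ : (ZMod (Nat.card K))ˣ).val.val, fun g => ?_⟩
  conv_rhs => rw [← pow_one g]
  refine pow_eq_pow_of_natCast_eq ?_ g
  rw [Nat.cast_mul, ZMod.natCast_val, ZMod.cast_id', id, ← ZMod.coe_unitOfCoprime t ht,
    Units.mul_inv, Nat.cast_one]

variable (K) in
theorem card_monoidHom_eq_index : Nat.card (K →* ℂˣ) = (commutator K).index := by
  have : Finite (Abelianization K) := Quotient.finite _
  have : NeZero (Monoid.exponent (Abelianization K) : ℂ) :=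
    ⟨by exact_mod_cast Monoid.exponent_ne_zero_of_finite⟩
  rw [Subgroup.index, ← Nat.card_congr Abelianization.lift.symm]
  exact CommGroup.card_monoidHom_of_hasEnoughRootsOfUnity (Abelianization K) ℂ

instance : Finite (K →* ℂˣ) :=
  Nat.finite_of_card_ne_zero (card_monoidHom_eq_index K ▸ Subgroup.index_ne_zero_of_finite)

theorem apply_eq_one_of_mem_commutator {G A : Type*} [Group G] [CommGroup A] (f : G →* A) {g : G}
    (hg : g ∈ commutator G) : f g = 1 :=
  MonoidHom.mem_ker.mp (Abelianization.commutator_subset_ker f hg)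

end LinearCharacters

section Action

variable {L K : Type*} [Group L] [Group K] [MulDistribMulAction L K]

theorem smul_ne_one (l : L) {k : K} (hk : k ≠ 1) : l • k ≠ 1 :=
  (MulDistribMulAction.toMulEquiv K l).map_ne_one_iff.mpr hk

section FixedPointFree

variable (h : IsFixedPointFree L K)
include h

theorem IsFixedPointFree.smul_left_injective {x : K} (hx : x ≠ 1) :
    Function.Injective fun l : L => l • x := by
  intro a b hab
  by_contra hne
  refine hx (h (b⁻¹ * a) (by rwa [Ne, inv_mul_eq_one, eq_comm]) x ?_)
  rwa [mul_smul, inv_smul_eq_iff]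

variable [Finite K]

theorem IsFixedPointFree.card_dvd : Nat.card L ∣ Nat.card K - 1 := by
  let S : SubMulAction L K := ⟨{1}ᶜ, fun l k hk => smul_ne_one l hk⟩
  have hfree : ∀ s : S, MulAction.stabilizer L s = ⊥ := fun s =>
    (Subgroup.eq_bot_iff_forall _).mpr fun l hl =>
      h.smul_left_injective s.2 ((congrArg Subtype.val hl).trans (one_smul L _).symm)
  have hS : Nat.card S = Nat.card K - 1 :=
    (Nat.card_coe_set_eq _).trans ((Set.ncard_compl _).trans (by rw [Set.ncard_singleton]))
  rw [← hS, Nat.card_congr (MulAction.selfEquivOrbitsQuotientProd hfree), Nat.card_prod]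
  exact dvd_mul_left _ _

theorem IsFixedPointFree.exists_smul_eq (hcard : Nat.card K = Nat.card L + 1) {x y : K}
    (hx : x ≠ 1) (hy : y ≠ 1) : ∃ l : L, l • x = y := by
  let orbitMap : L → ({1}ᶜ : Set K) := fun l => ⟨l • x, smul_ne_one l hx⟩
  have hinj : Function.Injective orbitMap := fun a b hab =>
    h.smul_left_injective hx (congrArg Subtype.val hab)
  have hle : Nat.card ({1}ᶜ : Set K) ≤ Nat.card L := by
    rw [Nat.card_coe_set_eq, Set.ncard_compl, Set.ncard_singleton, hcard, Nat.add_sub_cancel]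
  obtain ⟨l, hl⟩ := (hinj.bijective_of_nat_card_le hle).surjective ⟨y, hy⟩
  exact ⟨l, congrArg Subtype.val hl⟩

theorem IsFixedPointFree.not_dvd_card [Nontrivial K] {p : ℕ} [hp : Fact p.Prime]
    (hK : IsPGroup p K) : ¬ p ∣ Nat.card L := by
  intro hpL
  obtain ⟨n, hn0, hn⟩ := hK.nontrivial_iff_card.mp ‹_›
  have hpK : p ∣ Nat.card K := hn ▸ dvd_pow_self p hn0.ne'
  exact hp.out.not_dvd_one ((Nat.dvd_sub_iff_right Nat.card_pos hpK).mp (hpL.trans h.card_dvd))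

end FixedPointFree

variable (L) in
/-- The functions obtained from `f` by composing with elements of `L` and power maps. -/
def galoisOrbit {α : Type*} (f : K → α) : Set (K → α) :=
  {f' | ∃ (l : L) (t : ℕ), t.Coprime (Nat.card K) ∧ ∀ g, f' g = f (l • g ^ t)}

section GaloisOrbit

variable [Finite K]

variable (L K) in
/-- The combined action of `L` and of the power maps with exponent prime to the order of `K`. -/
noncomputable abbrev powerAction : MulAction (L × (ZMod (Nat.card K))ˣ) K where
  smul γ g := γ.1 • g ^ (γ.2 : ZMod (Nat.card K)).val
  one_smul g := by
    change (1 : L) • g ^ (1 : ZMod (Nat.card K)).val = g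
    rw [one_smul, pow_eq_pow_of_natCast_eq (t := 1) (by simp), pow_one]
  mul_smul a b g := by
    change (a.1 * b.1) • g ^ (a.2 * b.2 : ZMod (Nat.card K)).val =
      a.1 • (b.1 • g ^ (b.2 : ZMod (Nat.card K)).val) ^ (a.2 : ZMod (Nat.card K)).val
    rw [mul_smul, ← smul_pow', ← pow_mul]
    exact congrArg (a.1 • b.1 • ·) (pow_eq_pow_of_natCast_eq (by simp [mul_comm]) g)

theorem galoisOrbit_eq_orbit {α : Type*} (f : K → α) :
    let _ := powerAction L K
    let _ : MulAction (L × (ZMod (Nat.card K))ˣ) (K → α) := arrowAction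
    galoisOrbit L f = MulAction.orbit (L × (ZMod (Nat.card K))ˣ) f := by
  intro _ _
  ext f'
  constructor
  · rintro ⟨l, t, ht, hf'⟩
    let γ : L × (ZMod (Nat.card K))ˣ := (l, ZMod.unitOfCoprime t ht)
    refine ⟨γ⁻¹, funext fun g => ?_⟩
    change f (γ⁻¹⁻¹ • g) = f' g
    rw [inv_inv, hf']
    exact congrArg (fun k => f (l • k)) (pow_eq_pow_of_natCast_eq (by simp [γ]) g)
  · rintro ⟨γ, rfl⟩
    exact ⟨γ⁻¹.1, (γ⁻¹.2 : ZMod (Nat.card K)).val, ZMod.val_coe_unit_coprime _, fun g => rfl⟩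

theorem card_galoisOrbit_dvd {p : ℕ} [hp : Fact p.Prime] (hpK : p ∣ Nat.card K) {α : Type*}
    {f : K → α} (hf : ∀ g t, t ≡ 1 [MOD p] → f (g ^ t) = f g) :
    Nat.card (galoisOrbit L f) ∣ Nat.card L * (p - 1) := by
  let _ := powerAction L K
  let _ : MulAction (L × (ZMod (Nat.card K))ˣ) (K → α) := arrowAction
  let N : Subgroup (L × (ZMod (Nat.card K))ˣ) := (⊥ : Subgroup L).prod (ZMod.unitsMap hpK).ker
  have hN : N ≤ MulAction.stabilizer _ f := by
    have hfix : ∀ γ ∈ N, ∀ g : K, f (γ • g) = f g := by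
      rintro ⟨l, u⟩ ⟨rfl : l = 1, hu⟩ g
      have hu1 := congrArg Units.val (MonoidHom.mem_ker.mp hu)
      rw [ZMod.unitsMap_val, Units.val_one] at hu1
      refine (congrArg f (one_smul L _)).trans (hf g _ ?_)
      rwa [← ZMod.natCast_eq_natCast_iff, Nat.cast_one, ZMod.natCast_val]
    exact fun γ hγ => funext fun g => hfix γ⁻¹ (N.inv_mem hγ) g
  rw [galoisOrbit_eq_orbit, Nat.card_coe_set_eq, ← MulAction.index_stabilizer]
  refine (Subgroup.index_dvd_of_le hN).trans ?_
  rw [Subgroup.index_prod, Subgroup.index_bot, Subgroup.index_ker]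
  refine Nat.mul_dvd_mul_left _ ?_
  rw [← Nat.totient_prime hp.out, ← ZMod.card_units_eq_totient, ← Nat.card_eq_fintype_card]
  exact Subgroup.card_subgroup_dvd_card _

theorem exists_smul_pow_eq (l : L) {t : ℕ} (ht : t.Coprime (Nat.card K)) (x : K) :
    ∃ y, l • y ^ t = x := by
  obtain ⟨s, hs⟩ := exists_pow_mul_eq_self K ht
  exact ⟨(l⁻¹ • x) ^ s, by rw [← pow_mul, mul_comm, hs, smul_inv_smul]⟩

theorem galoisOrbit_coe_monoidHom {μ : K →* ℂˣ} (hμ : μ ≠ 1)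
    (htrans : ∀ ν : K →* ℂˣ, ν ≠ 1 → ⇑ν ∈ galoisOrbit L μ) :
    galoisOrbit L (μ : K → ℂˣ) = (fun ν : K →* ℂˣ => (ν : K → ℂˣ)) '' {1}ᶜ := by
  ext f
  constructor
  · rintro ⟨l, t, ht, hf⟩
    let ν := (powMonoidHom t).comp (μ.comp (MulDistribMulAction.toMonoidHom K l))
    have hν : ∀ g, ν g = μ (l • g ^ t) := fun g => by rw [smul_pow', map_pow]; rfl
    refine ⟨ν, fun hν1 => hμ (MonoidHom.ext fun x => ?_), funext fun g => (hν g).trans (hf g).symm⟩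
    obtain ⟨y, rfl⟩ := exists_smul_pow_eq l ht x
    rw [← hν, hν1, MonoidHom.one_apply, MonoidHom.one_apply]
  · rintro ⟨ν, hν, rfl⟩
    exact htrans ν hν

theorem exists_monoidHom_ne_one (hne : commutator K ≠ ⊤) : ∃ μ : K →* ℂˣ, μ ≠ 1 := by
  obtain ⟨x, -, hx⟩ := SetLike.exists_of_lt hne.lt_top
  obtain ⟨μ, -, hμx⟩ := exists_apply_ne_one le_rfl hx
  exact ⟨μ, fun hμ => hμx (by rw [hμ, MonoidHom.one_apply])⟩

theorem index_commutator_sub_one_dvd {p : ℕ} [Fact p.Prime] (hpK : p ∣ Nat.card K)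
    (hpow : ∀ x : K, x ^ p ∈ commutator K) (hne : commutator K ≠ ⊤)
    (htrans : ∀ μ ν : K →* ℂˣ, μ ≠ 1 → ν ≠ 1 → ⇑ν ∈ galoisOrbit L μ) :
    (commutator K).index - 1 ∣ Nat.card L * (p - 1) := by
  obtain ⟨μ, hμ⟩ := exists_monoidHom_ne_one hne
  have hdvd := card_galoisOrbit_dvd (L := L) hpK (f := μ) fun g t ht => by
    have hμp : μ g ^ p = 1 := (map_pow μ g p).symm.trans (apply_eq_one_of_mem_commutator μ (hpow g))
    conv_rhs => rw [← pow_one (μ g)]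
    rw [map_pow, pow_eq_pow_iff_modEq]
    exact ht.of_dvd (orderOf_dvd_of_pow_eq_one hμp)
  rwa [galoisOrbit_coe_monoidHom hμ fun ν hν => htrans μ ν hμ hν,
    Nat.card_image_of_injective DFunLike.coe_injective, Nat.card_coe_set_eq,
    Set.ncard_compl, Set.ncard_singleton, card_monoidHom_eq_index] at hdvd

variable {F : K → ℂ} (hF : ∀ ε : K →* ℂˣ, (fun g => (ε g : ℂ) * F g) ∈ galoisOrbit L F)
include hF

theorem mul_mem_galoisOrbit (ε : K →* ℂˣ) {f : K → ℂ} (hf : f ∈ galoisOrbit L F) :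
    (fun g => (ε g : ℂ) * f g) ∈ galoisOrbit L F := by
  obtain ⟨l, t, ht, hf⟩ := hf
  obtain ⟨s, hs⟩ := exists_pow_mul_eq_self K ht
  let ε' : K →* ℂˣ := (powMonoidHom s).comp (ε.comp (MulDistribMulAction.toMonoidHom K l⁻¹))
  have hε' : ∀ g, ε' (l • g ^ t) = ε g := fun g => by
    change ε (l⁻¹ • l • g ^ t) ^ s = ε g
    rw [inv_smul_smul, ← map_pow, ← pow_mul, hs]
  obtain ⟨l', t', ht', hε'F⟩ := hF ε'
  refine ⟨l' * l, t * t', ht.mul_left ht', fun g => ?_⟩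
  beta_reduce at hε'F ⊢
  rw [hf, ← hε' g, hε'F, mul_smul, pow_mul, smul_pow' l (g ^ t) t']

theorem exists_mem_galoisOrbit_forall_mul_eq {p : ℕ} [Fact p.Prime] (hK : IsPGroup p K)
    (hp : ¬ p ∣ Nat.card (galoisOrbit L F)) :
    ∃ f ∈ galoisOrbit L F, ∀ (ε : K →* ℂˣ) g, (ε g : ℂ) * f g = f g := by
  let _ : MulAction (K →* ℂˣ) (galoisOrbit L F) :=
    { smul := fun ε f => ⟨fun g => (ε g : ℂ) * f.1 g, mul_mem_galoisOrbit hF ε f.2⟩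
      one_smul := fun f => Subtype.ext (funext fun g => one_mul (f.1 g))
      mul_smul := fun a b f => Subtype.ext (funext fun g => mul_assoc (a g : ℂ) (b g) (f.1 g)) }
  have hdual : IsPGroup p (K →* ℂˣ) := by
    obtain ⟨m, hm⟩ := hK.index (commutator K)
    exact IsPGroup.of_card (n := m) ((card_monoidHom_eq_index K).trans hm)
  obtain ⟨f, hf⟩ := hdual.nonempty_fixed_point_of_prime_not_dvd_card _ hp
  exact ⟨f, f.2, fun ε g => congrFun (congrArg Subtype.val (hf ε)) g⟩

/-- The functions `ε * F` form orbits of the `p`-group of linear characters in a set of cardinality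
prime to `p`, so some member of the orbit of `F` is fixed by all of them. -/
theorem mem_commutator_of_apply_ne_zero {p : ℕ} [hp : Fact p.Prime] (hK : IsPGroup p K)
    (hL : ¬ p ∣ Nat.card L) (hper : ∀ g t, t ≡ 1 [MOD p] → F (g ^ t) = F g) {x : K}
    (hx : F x ≠ 0) : x ∈ commutator K := by
  by_contra hxK
  have : Nontrivial K := ⟨x, 1, fun h => hxK (h ▸ (commutator K).one_mem)⟩
  obtain ⟨n, hn0, hn⟩ := hK.nontrivial_iff_card.mp this
  have hpp : ¬ p ∣ p - 1 := Nat.not_dvd_of_pos_of_lt (Nat.sub_pos_of_lt hp.out.one_lt)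
    (Nat.sub_lt hp.out.pos one_pos)
  have hdvd := card_galoisOrbit_dvd (L := L) (hn ▸ dvd_pow_self p hn0.ne') hper
  obtain ⟨f, ⟨l, t, ht, hf⟩, hfix⟩ := exists_mem_galoisOrbit_forall_mul_eq hF hK fun h =>
    (hp.out.dvd_mul.mp (h.trans hdvd)).elim hL hpp
  obtain ⟨y, rfl⟩ := exists_smul_pow_eq l ht x
  have hyK : y ∉ commutator K := fun hy =>
    hxK (isInvariant_of_characteristic L _ l _ (pow_mem hy t))
  obtain ⟨ε, -, hε⟩ := exists_apply_ne_one le_rfl hyK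
  exact hε (Units.ext (mul_right_cancel₀ (hf y ▸ hx) ((hfix ε y).trans (one_mul _).symm)))

end GaloisOrbit

namespace IsGaloisTransitive

variable (h : IsGaloisTransitive L K)
include h

theorem coe_mem_galoisOrbit {μ ν : K →* ℂˣ} (hμ : μ ≠ 1) (hν : ν ≠ 1) :
    ⇑ν ∈ galoisOrbit L (μ : K → ℂˣ) := by
  have hne : ∀ μ : K →* ℂˣ, μ ≠ 1 → μ.comp (Subgroup.subtype ⊤) ≠ 1 := fun μ hμ h =>
    hμ (MonoidHom.ext fun g => DFunLike.congr_fun h (⟨g, trivial⟩ : (⊤ : Subgroup K)))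
  obtain ⟨l, t, ht, hg⟩ := h ⊤ inferInstance (fun _ _ _ => trivial) _ _ (hne μ hμ) (hne ν hν) _ _
    (irrOver_top μ) (irrOver_top ν) (by simp)
  exact ⟨l, t, ht, fun g => Units.ext (hg g)⟩

variable [Finite K]

theorem exists_prime_pow_mem_commutator (hK : commutator K ≠ ⊤) :
    ∃ p, p.Prime ∧ ∀ x : K, x ^ p ∈ commutator K := by
  have hindex : (commutator K).index ≠ 1 := fun h1 => hK (Subgroup.index_eq_one.mp h1)
  set p := (commutator K).index.minFac
  have hp : p.Prime := Nat.minFac_prime hindex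
  have := Fact.mk hp
  obtain ⟨μ, hμ⟩ := exists_prime_orderOf_dvd_card' (G := K →* ℂˣ) p
    (card_monoidHom_eq_index K ▸ Nat.minFac_dvd _)
  refine ⟨p, hp, fun y => ?_⟩
  by_contra hy
  obtain ⟨ν, -, hν⟩ := exists_apply_ne_one le_rfl hy
  obtain ⟨l, t, -, hg⟩ := h.coe_mem_galoisOrbit (μ := μ) (ν := ν)
    (fun h1 => hp.ne_one (hμ ▸ orderOf_eq_one_iff.mpr h1))
    (fun h1 => hν (by rw [h1, MonoidHom.one_apply]))
  rw [map_pow, hg, ← MonoidHom.pow_apply, ← hμ, pow_orderOf_eq_one] at hν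
  exact hν rfl

theorem eq_commutator_of_ne_top {U : Subgroup K} (hU : commutator K ≤ U) (hUL : IsInvariant L U)
    (hne : U ≠ ⊤) : U = commutator K := by
  refine le_antisymm (fun x hx => ?_) hU
  by_contra hxK
  obtain ⟨y, -, hy⟩ := SetLike.exists_of_lt hne.lt_top
  obtain ⟨μ, hμU, hμy⟩ := exists_apply_ne_one hU hy
  obtain ⟨ν, -, hνx⟩ := exists_apply_ne_one le_rfl hxK
  obtain ⟨l, t, -, hg⟩ := h.coe_mem_galoisOrbit (μ := μ) (ν := ν)
    (fun h1 => hμy (by rw [h1, MonoidHom.one_apply]))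
    (fun h1 => hνx (by rw [h1, MonoidHom.one_apply]))
  exact hνx ((hg x).trans (hμU _ (hUL l _ (U.pow_mem hx t))))

end IsGaloisTransitive

end Action

/-! ### Groups of class two -/

theorem isMulCommutative_of_le_center {G : Type*} [Group G] {N : Subgroup G}
    (hN : N ≤ Subgroup.center G) : IsMulCommutative N :=
  ⟨⟨fun x y => Subtype.ext (Subgroup.mem_center_iff.mp (hN y.2) x)⟩⟩

theorem commutator_commutator_eq_bot {G : Type*} [Group G]
    (hc : commutator G ≤ Subgroup.center G) : commutator (commutator G) = ⊥ :=
  (commutator_eq_bot_iff _).mpr (isMulCommutative_of_le_center hc)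

section ClassTwo

variable {P : Type*} [Group P] (hc : commutator P ≤ Subgroup.center P)
include hc

theorem commute_of_mem_commutator {z : P} (hz : z ∈ commutator P) (x : P) : Commute z x :=
  (Subgroup.mem_center_iff.mp (hc hz) x).symm

theorem commute_commutatorElement (x y z : P) : Commute ⁅x, y⁆ z :=
  commute_of_mem_commutator hc (Subgroup.commutator_mem_commutator trivial trivial) z

/-- The homomorphism `y ↦ ⁅x, y⁆` of a group of class two. -/
def commutatorHom (x : P) : P →* commutator P where
  toFun y := ⟨⁅x, y⁆, Subgroup.commutator_mem_commutator trivial trivial⟩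
  map_one' := Subtype.ext (commutatorElement_one_right x)
  map_mul' y y' := Subtype.ext <| by
    change ⁅x, y * y'⁆ = ⁅x, y⁆ * ⁅x, y'⁆
    rw [commutatorElement_mul_right_eq_mul_conj, mul_assoc, mul_assoc, ← mul_assoc y,
      ← (commute_commutatorElement hc x y' y).eq, mul_inv_cancel_right]

theorem coe_commutatorHom (x y : P) : (commutatorHom hc x y : P) = ⁅x, y⁆ := rfl

theorem commutatorHom_mul (x x' y : P) :
    commutatorHom hc (x * x') y = commutatorHom hc x y * commutatorHom hc x' y := by
  refine Subtype.ext ?_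
  change ⁅x * x', y⁆ = ⁅x, y⁆ * ⁅x', y⁆
  rw [commutatorElement_mul_left_eq_conj_mul, ← (commute_commutatorElement hc x' y x).eq,
    mul_inv_cancel_right, (commute_commutatorElement hc x' y _).eq]

theorem commutatorHom_inv (x y : P) : (commutatorHom hc x y)⁻¹ = commutatorHom hc y x :=
  Subtype.ext (commutatorElement_inv x y)

theorem commutatorHom_eq_one_iff {x y : P} : commutatorHom hc x y = 1 ↔ Commute x y :=
  Subtype.ext_iff.trans commutatorElement_eq_one_iff_commute

theorem conj_eq_mul_commutatorHom (g x : P) : g * x * g⁻¹ = x * commutatorHom hc g x := by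
  rw [coe_commutatorHom, ← (commute_commutatorElement hc g x x).eq, commutatorElement_def,
    inv_mul_cancel_right]

theorem mul_pow_eq_mul_commutatorHom (x y : P) (n : ℕ) :
    (x * y) ^ n = x ^ n * y ^ n * commutatorHom hc y x ^ n.choose 2 :=
  mul_pow_of_commutatorElement_central (commute_commutatorElement hc y x) n

theorem pow_eq_one_of_mem_commutator {p : ℕ} (hpow : ∀ x : P, x ^ p ∈ commutator P) {z : P}
    (hz : z ∈ commutator P) : z ^ p = 1 := by
  have hle : commutator P ≤
      (powMonoidHom p : Subgroup.center P →* _).ker.map (Subgroup.center P).subtype := by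
    rw [commutator_def, Subgroup.commutator_le]
    refine fun x _ y _ => ⟨⟨⁅x, y⁆, hc (commutatorHom hc x y).2⟩, ?_, rfl⟩
    have h : commutatorHom hc x y ^ p = 1 := by
      rw [← map_pow, commutatorHom_eq_one_iff]
      exact (commute_of_mem_commutator hc (hpow y) x).symm
    exact Subtype.ext (congrArg Subtype.val h :)
  obtain ⟨z, hzp, rfl⟩ := hle hz
  exact (congrArg Subtype.val hzp :)

/-- The radical of the form `(x, y) ↦ lam ⁅x, y⁆`. -/
def radical (lam : commutator P →* ℂˣ) : Subgroup P where
  carrier := {x | ∀ y, lam (commutatorHom hc x y) = 1}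
  one_mem' y := by rw [← commutatorHom_inv, map_one, inv_one, map_one]
  mul_mem' hx hx' y := by rw [commutatorHom_mul, map_mul, hx, hx', one_mul]
  inv_mem' {x} hx y := by
    rw [← commutatorHom_inv, map_inv, map_inv, map_inv, inv_inv,
      ← commutatorHom_inv, map_inv, hx, inv_one]

theorem commutator_le_radical (lam : commutator P →* ℂˣ) : commutator P ≤ radical hc lam :=
  fun x hx y => by
    rw [(commutatorHom_eq_one_iff hc).mpr (commute_of_mem_commutator hc hx y), map_one]

instance normal_radical (lam : commutator P →* ℂˣ) : (radical hc lam).Normal :=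
  Subgroup.Normal.of_commutator_le P (commutator_le_radical hc lam)

variable {lam : commutator P →* ℂˣ}

theorem apply_commutatorHom_of_mem_radical {x : P} (hx : x ∈ radical hc lam) (y : P) :
    lam (commutatorHom hc y x) = 1 := by
  rw [← commutatorHom_inv, map_inv, hx y, inv_one]

theorem IrrOver.eq_zero_of_notMem_radical {χ : P → ℂ} (hχ : IrrOver (commutator P) lam χ) {g : P}
    (hg : g ∉ radical hc lam) : χ g = 0 := by
  contrapose! hg
  intro y
  have hconj := hχ.apply_conj g y
  rw [conj_eq_mul_commutatorHom hc, hχ.apply_mul] at hconj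
  rw [← commutatorHom_inv, map_inv, inv_eq_one]
  exact Units.ext ((mul_eq_right₀ hg).mp hconj)

variable [Finite P]

theorem exists_extension_radical (lam : commutator P →* ℂˣ) : ∃ μ : radical hc lam →* ℂˣ,
    μ.comp (Subgroup.inclusion (commutator_le_radical hc lam)) = lam := by
  have hle := commutator_le_radical hc lam
  have hcomm : commutator (radical hc lam) ≤
      (lam.ker.map (commutator P).subtype).subgroupOf (radical hc lam) := by
    rw [commutator_def, Subgroup.commutator_le]
    exact fun a _ b _ => ⟨commutatorHom hc a b, a.2 b, rfl⟩
  obtain ⟨μ, hμ⟩ := exists_extension (D := (commutator P).subgroupOf (radical hc lam))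
    (lam := lam.comp (Subgroup.subgroupOfEquivOfLe hle).toMonoidHom) fun d hd => by
      obtain ⟨z, hz, hzd⟩ := hcomm hd
      rwa [show z = Subgroup.subgroupOfEquivOfLe hle d from Subtype.ext hzd] at hz
  exact ⟨μ, MonoidHom.ext fun z => hμ ⟨Subgroup.inclusion hle z, z.2⟩⟩

theorem IrrOver.sq_mul_card_radical {μ : radical hc lam →* ℂˣ} {χ : P → ℂ}
    (h : IrrOver (radical hc lam) μ χ) (hχ : IrrOver (commutator P) lam χ) :
    χ 1 ^ 2 * Nat.card (radical hc lam) = Nat.card P := by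
  classical
  have := Fintype.ofFinite P
  have hterm : ∀ g, χ g * χ g⁻¹ = if g ∈ radical hc lam then χ 1 ^ 2 else 0 := by
    intro g
    split_ifs with hg
    · have hinv : χ g⁻¹ = (μ ⟨g, hg⟩ : ℂ)⁻¹ * χ 1 := by
        rw [← Units.val_inv_eq_inv_val, ← map_inv]
        exact h.apply_coe ⟨g, hg⟩⁻¹
      rw [h.apply_coe ⟨g, hg⟩, hinv, mul_mul_mul_comm, mul_inv_cancel₀ (Units.ne_zero _), one_mul,
        sq]
    · rw [hχ.eq_zero_of_notMem_radical hc hg, zero_mul]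
  rw [← h.sum_mul_inv, Finset.sum_congr rfl fun g _ => hterm g, ← Finset.sum_filter,
    Finset.sum_const, nsmul_eq_mul, mul_comm, Nat.card_eq_fintype_card, Fintype.card_subtype]

theorem exists_irrOver_sq_mul_card_radical (lam : commutator P →* ℂˣ) : ∃ (χ : P → ℂ) (d : ℕ),
    IrrOver (commutator P) lam χ ∧ χ 1 = d ∧ d ^ 2 * Nat.card (radical hc lam) = Nat.card P ∧
      ∀ x ∈ radical hc lam, χ x ≠ 0 := by
  have hle := commutator_le_radical hc lam
  obtain ⟨μ, hμ⟩ := exists_extension_radical hc lam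
  obtain ⟨S, hS, hsum⟩ := exists_finset_irrOver_sum_sq (radical hc lam) (ν := μ) fun g n => by
    have hconj : MulAut.conjNormal g n = n * Subgroup.inclusion hle (commutatorHom hc g n) :=
      Subtype.ext (conj_eq_mul_commutatorHom hc g n)
    rw [hconj, map_mul, ← MonoidHom.comp_apply, hμ,
      apply_commutatorHom_of_mem_radical hc n.2, mul_one]
  obtain ⟨χ, hχS⟩ : S.Nonempty := by
    rw [Finset.nonempty_iff_ne_empty]
    rintro rfl
    rw [Finset.sum_empty, eq_comm, Nat.cast_eq_zero] at hsum
    exact Subgroup.index_ne_zero_of_finite hsum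
  have hχμ := hS χ hχS
  have hχ : IrrOver (commutator P) lam χ := hμ ▸ hχμ.mono hle
  obtain ⟨d, -, hd, -⟩ := hχ.exists_degree
  have hcard := hχμ.sq_mul_card_radical hc hχ
  rw [hd] at hcard
  refine ⟨χ, d, hχ, hd, by exact_mod_cast hcard, fun x hx => ?_⟩
  rw [hχμ.apply_coe ⟨x, hx⟩]
  exact mul_ne_zero (Units.ne_zero _) hχ.apply_one_ne_zero

end ClassTwo

theorem IrrOver.mul_monoidHom {K : Type*} [Group K] {M : Subgroup K} {lam : M →* ℂˣ} {χ : K → ℂ}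
    (h : IrrOver M lam χ) {ε : K →* ℂˣ} (hε : ∀ m ∈ M, ε m = 1) :
    IrrOver M lam fun g => (ε g : ℂ) * χ g := by
  obtain ⟨d, ρ, hirr, rfl, hM⟩ := h
  let ρ' : Representation ℂ K (Fin d → ℂ) :=
    { toFun := fun g => (ε g : ℂ) • ρ g
      map_one' := by rw [map_one, map_one, Units.val_one, one_smul]
      map_mul' := fun a b => by rw [map_mul, map_mul, Units.val_mul, smul_mul_smul_comm] }
  have hρ' : ∀ g, ρ' g = (ε g : ℂ) • ρ g := fun g => rfl
  refine ⟨d, ρ', ?_, ?_, fun m => ?_⟩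
  · rw [isIrreducible_iff] at hirr ⊢
    refine ⟨hirr.1, fun W hW => hirr.2 W fun g w hw => ?_⟩
    have := W.smul_mem (ε g : ℂ)⁻¹ (hW g w hw)
    rwa [hρ', LinearMap.smul_apply, inv_smul_smul₀ (ε g).ne_zero] at this
  · ext g
    rw [character, hρ', map_smul, smul_eq_mul, character]
  · rw [hρ', hε m m.2, Units.val_one, one_smul, hM]

section Arithmetic

variable {p : ℕ} (hp : p.Prime)
include hp

theorem sq_ne_prime_mul_sq {a b : ℕ} (hb : b ≠ 0) : a ^ 2 ≠ p * b ^ 2 := by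
  intro h
  obtain ⟨c, rfl⟩ : b ∣ a := (Nat.pow_dvd_pow_iff two_ne_zero).mp (h ▸ dvd_mul_left _ _)
  refine hp.prime.not_isSquare ⟨c, ?_⟩
  refine Nat.eq_of_mul_eq_mul_right (pow_pos (Nat.pos_of_ne_zero hb) 2) ?_
  rw [← h, mul_pow, mul_comm, sq c]

theorem odd_of_pow_sub_one_dvd {n k : ℕ} (hp2 : p ≠ 2) (hk : Odd k)
    (h : p ^ n - 1 ∣ k * (p - 1)) : Odd n := by
  by_contra hn
  have hdvd : (p + 1) * (p - 1) ∣ k * (p - 1) := by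
    rw [← Nat.sq_sub_sq, one_pow]
    exact (Nat.pow_sub_one_dvd_pow_sub_one p (Nat.not_odd_iff_even.mp hn).two_dvd).trans h
  have hpk : p + 1 ∣ k := Nat.dvd_of_mul_dvd_mul_right (Nat.sub_pos_of_lt hp.one_lt) hdvd
  exact Nat.not_even_iff_odd.mpr (hk.of_dvd_nat hpk) (hp.odd_of_ne_two hp2).add_one

end Arithmetic

section Pairing

variable {G S M N : Type*} [Group G] [Group S] [CommGroup M] [CommGroup N]

theorem exists_lift_apply {s : S →* N} (hs : Function.Surjective s) (b : G →* (S →* M))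
    (hb : ∀ x, s.ker ≤ (b x).ker) : ∃ A : G →* (N →* M), ∀ x y, A x (s y) = b x y := by
  have hlift : ∀ x y, s.liftOfSurjective hs ⟨b x, hb x⟩ (s y) = b x y := fun x y =>
    MonoidHom.liftOfRightInverse_comp_apply s _ _ ⟨b x, hb x⟩ y
  refine ⟨MonoidHom.mk' (fun x => s.liftOfSurjective hs ⟨b x, hb x⟩) fun x x' => ?_, hlift⟩
  ext m
  obtain ⟨y, rfl⟩ := hs m
  rw [MonoidHom.mul_apply, hlift, hlift, hlift, map_mul, MonoidHom.mul_apply]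

/-- For a suitable `x`, the endomorphism of `M` induced by `b x` takes a value which generates its
kernel, and the kernel contains `s (f x)`. -/
theorem exists_apply_eq_of_card_le {p : ℕ} [hp : Fact p.Prime] [Finite G] [Finite M]
    (hM : ∀ m : M, m ^ p = 1) (hG : ∀ x : G, x ^ p ∈ commutator G) (hpM : p < Nat.card M)
    (hMG : Nat.card M ≤ (commutator G).index) {s : S →* M} (hs : Function.Surjective s)
    (b : G →* (S →* M)) (hb : ∀ x, s.ker ≤ (b x).ker)
    (hrange : ∀ x ∉ commutator G, (b x).range.index = p) {f : G → S}
    (hf : ∀ x, b x (f x) = 1) :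
    ∃ x ∉ commutator G, ∃ y, b x y = s (f x) := by
  obtain ⟨A, hA⟩ := exists_lift_apply hs b hb
  have hker : ∀ x ∉ commutator G, Nat.card (A x).ker = p := by
    intro x hx
    have hcomp : (A x).comp s = b x := MonoidHom.ext (hA x)
    rw [← Subgroup.index_range, ← hrange x hx, ← hcomp, MonoidHom.range_comp,
      MonoidHom.range_eq_top.mpr hs, ← MonoidHom.range_eq_map]
  have hof {x : G} (hx : Abelianization.of x ≠ 1) : x ∉ commutator G :=
    mt (QuotientGroup.eq_one_iff x).mpr hx
  obtain ⟨a, ha, u, hu, huu⟩ := exists_apply_apply_eq_one (A := Abelianization G) hM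
    (fun a => by
      obtain ⟨x, rfl⟩ := QuotientGroup.mk_surjective a
      exact (QuotientGroup.eq_one_iff _).mpr (hG x))
    (Abelianization.lift A) hpM hMG fun a ha => by
      obtain ⟨x, rfl⟩ := QuotientGroup.mk_surjective a
      exact hker x (hof ha)
  obtain ⟨x, rfl⟩ : ∃ x, Abelianization.of x = a := QuotientGroup.mk_surjective a
  rw [Abelianization.lift_apply_of] at hu huu
  have hx := hof ha
  have hfker : s (f x) ∈ (A x).ker := (hA x (f x)).trans (hf x)
  obtain ⟨k, hk⟩ := mem_zpowers_of_prime_card (hker x hx) (g := ⟨A x u, huu⟩)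
    (g' := ⟨s (f x), hfker⟩) fun h => hu (congrArg Subtype.val h)
  obtain ⟨y, rfl⟩ := hs u
  refine ⟨x, hx, y ^ k, ?_⟩
  rw [map_zpow, ← hA]
  exact congrArg Subtype.val hk

end Pairing

theorem index_dvd_of_sup_zpowers_eq_top {G : Type*} [Group G] {N : Subgroup G} [N.Normal] {g : G}
    (h : N ⊔ Subgroup.zpowers g = ⊤) {n : ℕ} (hg : g ^ n = 1) : N.index ∣ n := by
  have htop : Subgroup.zpowers (QuotientGroup.mk' N g) = ⊤ := by
    rw [← Subgroup.map_top_of_surjective _ (QuotientGroup.mk'_surjective N), ← h, Subgroup.map_sup,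
      QuotientGroup.map_mk'_self, bot_sup_eq, MonoidHom.map_zpowers]
  rw [Subgroup.index_eq_card, ← Subgroup.card_top, ← htop, Nat.card_zpowers]
  exact orderOf_dvd_of_pow_eq_one (by rw [← map_pow, hg, map_one])

theorem IsFixedPointFree.odd_card {L P : Type*} [Group L] [Group P] [MulDistribMulAction L P]
    [Finite L] [Finite P] (h : IsFixedPointFree L P) (hne : commutator P ≠ ⊥) :
    Odd (Nat.card L) := by
  contrapose! hne
  obtain ⟨l, hl⟩ := exists_prime_orderOf_dvd_card' 2 (Nat.not_odd_iff_even.mp hne).two_dvd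
  have hfpf : MonoidHom.FixedPointFree (MulDistribMulAction.toMonoidHom P l) :=
    h l (orderOf_eq_one_iff.not.mp (hl.trans_ne (by decide)))
  have hinv : Function.Involutive (MulDistribMulAction.toMonoidHom P l) := fun x => by
    change l • l • x = x
    rw [← mul_smul, ← sq, ← hl, pow_orderOf_eq_one, one_smul]
  exact (commutator_eq_bot_iff P).mpr ⟨⟨hfpf.commute_all_of_involutive hinv⟩⟩

section PGroups

/-- The `p`-groups with operators to which the condition `GC*` leads: `L` acts on `P` without fixed
points, and irreducible characters of the same degree are conjugate as in `IsGaloisTransitive`. -/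
structure IsGaloisPGroup (p : ℕ) (L P : Type*) [Group L] [Group P] [MulDistribMulAction L P] :
    Prop where
  isGaloisTransitive : IsGaloisTransitive L P
  isFixedPointFree : IsFixedPointFree L P
  isPGroup : IsPGroup p P

variable {p : ℕ} {L P : Type*} [Group L] [Group P] [MulDistribMulAction L P]

/-- The character `χ` cut off outside the elements whose `p`-th power acts trivially. -/
noncomputable def cutoff (p : ℕ) (χ : P → ℂ) : P → ℂ := {g | χ (g ^ p) = χ 1}.indicator χ

namespace IsGaloisPGroup

variable [Finite P]

theorem quotient (h : IsGaloisPGroup p L P) {N : Subgroup P} [N.Normal]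
    (hN : IsInvariant L N) : let _ := quotientAction hN; IsGaloisPGroup p L (P ⧸ N) :=
  let _ := quotientAction hN
  ⟨h.isGaloisTransitive.of_surjective (QuotientGroup.mk'_surjective N) fun _ _ => rfl,
    h.isFixedPointFree.quotient hN, h.isPGroup.to_quotient N⟩

theorem center_eq_commutator (h : IsGaloisPGroup p L P) (hc : commutator P ≤ Subgroup.center P)
    (hne : commutator P ≠ ⊥) : Subgroup.center P = commutator P :=
  h.isGaloisTransitive.eq_commutator_of_ne_top hc (isInvariant_of_characteristic L _) fun htop =>
    hne ((commutator_eq_bot_iff_center_eq_top P).mpr htop)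

variable [hp : Fact p.Prime]

theorem commutator_ne_top [Nontrivial P] (h : IsGaloisPGroup p L P) : commutator P ≠ ⊤ :=
  have := h.isPGroup.isNilpotent
  (Group.IsSolvable.commutator_lt_top_of_nontrivial P).ne

theorem pow_mem (h : IsGaloisPGroup p L P) (x : P) : x ^ p ∈ commutator P := by
  cases subsingleton_or_nontrivial P
  · exact Subsingleton.elim 1 (x ^ p) ▸ one_mem _
  obtain ⟨q, hq, hqP⟩ := h.isGaloisTransitive.exists_prime_pow_mem_commutator h.commutator_ne_top
  obtain rfl | hpq := eq_or_ne p q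
  · exact hqP x
  refine absurd (eq_top_iff.mpr fun y _ => ?_) h.commutator_ne_top
  obtain ⟨n, hn⟩ := h.isPGroup y
  have hcop : (orderOf y).Coprime q :=
    (((Nat.coprime_primes hp.out hq).mpr hpq).pow_left n).coprime_dvd_left
      (orderOf_dvd_of_pow_eq_one hn)
  obtain ⟨m, hm⟩ := exists_pow_eq_self_of_coprime hcop.symm
  exact hm ▸ Subgroup.pow_mem _ (hqP y) m

theorem index_sub_one_dvd [Nontrivial P] (h : IsGaloisPGroup p L P) :
    (commutator P).index - 1 ∣ Nat.card L * (p - 1) := by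
  obtain ⟨n, hn0, hn⟩ := h.isPGroup.nontrivial_iff_card.mp ‹_›
  exact index_commutator_sub_one_dvd (hn ▸ dvd_pow_self p hn0.ne') h.pow_mem h.commutator_ne_top
    fun μ ν => h.isGaloisTransitive.coe_mem_galoisOrbit

theorem cutoff_mul_mem_galoisOrbit (h : IsGaloisPGroup p L P) {lam : commutator P →* ℂˣ}
    (hlam : lam ≠ 1) {χ : P → ℂ} (hχ : IrrOver (commutator P) lam χ) (ε : P →* ℂˣ) :
    (fun g => (ε g : ℂ) * cutoff p χ g) ∈ galoisOrbit L (cutoff p χ) := by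
  have hε : ∀ m ∈ commutator P, ε m = 1 := fun m hm => apply_eq_one_of_mem_commutator ε hm
  obtain ⟨l, t, ht, hg⟩ := h.isGaloisTransitive (commutator P) inferInstance
    (isInvariant_of_characteristic L _) lam lam hlam hlam χ _ hχ (hχ.mul_monoidHom hε)
    (by rw [map_one, Units.val_one, one_mul])
  refine ⟨l, t, ht, fun g => ?_⟩
  have hgp : χ ((l • g ^ t) ^ p) = χ (g ^ p) := by
    rw [← smul_pow', ← pow_mul, mul_comm, pow_mul, ← hg, hε _ (h.pow_mem g), Units.val_one,
      one_mul]
  simp only [cutoff, Set.indicator_apply, Set.mem_ofPred_eq, hgp]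
  split_ifs
  · exact hg g
  · exact mul_zero _

section ClassTwo

variable (hc : commutator P ≤ Subgroup.center P) {lam lam₁ lam₂ : commutator P →* ℂˣ}
include hc

theorem cutoff_pow (h : IsGaloisPGroup p L P) {χ : P → ℂ} (hχ : IrrOver (commutator P) lam χ)
    (g : P) {t : ℕ} (ht : t ≡ 1 [MOD p]) : cutoff p χ (g ^ t) = cutoff p χ g := by
  have ht0 : t ≠ 0 := by
    rintro rfl
    exact hp.out.one_lt.ne' (Nat.dvd_one.mp (Nat.modEq_zero_iff_dvd.mp ht.symm))
  obtain ⟨k, hk⟩ := (Nat.modEq_iff_dvd' (Nat.one_le_iff_ne_zero.mpr ht0)).mp ht.symm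
  have hgt : g ^ t = g * (g ^ p) ^ k := by
    rw [← pow_mul, ← hk, mul_pow_sub_one ht0]
  have hgtp : (g ^ t) ^ p = g ^ p := by
    rw [hgt, (((Commute.refl g).pow_right p).pow_right k).mul_pow,
      pow_eq_one_of_mem_commutator hc h.pow_mem (Subgroup.pow_mem _ (h.pow_mem g) k), mul_one]
  simp only [cutoff, Set.indicator_apply, Set.mem_ofPred_eq, hgtp]
  split_ifs with hgp
  · have hlam : lam ⟨g ^ p, h.pow_mem g⟩ = 1 := by
      rw [hχ.apply_coe ⟨g ^ p, h.pow_mem g⟩, mul_eq_right₀ hχ.apply_one_ne_zero] at hgp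
      exact Units.ext hgp
    have hmul := hχ.apply_mul g (⟨g ^ p, h.pow_mem g⟩ ^ k)
    rwa [map_pow, hlam, one_pow, Units.val_one, one_mul, Subgroup.coe_pow, ← hgt] at hmul
  · rfl

theorem mem_commutator_of_mem_radical (h : IsGaloisPGroup p L P) (hlam : lam ≠ 1) {x : P}
    (hx : x ∈ radical hc lam) (hxp : lam ⟨x ^ p, h.pow_mem x⟩ = 1) : x ∈ commutator P := by
  cases subsingleton_or_nontrivial P
  · exact Subsingleton.elim 1 x ▸ one_mem _
  obtain ⟨χ, -, hχ, -, -, hχx⟩ := exists_irrOver_sq_mul_card_radical hc lam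
  refine mem_commutator_of_apply_ne_zero (F := cutoff p χ)
    (h.cutoff_mul_mem_galoisOrbit hlam hχ) h.isPGroup (h.isFixedPointFree.not_dvd_card h.isPGroup)
    (fun g t => h.cutoff_pow hc hχ g) ?_
  have hxp' : χ (x ^ p) = χ 1 := by
    rw [hχ.apply_coe ⟨x ^ p, h.pow_mem x⟩, hxp, Units.val_one, one_mul]
  exact (Set.indicator_of_mem (s := {g | χ (g ^ p) = χ 1}) hxp' χ).trans_ne (hχx x hx)

theorem card_radical (h : IsGaloisPGroup p L P) (hlam : lam ≠ 1) :
    Nat.card (radical hc lam) = Nat.card (commutator P) ∨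
      Nat.card (radical hc lam) = p * Nat.card (commutator P) := by
  have hle := commutator_le_radical hc lam
  let θ : radical hc lam →* ℂˣ := MonoidHom.mk' (fun x => lam ⟨(x : P) ^ p, h.pow_mem x⟩)
    fun x y => by
      have hxy : (⟨(x * y : P) ^ p, h.pow_mem _⟩ : commutator P) = ⟨(x : P) ^ p, h.pow_mem x⟩ *
          ⟨(y : P) ^ p, h.pow_mem y⟩ * commutatorHom hc y x ^ p.choose 2 :=
        Subtype.ext (mul_pow_eq_mul_commutatorHom hc x y p)
      change lam ⟨(x * y : P) ^ p, _⟩ = _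
      rw [hxy, map_mul, map_pow, y.2, one_pow, mul_one, map_mul]
  have hpow_one {z : P} (hz : z ∈ commutator P) : z ^ p = 1 :=
    pow_eq_one_of_mem_commutator hc h.pow_mem hz
  have hker : θ.ker = (commutator P).subgroupOf (radical hc lam) := by
    refine le_antisymm (fun x hx => h.mem_commutator_of_mem_radical hc hlam x.2 hx) fun x hx => ?_
    change lam ⟨(x : P) ^ p, _⟩ = 1
    exact (congrArg lam (Subtype.ext (hpow_one hx))).trans (map_one lam)
  have hrange : θ.range ≤ rootsOfUnity p ℂ := by
    rintro _ ⟨x, rfl⟩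
    rw [mem_rootsOfUnity]
    change lam ⟨(x : P) ^ p, _⟩ ^ p = 1
    rw [← map_pow]
    exact (congrArg lam (Subtype.ext (hpow_one (h.pow_mem x)))).trans (map_one lam)
  have : NeZero p := ⟨hp.out.ne_zero⟩
  have hdvd := Subgroup.card_dvd_of_le hrange
  rw [← Subgroup.index_ker, hker, Complex.card_rootsOfUnity] at hdvd
  rw [← ((commutator P).subgroupOf (radical hc lam)).index_mul_card,
    Nat.card_congr (Subgroup.subgroupOfEquivOfLe hle).toEquiv]
  exact ((Nat.dvd_prime hp.out).mp hdvd).imp (fun h1 => by rw [h1, one_mul]) fun hp => by rw [hp]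

theorem card_radical_eq_card_radical (h : IsGaloisPGroup p L P) (h₁ : lam₁ ≠ 1) (h₂ : lam₂ ≠ 1) :
    Nat.card (radical hc lam₁) = Nat.card (radical hc lam₂) := by
  obtain ⟨-, d₁, -, -, hd₁, -⟩ := exists_irrOver_sq_mul_card_radical hc lam₁
  obtain ⟨-, d₂, -, -, hd₂, -⟩ := exists_irrOver_sq_mul_card_radical hc lam₂
  have hne {d r : ℕ} (hd : d ^ 2 * r = Nat.card P) : d ≠ 0 := by
    rintro rfl
    rw [zero_pow two_ne_zero, zero_mul] at hd
    exact Nat.card_pos.ne hd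
  have hcard : 0 < Nat.card (commutator P) := Nat.card_pos
  rcases h.card_radical hc h₁ with c₁ | c₁ <;> rcases h.card_radical hc h₂ with c₂ | c₂
  · rw [c₁, c₂]
  · refine absurd (Nat.eq_of_mul_eq_mul_right hcard ?_)
      (sq_ne_prime_mul_sq hp.out (a := d₁) (hne hd₂))
    rw [mul_right_comm, mul_comm _ (d₂ ^ 2), ← c₁, hd₁, ← hd₂, c₂, c₁]
  · refine absurd (Nat.eq_of_mul_eq_mul_right hcard ?_)
      (sq_ne_prime_mul_sq hp.out (a := d₂) (hne hd₁))
    rw [mul_right_comm, mul_comm _ (d₁ ^ 2), ← c₂, hd₂, ← hd₁, c₁, c₂]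
  · rw [c₁, c₂]

theorem mem_galoisOrbit_commutator (h : IsGaloisPGroup p L P) (h₁ : lam₁ ≠ 1) (h₂ : lam₂ ≠ 1) :
    let _ := restrictAction (isInvariant_of_characteristic L (commutator P))
    ⇑lam₂ ∈ galoisOrbit L (lam₁ : commutator P → ℂˣ) := by
  intro _
  obtain ⟨χ₁, d₁, hχ₁, hd₁, hcard₁, -⟩ := exists_irrOver_sq_mul_card_radical hc lam₁
  obtain ⟨χ₂, d₂, hχ₂, hd₂, hcard₂, -⟩ := exists_irrOver_sq_mul_card_radical hc lam₂
  have hd : d₁ = d₂ := by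
    rw [← hcard₁, h.card_radical_eq_card_radical hc h₁ h₂] at hcard₂
    exact Nat.pow_left_injective two_ne_zero
      (Nat.eq_of_mul_eq_mul_right Nat.card_pos hcard₂.symm)
  have hdeg : χ₁ 1 = χ₂ 1 := by rw [hd₁, hd₂, hd]
  obtain ⟨l, t, ht, hg⟩ := h.isGaloisTransitive (commutator P) inferInstance
    (isInvariant_of_characteristic L _) lam₁ lam₂ h₁ h₂ χ₁ χ₂ hχ₁ hχ₂ hdeg
  refine ⟨l, t, ht.coprime_dvd_right (Subgroup.card_subgroup_dvd_card _), fun z => ?_⟩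
  have hz := (hχ₂.apply_coe z).symm.trans ((hg z).trans (hχ₁.apply_coe (l • z ^ t)))
  rw [hdeg] at hz
  exact Units.ext (mul_right_cancel₀ hχ₂.apply_one_ne_zero hz)

theorem card_commutator_sub_one_dvd (h : IsGaloisPGroup p L P) (hne : commutator P ≠ ⊥) :
    Nat.card (commutator P) - 1 ∣ Nat.card L * (p - 1) := by
  let _ := restrictAction (isInvariant_of_characteristic L (commutator P))
  have hbot := commutator_commutator_eq_bot hc
  have : Nontrivial (commutator P) := (Subgroup.nontrivial_iff_ne_bot _).mpr hne
  obtain ⟨n, hn0, hn⟩ := (h.isPGroup.to_subgroup (commutator P)).nontrivial_iff_card.mp this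
  have hdvd := index_commutator_sub_one_dvd (L := L) (K := commutator P)
    (hn ▸ dvd_pow_self p hn0.ne')
    (fun z => by
      rw [hbot, Subgroup.mem_bot]
      exact Subtype.ext (pow_eq_one_of_mem_commutator hc h.pow_mem z.2))
    (hbot ▸ bot_ne_top) fun μ ν => h.mem_galoisOrbit_commutator hc
  rwa [hbot, Subgroup.index_bot] at hdvd

theorem range_commutatorHom_sup_zpowers_eq_top (h : IsGaloisPGroup p L P) {x : P}
    (hx : x ∉ commutator P) :
    (commutatorHom hc x).range ⊔ Subgroup.zpowers ⟨x ^ p, h.pow_mem x⟩ = ⊤ := by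
  have hbot := commutator_commutator_eq_bot hc
  by_contra hne
  obtain ⟨z, -, hz⟩ := SetLike.exists_of_lt (lt_top_iff_ne_top.mpr hne)
  obtain ⟨lam, hlam, hlamz⟩ := exists_apply_ne_one (hbot ▸ bot_le) hz
  refine hx (h.mem_commutator_of_mem_radical hc (lam := lam) (fun h1 => hlamz (by rw [h1]; rfl))
    (fun y => ?_) ?_)
  · exact hlam _ (Subgroup.mem_sup_left ⟨y, rfl⟩)
  · exact hlam _ (Subgroup.mem_sup_right (Subgroup.mem_zpowers _))

section Odd

variable (hp2 : p ≠ 2)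
include hp2

theorem card_radical_of_odd [Finite L] [Nontrivial P] (h : IsGaloisPGroup p L P)
    (hne : commutator P ≠ ⊥) (hlam : lam ≠ 1) :
    Nat.card (radical hc lam) = p * Nat.card (commutator P) := by
  refine (h.card_radical hc hlam).resolve_left fun hrad => ?_
  obtain ⟨n, hn⟩ := (h.isPGroup.to_quotient (commutator P)).exists_card_eq
  rw [← Subgroup.index_eq_card] at hn
  obtain ⟨k, rfl⟩ := odd_of_pow_sub_one_dvd hp.out hp2 (h.isFixedPointFree.odd_card hne)
    (hn ▸ h.index_sub_one_dvd)
  obtain ⟨-, d, -, -, hd, -⟩ := exists_irrOver_sq_mul_card_radical hc lam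
  rw [hrad, ← (commutator P).index_mul_card, hn] at hd
  refine sq_ne_prime_mul_sq hp.out (a := d) (pow_ne_zero k hp.out.ne_zero) ?_
  rw [Nat.eq_of_mul_eq_mul_right Nat.card_pos hd]
  ring

/-- The `p`-th power map, which is a homomorphism in a group of class two if `p` is odd. -/
def powHom (h : IsGaloisPGroup p L P) : P →* commutator P :=
  MonoidHom.mk' (fun x => ⟨x ^ p, h.pow_mem x⟩) fun x y => by
    obtain ⟨k, hk⟩ : p ∣ p.choose 2 :=
      hp.out.dvd_choose_self two_ne_zero (hp.out.two_le.lt_of_ne' hp2)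
    refine Subtype.ext ((mul_pow_eq_mul_commutatorHom hc x y p).trans ?_)
    rw [hk, pow_mul, pow_eq_one_of_mem_commutator hc h.pow_mem (SetLike.coe_mem _), one_pow,
      mul_one, Subgroup.coe_mul]

variable [Finite L] [Nontrivial P]

theorem ker_powHom (h : IsGaloisPGroup p L P) (hne : commutator P ≠ ⊥) :
    (h.powHom hc hp2).ker = commutator P := by
  have hbot := commutator_commutator_eq_bot hc
  refine h.isGaloisTransitive.eq_commutator_of_ne_top
    (fun x hx => Subtype.ext (pow_eq_one_of_mem_commutator hc h.pow_mem hx)) (fun l u hu => ?_)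
    fun htop => ?_
  · refine Subtype.ext ((smul_pow' l u p).symm.trans ?_)
    rw [show u ^ p = 1 from congrArg Subtype.val hu, smul_one, OneMemClass.coe_one]
  obtain ⟨z, hz⟩ := Subgroup.ne_bot_iff_exists_ne_one.mp hne
  obtain ⟨lam, -, hlamz⟩ := exists_apply_ne_one (D := commutator (commutator P)) le_rfl (x := z)
    (by rwa [hbot, Subgroup.mem_bot])
  have hlam : lam ≠ 1 := fun h1 => hlamz (by rw [h1, MonoidHom.one_apply])
  have hrad : radical hc lam ≤ commutator P := fun x hx =>
    h.mem_commutator_of_mem_radical hc hlam hx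
      ((congrArg lam (htop ▸ Subgroup.mem_top x : x ∈ (h.powHom hc hp2).ker)).trans (map_one lam))
  have hcard := h.card_radical_of_odd hc hp2 hne hlam
  rw [hrad.antisymm (commutator_le_radical hc lam), right_eq_mul₀ Nat.card_pos.ne'] at hcard
  exact hp.out.one_lt.ne' hcard

theorem powHom_surjective (h : IsGaloisPGroup p L P) (hne : commutator P ≠ ⊥) :
    Function.Surjective (h.powHom hc hp2) := by
  have hbot := commutator_commutator_eq_bot hc
  rw [← MonoidHom.range_eq_top]
  by_contra hR
  obtain ⟨z, -, hz⟩ := SetLike.exists_of_lt (lt_top_iff_ne_top.mpr hR)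
  obtain ⟨lam₁, hlam₁, h₁⟩ := exists_apply_ne_one (hbot ▸ bot_le) hz
  obtain ⟨x, -, hx⟩ := SetLike.exists_of_lt h.commutator_ne_top.lt_top
  obtain ⟨lam₂, -, h₂⟩ := exists_apply_ne_one (D := commutator (commutator P)) le_rfl
    (x := h.powHom hc hp2 x)
    (by rwa [hbot, Subgroup.mem_bot, ← MonoidHom.mem_ker, h.ker_powHom hc hp2 hne])
  obtain ⟨l, t, -, hlt⟩ := h.mem_galoisOrbit_commutator hc (lam₁ := lam₁) (lam₂ := lam₂)
    (fun h1 => h₁ (by rw [h1, MonoidHom.one_apply])) fun h1 => h₂ (by rw [h1, MonoidHom.one_apply])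
  refine h₂ ((hlt _).trans (hlam₁ _ ⟨l • x ^ t, Subtype.ext ?_⟩))
  change (l • x ^ t) ^ p = l • (x ^ p) ^ t
  rw [← smul_pow', ← pow_mul, ← pow_mul, mul_comm]

theorem index_range_commutatorHom (h : IsGaloisPGroup p L P) (hne : commutator P ≠ ⊥) {x : P}
    (hx : x ∉ commutator P) : (commutatorHom hc x).range.index = p := by
  have := isMulCommutative_of_le_center hc
  have hdvd : (commutatorHom hc x).range.index ∣ p :=
    index_dvd_of_sup_zpowers_eq_top (h.range_commutatorHom_sup_zpowers_eq_top hc hx)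
      (Subtype.ext (pow_eq_one_of_mem_commutator hc h.pow_mem (h.pow_mem x)))
  refine ((Nat.dvd_prime hp.out).mp hdvd).resolve_left fun h1 => hx ?_
  have hle : commutator P ≤ (commutatorHom hc x).ker := fun y hy =>
    (commutatorHom_eq_one_iff hc).mpr (commute_of_mem_commutator hc hy x).symm
  have hcard : Nat.card (commutator P) = (commutator P).index := by
    rw [← h.ker_powHom hc hp2 hne, Subgroup.index_ker,
      MonoidHom.range_eq_top.mpr (h.powHom_surjective hc hp2 hne), Subgroup.card_top,
      h.ker_powHom hc hp2 hne]
  have hindex : (commutatorHom hc x).ker.index = (commutator P).index := by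
    rw [Subgroup.index_ker, Subgroup.index_eq_one.mp h1, Subgroup.card_top, hcard]
  have hrel := Subgroup.relIndex_mul_index hle
  rw [hindex, mul_eq_right₀ Subgroup.index_ne_zero_of_finite] at hrel
  exact Subgroup.relIndex_eq_one.mp hrel ((commutatorHom_eq_one_iff hc).mpr (Commute.refl x))

theorem lt_card_commutator (h : IsGaloisPGroup p L P) (hne : commutator P ≠ ⊥) :
    p < Nat.card (commutator P) := by
  obtain ⟨x, -, hx⟩ := SetLike.exists_of_lt h.commutator_ne_top.lt_top
  have hrange : (commutatorHom hc x).range ≠ ⊥ := fun hbot => hx <| by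
    rw [← h.center_eq_commutator hc hne, Subgroup.mem_center_iff]
    exact fun y => ((commutatorHom_eq_one_iff hc).mp
      (DFunLike.congr_fun (MonoidHom.range_eq_bot_iff.mp hbot) y)).symm
  rw [← (commutatorHom hc x).range.index_mul_card, h.index_range_commutatorHom hc hp2 hne hx]
  exact lt_mul_of_one_lt_right hp.out.pos (Subgroup.one_lt_card_iff_ne_bot _ |>.mpr hrange)

theorem commutator_eq_bot_of_odd (h : IsGaloisPGroup p L P) : commutator P = ⊥ := by
  by_contra hne
  have := isMulCommutative_of_le_center hc
  have hker := h.ker_powHom hc hp2 hne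
  have hsurj := h.powHom_surjective hc hp2 hne
  have hcard : Nat.card (commutator P) = (commutator P).index := by
    rw [← hker, Subgroup.index_ker, MonoidHom.range_eq_top.mpr hsurj, Subgroup.card_top, hker]
  let b : P →* (P →* commutator P) :=
    MonoidHom.mk' (commutatorHom hc) fun x y => MonoidHom.ext (commutatorHom_mul hc x y)
  obtain ⟨x, hx, y, hy⟩ := exists_apply_eq_of_card_le (p := p)
    (fun m => Subtype.ext (pow_eq_one_of_mem_commutator hc h.pow_mem m.2)) h.pow_mem
    (h.lt_card_commutator hc hp2 hne) hcard.le hsurj b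
    (fun x y hy => (commutatorHom_eq_one_iff hc).mpr
      (commute_of_mem_commutator hc (hker.le hy) x).symm)
    (fun x hx => h.index_range_commutatorHom hc hp2 hne hx) (f := id)
    fun x => (commutatorHom_eq_one_iff hc).mpr (Commute.refl x)
  have hindex := h.index_range_commutatorHom hc hp2 hne hx
  have hmem : Subgroup.zpowers ⟨x ^ p, h.pow_mem x⟩ ≤ (commutatorHom hc x).range :=
    Subgroup.zpowers_le.mpr ⟨y, hy⟩
  rw [← sup_eq_left.mpr hmem, h.range_commutatorHom_sup_zpowers_eq_top hc hx,
    Subgroup.index_top] at hindex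
  exact hp.out.one_lt.ne hindex

end Odd

end ClassTwo

end IsGaloisPGroup

namespace IsGaloisPGroup

variable [Finite P] (h : IsGaloisPGroup 2 L P)
include h

theorem index_commutator [Nontrivial P] : (commutator P).index = Nat.card L + 1 := by
  let _ := quotientAction (isInvariant_of_characteristic L (commutator P))
  have hdvd := h.index_sub_one_dvd
  rw [Nat.add_sub_cancel_left 1 1, mul_one] at hdvd
  rw [← Nat.dvd_antisymm hdvd ?_, Nat.sub_add_cancel
    (Nat.one_le_iff_ne_zero.mpr Subgroup.index_ne_zero_of_finite)]
  exact (h.isFixedPointFree.quotient (isInvariant_of_characteristic L (commutator P))).card_dvd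

theorem card_commutator (hc : commutator P ≤ Subgroup.center P) (hne : commutator P ≠ ⊥) :
    Nat.card (commutator P) = Nat.card L + 1 := by
  let _ := restrictAction (isInvariant_of_characteristic L (commutator P))
  have hdvd := h.card_commutator_sub_one_dvd hc hne
  rw [Nat.add_sub_cancel_left 1 1, mul_one] at hdvd
  rw [← Nat.dvd_antisymm hdvd ?_, Nat.sub_add_cancel Nat.card_pos]
  exact (h.isFixedPointFree.restrict (isInvariant_of_characteristic L (commutator P))).card_dvd

end IsGaloisPGroup

end PGroups

theorem exists_sq_ne_one {G : Type*} [Group G] (hne : commutator G ≠ ⊥) : ∃ x : G, x ^ 2 ≠ 1 := by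
  contrapose! hne
  exact (commutator_eq_bot_iff G).mpr
    ⟨⟨Commute.of_orderOf_dvd_two fun x => orderOf_dvd_of_pow_eq_one (hne x)⟩⟩

namespace IsGaloisPGroup

variable {L P : Type*} [Group L] [Group P] [MulDistribMulAction L P] [Finite P]
  (h : IsGaloisPGroup 2 L P)
include h

theorem exists_smul_mul_eq {x y : P} (hx : x ∉ commutator P) (hy : y ∉ commutator P) :
    ∃ l : L, ∃ d ∈ commutator P, l • x * d = y := by
  have hinv := isInvariant_of_characteristic L (commutator P)
  let _ := quotientAction hinv
  have : Nontrivial P := ⟨x, 1, fun hx1 => hx (hx1 ▸ one_mem _)⟩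
  have hmk {z : P} (hz : z ∉ commutator P) : (z : P ⧸ commutator P) ≠ 1 :=
    mt (QuotientGroup.eq_one_iff z).mp hz
  obtain ⟨l, hl⟩ :=
    (h.isFixedPointFree.quotient hinv).exists_smul_eq h.index_commutator (hmk hx) (hmk hy)
  exact ⟨l, (l • x)⁻¹ * y, QuotientGroup.eq.mp hl, mul_inv_cancel_left _ _⟩

section ClassTwo

variable (hc : commutator P ≤ Subgroup.center P) (hne : commutator P ≠ ⊥)
include hc hne

theorem exists_smul_eq_of_mem_commutator {x y : P} (hx : x ∈ commutator P)
    (hy : y ∈ commutator P) (hx1 : x ≠ 1) (hy1 : y ≠ 1) : ∃ l : L, l • x = y := by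
  have hinv := isInvariant_of_characteristic L (commutator P)
  let _ := restrictAction hinv
  obtain ⟨l, hl⟩ := (h.isFixedPointFree.restrict hinv).exists_smul_eq (h.card_commutator hc hne)
    (x := ⟨x, hx⟩) (y := ⟨y, hy⟩) (mt (congrArg Subtype.val) hx1) (mt (congrArg Subtype.val) hy1)
  exact ⟨l, congrArg Subtype.val hl⟩

theorem sq_ne_one {x : P} (hx : x ∉ commutator P) : x ^ 2 ≠ 1 := by
  obtain ⟨y, hy⟩ := exists_sq_ne_one hne
  have hyc : y ∉ commutator P := fun hyc => hy (pow_eq_one_of_mem_commutator hc h.pow_mem hyc)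
  obtain ⟨l, d, hd, rfl⟩ := h.exists_smul_mul_eq hyc hx
  rw [(commute_of_mem_commutator hc hd (l • y)).symm.mul_pow,
    pow_eq_one_of_mem_commutator hc h.pow_mem hd, mul_one, ← smul_pow']
  exact smul_ne_one l hy

theorem exists_sq_eq {y : P} (hy : y ∈ commutator P) (hy1 : y ≠ 1) :
    ∃ x ∉ commutator P, x ^ 2 = y := by
  obtain ⟨x, hx⟩ := exists_sq_ne_one hne
  obtain ⟨l, hl⟩ := h.exists_smul_eq_of_mem_commutator hc hne (h.pow_mem x) hy hx hy1
  rw [smul_pow'] at hl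
  exact ⟨l • x, fun hlx => hy1 (hl ▸ pow_eq_one_of_mem_commutator hc h.pow_mem hlx), hl⟩

end ClassTwo

end IsGaloisPGroup

section Counting

variable {ι : Type*} {S : Finset ι} {a : ι → ℕ}

theorem three_mul_sum_four_pow_add_le {c m : ℕ} (hfibre : ∀ i ∈ S, (S.filter (a · = a i)).card ≤ c)
    (ha : ∀ i ∈ S, a i < m) : 3 * ∑ i ∈ S, 4 ^ a i + c ≤ c * 4 ^ m := by
  have hcard (j : ℕ) : (S.filter (a · = j)).card ≤ c := by
    obtain hempty | ⟨i, hi⟩ := (S.filter (a · = j)).eq_empty_or_nonempty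
    · rw [hempty, Finset.card_empty]
      exact c.zero_le
    · obtain ⟨hiS, rfl⟩ := Finset.mem_filter.mp hi
      exact hfibre i hiS
  have hsum : ∑ i ∈ S, 4 ^ a i ≤ c * ∑ j ∈ Finset.range m, 4 ^ j := by
    rw [← Finset.sum_fiberwise_of_maps_to fun i hi => Finset.mem_range.mpr (ha i hi),
      Finset.mul_sum]
    refine Finset.sum_le_sum fun j _ => ?_
    rw [Finset.sum_congr rfl fun i hi => by rw [(Finset.mem_filter.mp hi).2], Finset.sum_const,
      smul_eq_mul]
    exact Nat.mul_le_mul_right _ (hcard j)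
  calc 3 * ∑ i ∈ S, 4 ^ a i + c ≤ 3 * (c * ∑ j ∈ Finset.range m, 4 ^ j) + c := by gcongr
    _ = c * ((∑ j ∈ Finset.range m, 4 ^ j) * 3 + 1) := by ring
    _ = c * 4 ^ m := congrArg (c * ·) (geom_sum_mul_add 3 m)

variable {k : ℕ} (hsum : ∑ i ∈ S, 4 ^ a i = 2 * 4 ^ k)
include hsum

theorem le_of_sum_four_pow_eq {i : ι} (hi : i ∈ S) : a i ≤ k := by
  have hle : 4 ^ a i ≤ 2 * 4 ^ k := hsum ▸
    Finset.single_le_sum (f := fun i => 4 ^ a i) (fun _ _ => Nat.zero_le _) hi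
  refine Nat.lt_succ_iff.mp ((Nat.pow_lt_pow_iff_right (a := 4) (by decide)).mp (hle.trans_lt ?_))
  rw [pow_succ']
  gcongr
  decide

theorem exists_eq_of_sum_four_pow_eq (hfibre : ∀ i ∈ S, (S.filter (a · = a i)).card ≤ 4) :
    ∃ i ∈ S, a i = k := by
  by_contra! hne
  have := three_mul_sum_four_pow_add_le hfibre fun i hi =>
    (le_of_sum_four_pow_eq hsum hi).lt_of_ne (hne i hi)
  omega

theorem exists_ne_of_sum_four_pow_eq : ∃ i ∈ S, ∃ j ∈ S, i ≠ j ∧ a i = a j := by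
  by_contra! hinj
  have hfibre : ∀ i ∈ S, (S.filter (a · = a i)).card ≤ 1 := fun i _ => by
    simp only [Finset.card_le_one, Finset.mem_filter]
    exact fun j hj l hl => by_contra fun hjl => hinj j hj.1 l hl.1 hjl (hj.2.trans hl.2.symm)
  have := three_mul_sum_four_pow_add_le hfibre fun i hi =>
    Nat.lt_succ_of_le (le_of_sum_four_pow_eq hsum hi)
  rw [pow_succ] at this
  omega

end Counting

theorem exists_finset_irrOver_sum_four_pow {G : Type*} [Group G] [Finite G] (hG : IsPGroup 2 G)
    (N : Subgroup G) [N.Normal] {ν : N →* ℂˣ} (hν : ∀ g n, ν (MulAut.conjNormal g n) = ν n) :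
    ∃ (S : Finset (G → ℂ)) (a : (G → ℂ) → ℕ),
      (∀ χ ∈ S, IrrOver N ν χ ∧ χ 1 = 2 ^ a χ) ∧ ∑ χ ∈ S, 4 ^ a χ = N.index := by
  obtain ⟨S, hS, hsum⟩ := exists_finset_irrOver_sum_sq N hν
  obtain ⟨n, hn⟩ := hG.exists_card_eq
  have hdegree : ∀ χ ∈ S, ∃ a : ℕ, χ 1 = 2 ^ a := fun χ hχ => by
    obtain ⟨d, -, hd, hdvd⟩ := (hS χ hχ).exists_degree
    obtain ⟨a, -, rfl⟩ := (Nat.dvd_prime_pow Nat.prime_two).mp (hn ▸ hdvd)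
    exact ⟨a, by rw [hd, Nat.cast_pow, Nat.cast_ofNat]⟩
  choose! a ha using hdegree
  refine ⟨S, a, fun χ hχ => ⟨hS χ hχ, ha χ hχ⟩, ?_⟩
  rw [← Nat.cast_inj (R := ℂ), ← hsum, Nat.cast_sum]
  refine Finset.sum_congr rfl fun χ hχ => ?_
  rw [ha χ hχ, ← pow_mul, mul_comm, pow_mul]
  norm_num

theorem IrrOver.apply_eq_pow {G : Type*} [Group G] [Finite G] {N : Subgroup G} {ν₁ ν₂ : N →* ℂˣ}
    {χ₁ χ₂ : G → ℂ} (h₁ : IrrOver N ν₁ χ₁) (h₂ : IrrOver N ν₂ χ₂) {t : ℕ}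
    (h : ∀ g, χ₂ g = χ₁ (g ^ t)) (n : N) : ν₂ n = ν₁ n ^ t := by
  have hone : χ₂ 1 = χ₁ 1 := by rw [h, one_pow]
  have hn := h n
  rw [h₂.apply_coe, ← Subgroup.coe_pow, h₁.apply_coe, map_pow, hone] at hn
  exact Units.ext (mul_right_cancel₀ h₁.apply_one_ne_zero hn)

/-! ### Groups of class three -/

theorem lowerCentralSeries_quotient_le_center {K : Type*} [Group K] (n : ℕ) :
    (⊤ : Subgroup (K ⧸ (⊤ : Subgroup K).lowerCentralSeries (n + 1))).lowerCentralSeries n ≤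
      Subgroup.center _ := by
  set N := (⊤ : Subgroup K).lowerCentralSeries (n + 1)
  rw [← Subgroup.centralizer_univ, ← Subgroup.coe_top,
    ← Subgroup.commutator_eq_bot_iff_le_centralizer, ← Subgroup.lowerCentralSeries_succ,
    ← Subgroup.map_top_of_surjective _ (QuotientGroup.mk'_surjective N),
    ← Subgroup.map_lowerCentralSeries]
  exact QuotientGroup.map_mk'_self N

section ClassThree

/-- The third term `γ₃(Q) = [[Q, Q], Q]` of the lower central series. -/
abbrev gammaThree (Q : Type*) [Group Q] : Subgroup Q := ⁅commutator Q, (⊤ : Subgroup Q)⁆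

variable {Q : Type*} [Group Q]

theorem gammaThree_le_commutator : gammaThree Q ≤ commutator Q := Subgroup.commutator_le_left _ _

theorem commutatorElement_mem_gammaThree (g : Q) {w : Q} (hw : w ∈ commutator Q) :
    ⁅g, w⁆ ∈ gammaThree Q := by
  rw [gammaThree, Subgroup.commutator_comm]
  exact Subgroup.commutator_mem_commutator trivial hw

theorem normal_of_gammaThree_le {N : Subgroup Q} (hγN : gammaThree Q ≤ N)
    (hN : N ≤ commutator Q) : N.Normal where
  conj_mem n hn g := by
    rw [← inv_mul_cancel_right (g * n * g⁻¹) n]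
    exact mul_mem (hγN (commutatorElement_mem_gammaThree g (hN hn))) hn

theorem mk_mem_commutator_iff {N : Subgroup Q} [N.Normal] (hN : N ≤ commutator Q) {x : Q} :
    (x : Q ⧸ N) ∈ commutator (Q ⧸ N) ↔ x ∈ commutator Q := by
  rw [← map_commutator_of_surjective (QuotientGroup.mk'_surjective N)]
  refine ⟨?_, fun hx => ⟨x, hx, rfl⟩⟩
  rintro ⟨w, hw, hwx⟩
  simpa using mul_mem hw (hN (QuotientGroup.eq.mp hwx))

theorem commutator_quotient_gammaThree_le_center :
    commutator (Q ⧸ gammaThree Q) ≤ Subgroup.center (Q ⧸ gammaThree Q) :=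
  lowerCentralSeries_quotient_le_center 1

variable (hcen : gammaThree Q ≤ Subgroup.center Q)
include hcen

theorem commutator_quotient_gammaThree_ne_bot (hne : gammaThree Q ≠ ⊥) :
    commutator (Q ⧸ gammaThree Q) ≠ ⊥ := by
  contrapose! hne
  rw [gammaThree, Subgroup.commutator_eq_bot_iff_le_centralizer, Subgroup.coe_top,
    Subgroup.centralizer_univ]
  refine fun x hx => hcen ?_
  rw [← mk_mem_commutator_iff gammaThree_le_commutator, hne, Subgroup.mem_bot,
    QuotientGroup.eq_one_iff] at hx
  exact hx

theorem commute_of_mem_gammaThree {z : Q} (hz : z ∈ gammaThree Q) (g : Q) : Commute z g :=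
  (Subgroup.mem_center_iff.mp (hcen hz) g).symm

/-- The homomorphism `w ↦ ⁅g, w⁆` from the commutator subgroup of a group of class three. -/
def bracket (g : Q) : commutator Q →* gammaThree Q where
  toFun w := ⟨⁅g, (w : Q)⁆, commutatorElement_mem_gammaThree g w.2⟩
  map_one' := Subtype.ext (commutatorElement_one_right g)
  map_mul' w w' := Subtype.ext <| by
    change ⁅g, (w : Q) * w'⁆ = ⁅g, (w : Q)⁆ * ⁅g, (w' : Q)⁆
    have hcomm := commute_of_mem_gammaThree hcen (commutatorElement_mem_gammaThree g w'.2) (w : Q)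
    rw [commutatorElement_mul_right_eq_mul_conj, mul_assoc, mul_assoc, ← mul_assoc (w : Q),
      ← hcomm.eq, mul_inv_cancel_right]

theorem bracket_mul (g g' : Q) (w : commutator Q) :
    bracket hcen (g * g') w = bracket hcen g w * bracket hcen g' w := by
  have hcomm := commute_of_mem_gammaThree hcen (commutatorElement_mem_gammaThree g' w.2)
  refine Subtype.ext ?_
  change ⁅g * g', (w : Q)⁆ = ⁅g, (w : Q)⁆ * ⁅g', (w : Q)⁆
  rw [commutatorElement_mul_left_eq_conj_mul, ← (hcomm g).eq, mul_inv_cancel_right,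
    (hcomm _).eq]

theorem bracket_eq_one_iff {g : Q} {w : commutator Q} :
    bracket hcen g w = 1 ↔ Commute g (w : Q) :=
  Subtype.ext_iff.trans commutatorElement_eq_one_iff_commute

/-- The homomorphism `g ↦ ⁅g, w⁆` on a group of class three. -/
def bracketLeft (w : commutator Q) : Q →* gammaThree Q where
  toFun g := bracket hcen g w
  map_one' := (bracket_eq_one_iff hcen).mpr (Commute.one_left _)
  map_mul' g g' := bracket_mul hcen g g' w

theorem bracket_of_mem_commutator {g : Q} (hg : g ∈ commutator Q) (w : commutator Q) :
    bracket hcen g w = 1 :=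
  have := isMulCommutative_of_le_center hcen
  apply_eq_one_of_mem_commutator (bracketLeft hcen w) hg

theorem isMulCommutative_commutator : IsMulCommutative (commutator Q) :=
  ⟨⟨fun g w => Subtype.ext
    ((bracket_eq_one_iff hcen).mp (bracket_of_mem_commutator hcen g.2 w)).eq⟩⟩

end ClassThree

/-- The `2`-groups of class three to which the condition `GC*` would lead. They turn out not to
exist. -/
structure IsClassThree (L Q : Type*) [Group L] [Group Q] [MulDistribMulAction L Q] : Prop
    extends IsGaloisPGroup 2 L Q where
  ne_bot : gammaThree Q ≠ ⊥
  le_center : gammaThree Q ≤ Subgroup.center Q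

namespace IsClassThree

variable {L Q : Type*} [Group L] [Group Q] [MulDistribMulAction L Q] (h : IsClassThree L Q)
include h

theorem commutator_quotient_ne_bot : commutator (Q ⧸ gammaThree Q) ≠ ⊥ :=
  commutator_quotient_gammaThree_ne_bot h.le_center h.ne_bot

variable [Finite Q]

theorem sq_mem_gammaThree {w : Q} (hw : w ∈ commutator Q) : w ^ 2 ∈ gammaThree Q := by
  let _ := quotientAction (isInvariant_of_characteristic L (gammaThree Q))
  rw [← QuotientGroup.eq_one_iff, QuotientGroup.mk_pow]
  exact pow_eq_one_of_mem_commutator commutator_quotient_gammaThree_le_center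
    (h.quotient (isInvariant_of_characteristic L _)).pow_mem
    ((mk_mem_commutator_iff gammaThree_le_commutator).mpr hw)

theorem sq_notMem_gammaThree {x : Q} (hx : x ∉ commutator Q) : x ^ 2 ∉ gammaThree Q := by
  let _ := quotientAction (isInvariant_of_characteristic L (gammaThree Q))
  rw [← QuotientGroup.eq_one_iff, QuotientGroup.mk_pow]
  exact (h.quotient (isInvariant_of_characteristic L _)).sq_ne_one
    commutator_quotient_gammaThree_le_center h.commutator_quotient_ne_bot
    (mt (mk_mem_commutator_iff gammaThree_le_commutator).mp hx)

theorem exists_sq_mul_eq {w : Q} (hw : w ∈ commutator Q) (hwγ : w ∉ gammaThree Q) :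
    ∃ x ∉ commutator Q, ∃ m ∈ gammaThree Q, x ^ 2 * m = w := by
  let _ := quotientAction (isInvariant_of_characteristic L (gammaThree Q))
  obtain ⟨x, hx, hxw⟩ := (h.quotient (isInvariant_of_characteristic L _)).exists_sq_eq
    commutator_quotient_gammaThree_le_center h.commutator_quotient_ne_bot
    ((mk_mem_commutator_iff gammaThree_le_commutator).mpr hw)
    (mt (QuotientGroup.eq_one_iff w).mp hwγ)
  obtain ⟨x, rfl⟩ := QuotientGroup.mk_surjective x
  exact ⟨x, mt (mk_mem_commutator_iff gammaThree_le_commutator).mpr hx, (x ^ 2)⁻¹ * w,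
    QuotientGroup.eq.mp hxw, mul_inv_cancel_left _ _⟩

theorem relIndex_gammaThree : (gammaThree Q).relIndex (commutator Q) = Nat.card L + 1 := by
  let _ := quotientAction (isInvariant_of_characteristic L (gammaThree Q))
  rw [← (h.quotient (isInvariant_of_characteristic L _)).card_commutator
    commutator_quotient_gammaThree_le_center h.commutator_quotient_ne_bot,
    ← map_commutator_of_surjective (QuotientGroup.mk'_surjective _), ← Subgroup.relIndex_ker,
    QuotientGroup.ker_mk']

theorem sq_eq_one {m : Q} (hm : m ∈ gammaThree Q) : m ^ 2 = 1 := by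
  have hle : gammaThree Q ≤
      (powMonoidHom 2 : Subgroup.center Q →* _).ker.map (Subgroup.center Q).subtype := by
    rw [gammaThree, Subgroup.commutator_comm, Subgroup.commutator_le]
    refine fun g _ w hw =>
      ⟨⟨⁅g, w⁆, h.le_center (commutatorElement_mem_gammaThree g hw)⟩, ?_, rfl⟩
    have hsq : bracket h.le_center g ⟨w, hw⟩ ^ 2 = 1 := by
      rw [← map_pow, bracket_eq_one_iff]
      exact (commute_of_mem_gammaThree h.le_center (h.sq_mem_gammaThree hw) g).symm
    have hsq' : ⁅g, w⁆ ^ 2 = 1 := congrArg Subtype.val hsq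
    exact Subtype.ext hsq'
  obtain ⟨z, hz, rfl⟩ := hle hm
  exact congrArg Subtype.val hz

theorem mul_sq_eq (g : Q) {d : Q} (hd : d ∈ commutator Q) :
    ∃ m ∈ gammaThree Q, (g * d) ^ 2 = g ^ 2 * m := by
  refine ⟨⁅g⁻¹, d⁆ * d ^ 2, mul_mem (commutatorElement_mem_gammaThree _ hd)
    (h.sq_mem_gammaThree hd), ?_⟩
  simp only [commutatorElement_def, sq]
  group

theorem mul_pow_four (g : Q) {d : Q} (hd : d ∈ commutator Q) : (g * d) ^ 4 = g ^ 4 := by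
  obtain ⟨m, hm, hgd⟩ := h.mul_sq_eq g hd
  rw [pow_mul _ 2 2, hgd, (commute_of_mem_gammaThree h.le_center hm _).symm.mul_pow,
    h.sq_eq_one hm, mul_one, ← pow_mul]

theorem pow_four_mem (g : Q) : g ^ 4 ∈ gammaThree Q :=
  pow_mul g 2 2 ▸ h.sq_mem_gammaThree (h.pow_mem g)

theorem pow_eight (g : Q) : g ^ 8 = 1 :=
  pow_mul g 4 2 ▸ h.sq_eq_one (h.pow_four_mem g)

theorem pow_mod_eight (g : Q) (t : ℕ) : g ^ (t % 8) = g ^ t :=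
  (pow_eq_pow_mod t (h.pow_eight g)).symm

end IsClassThree

section ClassThree

variable {L Q : Type*} [Group L] [Group Q] [MulDistribMulAction L Q]

/-- The subgroup generated by `γ₃(Q)` and `x ^ 2`. If `x ^ 2` is central modulo the kernel of a
linear character of `[Q, Q]`, the restriction of that character to this subgroup is `Q`-invariant.
-/
def sqSubgroup (x : Q) : Subgroup Q := gammaThree Q ⊔ Subgroup.zpowers (x ^ 2)

theorem gammaThree_le_sqSubgroup (x : Q) : gammaThree Q ≤ sqSubgroup x := le_sup_left

theorem sq_mem_sqSubgroup (x : Q) : x ^ 2 ∈ sqSubgroup x :=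
  Subgroup.mem_sup_right (Subgroup.mem_zpowers (x ^ 2))

/-- The restriction to `γ₃(Q)` of a linear character of the commutator subgroup. -/
abbrev resGammaThree (ν : commutator Q →* ℂˣ) : gammaThree Q →* ℂˣ :=
  ν.comp (Subgroup.inclusion gammaThree_le_commutator)

namespace IsClassThree

variable (h : IsClassThree L Q)
include h

theorem nontrivial : Nontrivial Q :=
  not_subsingleton_iff_nontrivial.mp fun _ => h.ne_bot (Subsingleton.elim _ _)

variable [Finite Q]

theorem exists_two_pow [Finite L] : ∃ k : ℕ, Nat.card L + 1 = 2 ^ (k + 1) := by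
  have := h.nontrivial
  obtain ⟨n, hn⟩ := (h.isPGroup.to_quotient (commutator Q)).exists_card_eq
  rw [← Subgroup.index_eq_card, h.index_commutator] at hn
  obtain _ | k := n
  · exact absurd (Nat.succ_injective hn) Nat.card_pos.ne'
  · exact ⟨k, hn⟩

/-- The square of an element, in the commutator subgroup. -/
def sq (x : Q) : commutator Q := ⟨x ^ 2, h.pow_mem x⟩

theorem sqSubgroup_le_commutator (x : Q) : sqSubgroup x ≤ commutator Q :=
  sup_le gammaThree_le_commutator (Subgroup.zpowers_le.mpr (h.pow_mem x))

theorem normal_sqSubgroup (x : Q) : (sqSubgroup x).Normal :=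
  normal_of_gammaThree_le (gammaThree_le_sqSubgroup x) (h.sqSubgroup_le_commutator x)

/-- The restriction to `sqSubgroup x` of a linear character of the commutator subgroup. -/
abbrev resSqSubgroup (x : Q) (ν : commutator Q →* ℂˣ) : sqSubgroup x →* ℂˣ :=
  ν.comp (Subgroup.inclusion (h.sqSubgroup_le_commutator x))

variable {x : Q}

theorem index_sqSubgroup (hx : x ∉ commutator Q) {k : ℕ} (hk : Nat.card L + 1 = 2 ^ (k + 1)) :
    (sqSubgroup x).index = 2 * 4 ^ k := by
  have := h.nontrivial
  have hrel : (gammaThree Q).relIndex (sqSubgroup x) = 2 := by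
    have hcard := Subgroup.relIndex_ker (sqSubgroup x) (QuotientGroup.mk' (gammaThree Q))
    rw [QuotientGroup.ker_mk', sqSubgroup, Subgroup.map_sup, QuotientGroup.map_mk'_self,
      bot_sup_eq, MonoidHom.map_zpowers, Nat.card_zpowers] at hcard
    refine hcard.trans (orderOf_eq_prime ?_ ?_)
    · rw [← map_pow]
      exact (QuotientGroup.eq_one_iff _).mpr (h.sq_mem_gammaThree (h.pow_mem x))
    · exact mt (QuotientGroup.eq_one_iff _).mp (h.sq_notMem_gammaThree hx)
  have hindex := Subgroup.relIndex_mul_index (gammaThree_le_sqSubgroup x)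
  rw [hrel, ← Subgroup.relIndex_mul_index gammaThree_le_commutator, h.relIndex_gammaThree,
    h.index_commutator, hk, ← mul_pow, pow_succ', mul_assoc] at hindex
  exact Nat.eq_of_mul_eq_mul_left two_pos hindex

section Counting

variable {ν ν₁ ν₂ : commutator Q →* ℂˣ} {χ χ₁ χ₂ : Q → ℂ}

theorem exists_pow_eq (hν : resGammaThree ν₁ = resGammaThree ν₂) (hne : resGammaThree ν₁ ≠ 1)
    (h₁ : IrrOver (sqSubgroup x) (h.resSqSubgroup x ν₁) χ₁)
    (h₂ : IrrOver (sqSubgroup x) (h.resSqSubgroup x ν₂) χ₂) (hdeg : χ₁ 1 = χ₂ 1) :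
    ∃ t : ℕ, Odd t ∧ ∀ g, χ₂ g = χ₁ (g ^ t) := by
  have hinv := isInvariant_of_characteristic L (gammaThree Q)
  have h₁' : IrrOver _ (resGammaThree ν₁) χ₁ := h₁.mono (gammaThree_le_sqSubgroup x)
  have h₂' : IrrOver _ (resGammaThree ν₁) χ₂ := hν ▸ h₂.mono (gammaThree_le_sqSubgroup x)
  obtain ⟨l, t, ht, hg⟩ := h.isGaloisTransitive _ inferInstance hinv _ _ hne hne χ₁ χ₂ h₁' h₂' hdeg
  have hodd : Odd t := by
    have := h.nontrivial
    obtain ⟨n, hn, hcard⟩ := h.isPGroup.nontrivial_iff_card.mp this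
    exact Nat.coprime_two_right.mp
      (ht.coprime_dvd_right (hcard ▸ dvd_pow_self 2 hn.ne'))
  have hl : l = 1 := by
    refine h.isFixedPointFree.twist_injective hinv hne (MonoidHom.ext fun m => Units.ext ?_)
    have hm : (m : Q) ^ t = m := by
      obtain ⟨j, rfl⟩ := hodd
      rw [pow_succ, pow_mul, h.sq_eq_one m.2, one_pow, one_mul]
    rw [twist_one]
    have := hg m
    rw [hm, h₂'.apply_coe, ← hdeg] at this
    exact mul_right_cancel₀ h₁.apply_one_ne_zero
      ((h₁'.apply_coe (hinv.toMonoidHom l m)).symm.trans this.symm)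
  exact ⟨t, hodd, fun g => by rw [hg, hl, one_smul]⟩

variable (hν : (bracketLeft h.le_center (h.sq x)).range ≤ (resGammaThree ν).ker)
include hν

theorem resGammaThree_bracket (g : Q) {w : commutator Q} (hw : (w : Q) ∈ sqSubgroup x) :
    resGammaThree ν (bracket h.le_center g w) = 1 := by
  have hle : sqSubgroup x ≤
      ((resGammaThree ν).comp (bracket h.le_center g)).ker.map (commutator Q).subtype := by
    refine sup_le (fun m hm => ⟨⟨m, gammaThree_le_commutator hm⟩, ?_, rfl⟩)
      (Subgroup.zpowers_le.mpr ⟨h.sq x, hν ⟨g, rfl⟩, rfl⟩)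
    have hbr : bracket h.le_center g ⟨m, gammaThree_le_commutator hm⟩ = 1 :=
      (bracket_eq_one_iff _).mpr (commute_of_mem_gammaThree h.le_center hm g).symm
    rw [SetLike.mem_coe, MonoidHom.mem_ker, MonoidHom.comp_apply, hbr, map_one]
  obtain ⟨w', hw', hww'⟩ := hle hw
  obtain rfl : w' = w := Subtype.ext hww'
  exact hw'

theorem exists_finset_irrOver_sqSubgroup [Finite L] (hx : x ∉ commutator Q) {k : ℕ}
    (hk : Nat.card L + 1 = 2 ^ (k + 1)) :
    ∃ (S : Finset (Q → ℂ)) (a : (Q → ℂ) → ℕ),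
      (∀ χ ∈ S, IrrOver (sqSubgroup x) (h.resSqSubgroup x ν) χ ∧ χ 1 = 2 ^ a χ) ∧
        ∑ χ ∈ S, 4 ^ a χ = 2 * 4 ^ k := by
  have := h.normal_sqSubgroup x
  rw [← h.index_sqSubgroup hx hk]
  refine exists_finset_irrOver_sum_four_pow h.isPGroup _ fun g n => ?_
  have hconj : Subgroup.inclusion (h.sqSubgroup_le_commutator x) (MulAut.conjNormal g n) =
      Subgroup.inclusion gammaThree_le_commutator (bracket h.le_center g
        (Subgroup.inclusion (h.sqSubgroup_le_commutator x) n)) *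
      Subgroup.inclusion (h.sqSubgroup_le_commutator x) n :=
    Subtype.ext (inv_mul_cancel_right (g * n * g⁻¹) (n : Q)).symm
  rw [MonoidHom.comp_apply, hconj, map_mul]
  exact mul_eq_right.mpr (h.resGammaThree_bracket hν g n.2)

theorem exists_ne_irrOver [Finite L] (hx : x ∉ commutator Q) :
    ∃ χ₁ χ₂, IrrOver (sqSubgroup x) (h.resSqSubgroup x ν) χ₁ ∧
      IrrOver (sqSubgroup x) (h.resSqSubgroup x ν) χ₂ ∧ χ₁ ≠ χ₂ ∧ χ₁ 1 = χ₂ 1 := by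
  obtain ⟨k, hk⟩ := h.exists_two_pow
  obtain ⟨S, a, hS, hsum⟩ := h.exists_finset_irrOver_sqSubgroup hν hx hk
  obtain ⟨χ₁, h₁, χ₂, h₂, hχ, ha⟩ := exists_ne_of_sum_four_pow_eq hsum
  exact ⟨χ₁, χ₂, (hS χ₁ h₁).1, (hS χ₂ h₂).1, hχ, by rw [(hS χ₁ h₁).2, (hS χ₂ h₂).2, ha]⟩

variable [Finite L] (hne : resGammaThree ν ≠ 1) (hx : x ∉ commutator Q)
include hne hx

theorem exists_irrOver_eq_two_pow {k : ℕ} (hk : Nat.card L + 1 = 2 ^ (k + 1)) :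
    ∃ χ, IrrOver (sqSubgroup x) (h.resSqSubgroup x ν) χ ∧ χ 1 = 2 ^ k := by
  classical
  obtain ⟨S, a, hS, hsum⟩ := h.exists_finset_irrOver_sqSubgroup hν hx hk
  suffices hfibre : ∀ χ ∈ S, (S.filter (a · = a χ)).card ≤ 4 by
    obtain ⟨χ, hχ, rfl⟩ := exists_eq_of_sum_four_pow_eq hsum hfibre
    exact ⟨χ, hS χ hχ⟩
  intro χ hχ
  have hsub : S.filter (a · = a χ) ⊆ ({1, 3, 5, 7} : Finset ℕ).image fun t g => χ (g ^ t) := by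
    intro ψ hψ
    obtain ⟨hψ, haψ⟩ := Finset.mem_filter.mp hψ
    obtain ⟨t, ht, hψt⟩ := h.exists_pow_eq rfl hne (hS χ hχ).1 (hS ψ hψ).1
      (by rw [(hS χ hχ).2, (hS ψ hψ).2, haψ])
    refine Finset.mem_image.mpr ⟨t % 8, ?_, funext fun g => by rw [hψt, h.pow_mod_eight]⟩
    rw [Nat.odd_iff] at ht
    simp only [Finset.mem_insert, Finset.mem_singleton]
    omega
  exact (Finset.card_le_card hsub).trans (Finset.card_image_le.trans (by decide))

theorem apply_pow_four_ne_one : ν (h.sq x ^ 2) ≠ 1 := by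
  intro hν4
  obtain ⟨k, hk⟩ := h.exists_two_pow
  have hcomm := isMulCommutative_commutator h.le_center
  obtain ⟨ε, hε, hεx⟩ := exists_apply_ne_one (D := (gammaThree Q).subgroupOf (commutator Q))
    (x := h.sq x) ((commutator_eq_bot_iff _).mpr hcomm ▸ bot_le) (h.sq_notMem_gammaThree hx)
  have hres : resGammaThree ν = resGammaThree (ν * ε) := MonoidHom.ext fun m => by
    simp [hε (Subgroup.inclusion gammaThree_le_commutator m) m.2]
  obtain ⟨χ₁, h₁, hχ₁⟩ := h.exists_irrOver_eq_two_pow hν hne hx hk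
  obtain ⟨χ₂, h₂, hχ₂⟩ := h.exists_irrOver_eq_two_pow (hres ▸ hν) (hres ▸ hne) hx hk
  obtain ⟨t, ⟨j, rfl⟩, hg⟩ := h.exists_pow_eq hres hne h₁ h₂ (hχ₁.trans hχ₂.symm)
  have hsq : (ν * ε) (h.sq x) = ν (h.sq x) ^ (2 * j + 1) :=
    h₁.apply_eq_pow h₂ hg ⟨x ^ 2, sq_mem_sqSubgroup x⟩
  rw [pow_succ, pow_mul, ← map_pow, hν4, one_pow, one_mul, MonoidHom.mul_apply] at hsq
  exact hεx (mul_eq_left.mp hsq)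

end Counting

end IsClassThree

end ClassThree

section ClassThree

theorem exists_resGammaThree_ne_one {Q : Type*} [Group Q] [Finite Q]
    (hcen : gammaThree Q ≤ Subgroup.center Q) {R : Subgroup (gammaThree Q)} (hR : R ≠ ⊤) :
    ∃ ν : commutator Q →* ℂˣ, R ≤ (resGammaThree ν).ker ∧ resGammaThree ν ≠ 1 := by
  obtain ⟨z, hz⟩ := SetLike.exists_not_mem_of_ne_top R hR
  have hcomm := (commutator_eq_bot_iff _).mpr (isMulCommutative_commutator hcen)
  obtain ⟨ν, hν, hνz⟩ := exists_apply_ne_one (D := R.map (Subgroup.inclusion _)) (hcomm ▸ bot_le)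
    (mt (Subgroup.mem_map_iff_mem (Subgroup.inclusion_injective gammaThree_le_commutator)).mp hz)
  exact ⟨ν, fun r hr => hν _ ⟨r, hr, rfl⟩, fun h1 => hνz (DFunLike.congr_fun h1 z)⟩

namespace IsClassThree

variable {L Q : Type*} [Group L] [Group Q] [MulDistribMulAction L Q] [Finite Q]
  (h : IsClassThree L Q)
include h

theorem bracket_sq (x : Q) : bracket h.le_center x (h.sq x) = 1 :=
  (bracket_eq_one_iff _).mpr ((Commute.refl x).pow_right 2)

theorem relIndex_ker_bracketLeft_mul (w : commutator Q) :
    (commutator Q).relIndex (bracketLeft h.le_center w).ker *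
      Nat.card (bracketLeft h.le_center w).range = Nat.card L + 1 := by
  have := h.nontrivial
  rw [← Subgroup.index_ker, Subgroup.relIndex_mul_index, h.index_commutator]
  exact fun g hg => bracket_of_mem_commutator h.le_center hg w

theorem card_le_card : Nat.card L + 1 ≤ Nat.card (gammaThree Q) := by
  have hinv := isInvariant_of_characteristic L (gammaThree Q)
  let _ := restrictAction hinv
  have : Nontrivial (gammaThree Q) := (Subgroup.nontrivial_iff_ne_bot _).mpr h.ne_bot
  have hcard : 1 < Nat.card (gammaThree Q) := Finite.one_lt_card
  have := Nat.le_of_dvd (by omega) (h.isFixedPointFree.restrict hinv).card_dvd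
  omega

theorem exists_notMem : ∃ x, x ∉ commutator Q :=
  have := h.nontrivial
  SetLike.exists_not_mem_of_ne_top _ h.commutator_ne_top

variable [Finite L]

theorem range_sup_zpowers_eq_top {x : Q} (hx : x ∉ commutator Q) :
    (bracketLeft h.le_center (h.sq x)).range ⊔ Subgroup.zpowers ⟨x ^ 4, h.pow_four_mem x⟩ = ⊤ := by
  by_contra hR
  obtain ⟨ν, hν, hne⟩ := exists_resGammaThree_ne_one h.le_center hR
  refine h.apply_pow_four_ne_one (le_sup_left.trans hν) hne hx ?_
  have hx4 : h.sq x ^ 2 = Subgroup.inclusion gammaThree_le_commutator ⟨x ^ 4, h.pow_four_mem x⟩ :=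
    Subtype.ext (pow_mul x 2 2).symm
  rw [hx4]
  exact hν (Subgroup.mem_sup_right (Subgroup.mem_zpowers _))

theorem relIndex_ker_and_index_range {x : Q} (hx : x ∉ commutator Q) :
    (commutator Q).relIndex (bracketLeft h.le_center (h.sq x)).ker = 2 ∧
      (bracketLeft h.le_center (h.sq x)).range.index = 2 := by
  have := isMulCommutative_of_le_center h.le_center
  have hmul := h.relIndex_ker_bracketLeft_mul (h.sq x)
  set β := bracketLeft h.le_center (h.sq x)
  have hindex : β.range.index ≤ 2 := Nat.le_of_dvd two_pos <|
    index_dvd_of_sup_zpowers_eq_top (h.range_sup_zpowers_eq_top hx)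
      (Subtype.ext (h.sq_eq_one (h.pow_four_mem x)))
  have hne_zero : (commutator Q).relIndex β.ker ≠ 0 := by
    rintro hzero
    rw [hzero, zero_mul] at hmul
    exact (Nat.succ_ne_zero _ hmul.symm).elim
  have hne_one : (commutator Q).relIndex β.ker ≠ 1 := fun hone =>
    hx (Subgroup.relIndex_eq_one.mp hone (h.bracket_sq x))
  have hle : (commutator Q).relIndex β.ker ≤ β.range.index := by
    refine Nat.le_of_mul_le_mul_right ?_ (Nat.card_pos (α := β.range))
    rw [hmul, mul_comm, Subgroup.card_mul_index]
    exact h.card_le_card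
  omega

theorem card_gammaThree : Nat.card (gammaThree Q) = Nat.card L + 1 := by
  obtain ⟨x, hx⟩ := h.exists_notMem
  obtain ⟨hker, hrange⟩ := h.relIndex_ker_and_index_range hx
  rw [← h.relIndex_ker_bracketLeft_mul (h.sq x), ← Subgroup.card_mul_index, hrange, hker, mul_comm]

theorem pow_four_ne_one {x : Q} (hx : x ∉ commutator Q) : x ^ 4 ≠ 1 := by
  intro hx4
  have hone : (⟨x ^ 4, h.pow_four_mem x⟩ : gammaThree Q) = 1 := Subtype.ext hx4
  have htop := h.range_sup_zpowers_eq_top hx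
  rw [hone, Subgroup.zpowers_one_eq_bot, sup_bot_eq, ← Subgroup.index_eq_one,
    (h.relIndex_ker_and_index_range hx).2] at htop
  omega

theorem inv_mul_mem_of_commute_sq {x g : Q} (hx : x ∉ commutator Q) (hg : g ∉ commutator Q)
    (hgx : Commute g (x ^ 2)) : x⁻¹ * g ∈ commutator Q := by
  obtain ⟨hker, -⟩ := h.relIndex_ker_and_index_range hx
  set C := (bracketLeft h.le_center (h.sq x)).ker
  have hmem := Subgroup.mul_mem_iff_of_index_two (H := (commutator Q).subgroupOf C) hker
    (a := (⟨x, h.bracket_sq x⟩ : C)⁻¹) (b := ⟨g, (bracket_eq_one_iff h.le_center).mpr hgx⟩)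
  rw [inv_mem_iff] at hmem
  exact hmem.mpr ⟨fun hx' => (hx hx').elim, fun hg' => (hg hg').elim⟩

theorem sq_ne_one_of_notMem {w : Q} (hw : w ∈ commutator Q) (hwγ : w ∉ gammaThree Q) :
    w ^ 2 ≠ 1 := by
  obtain ⟨x, hx, m, hm, rfl⟩ := h.exists_sq_mul_eq hw hwγ
  rw [(commute_of_mem_gammaThree h.le_center hm _).symm.mul_pow, h.sq_eq_one hm, mul_one,
    ← pow_mul]
  exact h.pow_four_ne_one hx

theorem inv_mul_mem_gammaThree_of_commute {x w : Q} (hx : x ∉ commutator Q)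
    (hw : w ∈ commutator Q) (hwγ : w ∉ gammaThree Q) (hxw : Commute x w) :
    (x ^ 2)⁻¹ * w ∈ gammaThree Q := by
  obtain ⟨y, hy, m, hm, rfl⟩ := h.exists_sq_mul_eq hw hwγ
  have hxy : Commute x (y ^ 2) := by
    have := hxw.mul_right (commute_of_mem_gammaThree h.le_center hm x).symm.inv_right
    rwa [mul_inv_cancel_right] at this
  obtain ⟨a, ha, hsq⟩ := h.mul_sq_eq y (h.inv_mul_mem_of_commute_sq hy hx hxy)
  rw [mul_inv_cancel_left] at hsq
  rw [hsq, mul_inv_rev, ← mul_assoc, inv_mul_cancel_right]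
  exact mul_mem (inv_mem ha) hm

/-- The squaring homomorphism `[Q, Q] → γ₃(Q)`, which is surjective with kernel `γ₃(Q)`. -/
def sqHom : commutator Q →* gammaThree Q where
  toFun w := ⟨(w : Q) ^ 2, h.sq_mem_gammaThree w.2⟩
  map_one' := Subtype.ext (one_pow 2)
  map_mul' w w' := Subtype.ext <|
    (((bracket_eq_one_iff h.le_center).mp
      (bracket_of_mem_commutator h.le_center w.2 w')).mul_pow 2)

theorem ker_sqHom : h.sqHom.ker = (gammaThree Q).subgroupOf (commutator Q) := by
  ext w
  rw [MonoidHom.mem_ker, Subgroup.mem_subgroupOf]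
  refine ⟨fun hw => ?_, fun hw => Subtype.ext (h.sq_eq_one hw)⟩
  by_contra hwγ
  exact h.sq_ne_one_of_notMem w.2 hwγ (congrArg Subtype.val hw)

theorem sqHom_surjective : Function.Surjective h.sqHom := by
  rw [← MonoidHom.range_eq_top]
  apply Subgroup.eq_top_of_card_eq
  rw [← Subgroup.index_ker, ker_sqHom, h.card_gammaThree]
  exact h.relIndex_gammaThree

theorem ker_sqHom_le_ker_bracket (x : Q) : h.sqHom.ker ≤ (bracket h.le_center x).ker := by
  rw [ker_sqHom]
  exact fun w hw =>
    (bracket_eq_one_iff _).mpr (commute_of_mem_gammaThree h.le_center hw x).symm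

theorem relIndex_ker_bracket {x : Q} (hx : x ∉ commutator Q) :
    h.sqHom.ker.relIndex (bracket h.le_center x).ker = 2 := by
  rw [ker_sqHom, Subgroup.relIndex_eq_two_iff_exists_notMem_and']
  refine ⟨(h.sq x)⁻¹, inv_mem (h.bracket_sq x), ?_, fun w hw => ?_⟩
  · rw [inv_mem_iff]
    exact h.sq_notMem_gammaThree hx
  · by_cases hwγ : (w : Q) ∈ gammaThree Q
    · exact Or.inr hwγ
    · exact Or.inl (h.inv_mul_mem_gammaThree_of_commute hx w.2 hwγ
        ((bracket_eq_one_iff _).mp hw))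

theorem index_range_bracket {x : Q} (hx : x ∉ commutator Q) :
    (bracket h.le_center x).range.index = 2 := by
  have hindex := Subgroup.relIndex_mul_index (h.ker_sqHom_le_ker_bracket x)
  rw [h.relIndex_ker_bracket hx, Subgroup.index_ker, Subgroup.index_ker,
    MonoidHom.range_eq_top.mpr h.sqHom_surjective, Subgroup.card_top,
    ← Subgroup.card_mul_index (bracket h.le_center x).range, mul_comm] at hindex
  exact Nat.eq_of_mul_eq_mul_left Nat.card_pos hindex.symm

variable [Nontrivial L]

theorem exists_commutatorElement_eq_pow_four :
    ∃ x ∉ commutator Q, ∃ w ∈ commutator Q, ⁅x, w⁆ = x ^ 4 := by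
  have := isMulCommutative_of_le_center h.le_center
  have := h.nontrivial
  let b : Q →* (commutator Q →* gammaThree Q) :=
    MonoidHom.mk' (bracket h.le_center) fun x y => MonoidHom.ext (bracket_mul h.le_center x y)
  have hcard : 2 < Nat.card (gammaThree Q) := by
    rw [h.card_gammaThree]
    exact Nat.succ_lt_succ Finite.one_lt_card
  obtain ⟨x, hx, w, hw⟩ := exists_apply_eq_of_card_le (f := h.sq)
    (fun m => Subtype.ext (h.sq_eq_one m.2)) h.pow_mem hcard
    (by rw [h.card_gammaThree, h.index_commutator]) h.sqHom_surjective b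
    h.ker_sqHom_le_ker_bracket (fun _ => h.index_range_bracket) h.bracket_sq
  have hxw : ⁅x, (w : Q)⁆ = (x ^ 2) ^ 2 := congrArg Subtype.val hw
  exact ⟨x, hx, w, w.2, by rw [hxw, ← pow_mul]⟩

theorem exists_commutatorElement_eq {g : Q} (hg : g ∉ commutator Q) : ∃ w : Q, ⁅g, w⁆ = g ^ 4 := by
  obtain ⟨x, hx, w, hw, hxw⟩ := h.exists_commutatorElement_eq_pow_four
  obtain ⟨l, d, hd, rfl⟩ := h.exists_smul_mul_eq hx hg
  have hlw : l • w ∈ commutator Q := isInvariant_of_characteristic L (commutator Q) l w hw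
  have hbr := congrArg Subtype.val (bracket_mul h.le_center (l • x) d ⟨l • w, hlw⟩)
  rw [bracket_of_mem_commutator h.le_center hd, mul_one] at hbr
  change ⁅l • x * d, l • w⁆ = ⁅l • x, l • w⁆ at hbr
  refine ⟨l • w, ?_⟩
  rw [hbr, h.mul_pow_four _ hd, ← smul_pow', ← hxw]
  simp only [commutatorElement_def, smul_mul', smul_inv']

theorem isConj_pow_five (g : Q) : IsConj g (g ^ 5) := by
  by_cases hg : g ∈ commutator Q
  · rw [pow_succ, pow_mul g 2 2, h.sq_eq_one (h.sq_mem_gammaThree hg), one_mul]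
  obtain ⟨w, hw⟩ := h.exists_commutatorElement_eq hg
  refine isConj_iff.mpr ⟨w, ?_⟩
  have hconj : w * g * w⁻¹ = ⁅g, w⁆⁻¹ * g := by
    rw [commutatorElement_def]
    group
  rw [hconj, hw, inv_mul_eq_iff_eq_mul, ← pow_add, pow_succ, h.pow_eight, one_mul]

theorem eq_of_irrOver {x : Q} {ν : commutator Q →* ℂˣ}
    (hν : (bracketLeft h.le_center (h.sq x)).range ≤ (resGammaThree ν).ker)
    (hne : resGammaThree ν ≠ 1) (hx : x ∉ commutator Q) {χ₁ χ₂ : Q → ℂ}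
    (h₁ : IrrOver (sqSubgroup x) (h.resSqSubgroup x ν) χ₁)
    (h₂ : IrrOver (sqSubgroup x) (h.resSqSubgroup x ν) χ₂) (hdeg : χ₁ 1 = χ₂ 1) : χ₁ = χ₂ := by
  obtain ⟨t, -, hg⟩ := h.exists_pow_eq rfl hne h₁ h₂ hdeg
  have hνt : ν (h.sq x) = ν (h.sq x) ^ t := h₁.apply_eq_pow h₂ hg ⟨x ^ 2, sq_mem_sqSubgroup x⟩
  have horder : orderOf (ν (h.sq x)) = 2 ^ 2 := by
    refine orderOf_eq_prime_pow ?_ ?_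
    · rw [pow_one, ← map_pow]
      exact h.apply_pow_four_ne_one hν hne hx
    · have hsq : h.sq x ^ 2 ^ 2 = 1 := Subtype.ext ((pow_mul x 2 4).symm.trans (h.pow_eight x))
      rw [← map_pow, hsq, map_one]
  have hmod : 1 % 4 = t % 4 := by
    rw [← pow_one (ν (h.sq x)), ← pow_mul, one_mul, pow_eq_pow_iff_modEq, horder] at hνt
    exact hνt
  ext g
  rw [hg, ← h.pow_mod_eight]
  obtain ht | ht : t % 8 = 1 ∨ t % 8 = 5 := by omega
  · rw [ht, pow_one]
  · obtain ⟨c, hc⟩ := isConj_iff.mp (h.isConj_pow_five g)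
    rw [ht, ← hc, h₁.apply_conj]

theorem false : False := by
  obtain ⟨x, hx⟩ := h.exists_notMem
  have hR : (bracketLeft h.le_center (h.sq x)).range ≠ ⊤ := fun htop => by
    have hindex := (h.relIndex_ker_and_index_range hx).2
    rw [htop, Subgroup.index_top] at hindex
    exact absurd hindex (by decide)
  obtain ⟨ν, hν, hne⟩ := exists_resGammaThree_ne_one h.le_center hR
  obtain ⟨χ₁, χ₂, h₁, h₂, hχ, hdeg⟩ := h.exists_ne_irrOver hν hx
  exact hχ (h.eq_of_irrOver hν hne hx h₁ h₂ hdeg)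

end IsClassThree

end ClassThree

/-! ### The prime -/

theorem lowerCentralSeries_quotient_ne_bot {K : Type*} [Group K] [Group.IsNilpotent K] {n : ℕ}
    (hn : (⊤ : Subgroup K).lowerCentralSeries n ≠ ⊥) :
    (⊤ : Subgroup (K ⧸ (⊤ : Subgroup K).lowerCentralSeries (n + 1))).lowerCentralSeries n ≠ ⊥ := by
  set N := (⊤ : Subgroup K).lowerCentralSeries (n + 1)
  rw [← Subgroup.map_top_of_surjective _ (QuotientGroup.mk'_surjective N),
    ← Subgroup.map_lowerCentralSeries, Ne, Subgroup.map_eq_bot_iff, QuotientGroup.ker_mk']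
  intro hle
  have hstable : ∀ m, (⊤ : Subgroup K).lowerCentralSeries n ≤
      (⊤ : Subgroup K).lowerCentralSeries (n + m) := by
    intro m
    induction m with
    | zero => exact le_rfl
    | succ m ih => exact hle.trans (Subgroup.commutator_mono ih le_rfl)
  obtain ⟨m, hm⟩ := Subgroup.nilpotent_iff_lowerCentralSeries.mp ‹Group.IsNilpotent K›
  refine hn (eq_bot_iff.mpr (hm ▸ (hstable m).trans ?_))
  exact Subgroup.lowerCentralSeries_antitone _ (Nat.le_add_left m n)

theorem IsGaloisTransitive.exists_isGaloisPGroup {L K : Type*} [Group L] [Group K]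
    [MulDistribMulAction L K] [Finite L] [Nontrivial L] [Finite K] [Nontrivial K]
    [Group.IsSolvable K] (h : IsGaloisTransitive L K) (hfpf : IsFixedPointFree L K) :
    ∃ p, p.Prime ∧ IsGaloisPGroup p L K := by
  obtain ⟨p, hp, hpow⟩ := h.exists_prime_pow_mem_commutator
    (Group.IsSolvable.commutator_lt_top_of_nontrivial K).ne
  have := Fact.mk hp
  exact ⟨p, hp, h, hfpf, hfpf.isPGroup ‹_› fun x => ⟨1, by rw [pow_one]; exact hpow x⟩⟩

section

variable {p : ℕ} {L P : Type*} [Group L] [Group P] [MulDistribMulAction L P] [Finite P] [Finite L]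

theorem IsGaloisPGroup.eq_two_of_commutator_ne_bot [hp : Fact p.Prime] (h : IsGaloisPGroup p L P)
    (hne : commutator P ≠ ⊥) : p = 2 := by
  by_contra hp2
  have := h.isPGroup.isNilpotent
  set N := (⊤ : Subgroup P).lowerCentralSeries 2
  have hbot : commutator (P ⧸ N) ≠ ⊥ := lowerCentralSeries_quotient_ne_bot (n := 1) hne
  have : Nontrivial (P ⧸ N) := by
    by_contra hnt
    have := not_nontrivial_iff_subsingleton.mp hnt
    exact hbot (Subsingleton.elim _ _)
  let _ := quotientAction (isInvariant_of_characteristic L N)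
  have hquot := h.quotient (isInvariant_of_characteristic L N)
  exact hbot (hquot.commutator_eq_bot_of_odd (lowerCentralSeries_quotient_le_center 1) hp2)

theorem IsGaloisPGroup.commutator_le_center [Nontrivial L] (h : IsGaloisPGroup 2 L P) :
    commutator P ≤ Subgroup.center P := by
  have := h.isPGroup.isNilpotent
  suffices hbot : gammaThree P = ⊥ by
    rwa [Subgroup.commutator_eq_bot_iff_le_centralizer, Subgroup.coe_top,
      Subgroup.centralizer_univ] at hbot
  by_contra hne
  have hinv := isInvariant_of_characteristic L ((⊤ : Subgroup P).lowerCentralSeries 3)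
  let _ := quotientAction hinv
  exact IsClassThree.false (L := L) (Q := P ⧸ (⊤ : Subgroup P).lowerCentralSeries 3)
    ⟨h.quotient hinv, lowerCentralSeries_quotient_ne_bot (n := 2) hne,
      lowerCentralSeries_quotient_le_center 2⟩

end

/-! ### Complements -/

/-- In the commutative ring of endomorphisms of `V` generated by `A`, the element `a - 1` is a unit
for every `a ≠ 1`, so that `A` embeds into the unit group of a residue field. -/
theorem IsFixedPointFree.isCyclic_of_isMulCommutative {A V : Type*} [Group A] [Finite A]
    [IsMulCommutative A] [CommGroup V] [Finite V] [Nontrivial V] [MulDistribMulAction A V]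
    (h : IsFixedPointFree A V) : IsCyclic A := by
  let ρ : A →* AddMonoid.End (Additive V) :=
    (monoidEndToAdditive V).toMonoidHom.comp (MulDistribMulAction.toMonoidEnd A V)
  let R := Subring.closure (Set.range ρ)
  have : IsMulCommutative R := Subring.isMulCommutative_closure <| by
    rintro _ ⟨a, rfl⟩ _ ⟨b, rfl⟩
    rw [← map_mul, ← map_mul, mul_comm' a b]
  have : Finite (AddMonoid.End (Additive V)) := Finite.of_injective _ DFunLike.coe_injective
  let f : A →* R := ρ.codRestrict R.toSubmonoid fun a => Subring.subset_closure ⟨a, rfl⟩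
  have : Nontrivial R := by
    obtain ⟨v, hv⟩ := exists_ne (0 : Additive V)
    exact ⟨1, 0, fun h1 => hv (DFunLike.congr_fun (congrArg Subtype.val h1) v)⟩
  have hunit : ∀ a ≠ 1, IsUnit (f a - 1) := by
    refine fun a ha => (isLeftRegular_iff_right_eq_zero_of_mul.mpr fun r hr => ?_).isUnit_of_finite
    refine Subtype.ext (AddMonoidHom.ext fun v => h a ha (r.1 v).toMul ?_)
    rw [sub_mul, one_mul, sub_eq_zero] at hr
    exact DFunLike.congr_fun (congrArg Subtype.val hr) v
  obtain ⟨m, hm⟩ := Ideal.exists_maximal R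
  refine isCyclic_of_injective_ringHom ((Ideal.Quotient.mk m : R →* R ⧸ m).comp f)
    ((injective_iff_map_eq_one _).mpr fun a ha => ?_)
  by_contra hne
  refine hm.ne_top (m.eq_top_of_isUnit_mem ?_ (hunit a hne))
  rw [← Ideal.Quotient.eq_zero_iff_mem, map_sub, map_one, sub_eq_zero]
  exact ha

section PGroup

variable {p : ℕ} [hp : Fact p.Prime] {P : Type*} [Group P] [Finite P]

theorem exists_index_eq_prime (hP : IsPGroup p P) {x : P} (hx : Subgroup.zpowers x ≠ ⊤) :
    ∃ M : Subgroup P, x ∈ M ∧ M.index = p ∧ commutator P ≤ M ∧ ∀ g, g ^ p ∈ M := by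
  obtain ⟨n, hn⟩ := hP.exists_card_eq
  obtain ⟨k, hk⟩ := (hP.to_subgroup (Subgroup.zpowers x)).exists_card_eq
  have hlt : k < n := by
    rw [← Nat.pow_lt_pow_iff_right hp.out.one_lt, ← hk, ← hn]
    exact (Subgroup.card_le_card_group _).lt_of_ne fun h => hx (Subgroup.eq_top_of_card_eq _ h)
  obtain ⟨n, rfl⟩ := Nat.exists_eq_succ_of_ne_zero (Nat.ne_zero_of_lt hlt)
  obtain ⟨M, hM, hle⟩ := Sylow.exists_subgroup_card_pow_prime_le p
    (hn ▸ pow_dvd_pow p n.le_succ) (Subgroup.zpowers x) hk (Nat.lt_succ_iff.mp hlt)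
  have hindex : M.index = p := by
    refine Nat.eq_of_mul_eq_mul_left (pow_pos hp.out.pos n) ?_
    rw [← hM, M.card_mul_index, hn, pow_succ, hM]
  have hnormal : M.Normal := Subgroup.normal_of_index_eq_minFac_card (by
    rw [hindex, hn, hp.out.pow_minFac n.succ_ne_zero])
  refine ⟨M, hle (Subgroup.mem_zpowers x), hindex, ?_, fun g => hindex ▸ M.pow_index_mem g⟩
  have : IsCyclic (P ⧸ M) := isCyclic_of_prime_card (p := p) hindex
  exact Subgroup.Normal.quotient_commutative_iff_commutator_le.mp IsCyclic.isMulCommutative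

theorem commutator_le_center_and_pow_mem_center (hP : IsPGroup p P)
    (hsub : ∀ H : Subgroup P, H ≠ ⊤ → IsMulCommutative H) :
    commutator P ≤ Subgroup.center P ∧ ∀ g : P, g ^ p ∈ Subgroup.center P := by
  by_cases hcomm : ∀ x y : P, x * y = y * x
  · have htop : Subgroup.center P = ⊤ :=
      eq_top_iff.mpr fun y _ => Subgroup.mem_center_iff.mpr fun x => hcomm x y
    exact ⟨htop ▸ le_top, fun g => htop ▸ Subgroup.mem_top _⟩
  push Not at hcomm
  obtain ⟨x, y, hxy⟩ := hcomm
  have hcommute {H : Subgroup P} (hH : H ≠ ⊤) {a b : P} (ha : a ∈ H) (hb : b ∈ H) :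
      a * b = b * a :=
    have := hsub H hH
    congrArg Subtype.val (mul_comm' (⟨a, ha⟩ : H) ⟨b, hb⟩)
  have hzpowers : ∀ g : P, Subgroup.zpowers g ≠ ⊤ := fun g hg => by
    have : IsCyclic P := ⟨g, Subgroup.eq_top_iff' _ |>.mp hg⟩
    have : IsMulCommutative P := IsCyclic.isMulCommutative
    exact hxy (mul_comm' x y)
  obtain ⟨M₁, hx, hi₁, hc₁, hp₁⟩ := exists_index_eq_prime hP (hzpowers x)
  obtain ⟨M₂, hy, hi₂, hc₂, hp₂⟩ := exists_index_eq_prime hP (hzpowers y)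
  have hproper {M : Subgroup P} (hM : M.index = p) : M ≠ ⊤ := fun htop =>
    hp.out.one_lt.ne' (hM.symm.trans (Subgroup.index_eq_one.mpr htop))
  have hcenter : M₁ ⊓ M₂ ≤ Subgroup.center P := fun z hz => by
    have hcentralizer : Subgroup.centralizer {z} = ⊤ := by
      by_contra hne
      exact hxy (hcommute hne
        (Subgroup.mem_centralizer_singleton_iff.mpr (hcommute (hproper hi₁) hx hz.1))
        (Subgroup.mem_centralizer_singleton_iff.mpr (hcommute (hproper hi₂) hy hz.2)))
    exact Subgroup.mem_center_iff.mpr fun g =>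
      Subgroup.mem_centralizer_singleton_iff.mp (hcentralizer ▸ Subgroup.mem_top g)
  exact ⟨(le_inf hc₁ hc₂).trans hcenter, fun g => hcenter ⟨hp₁ g, hp₂ g⟩⟩

end PGroup

section CyclicSubgroups

variable {P : Type*} [Group P] [Finite P]
  (hab : ∀ H : Subgroup P, IsMulCommutative H → IsCyclic H)
include hab

theorem mem_zpowers_of_pow_orderOf_eq_one {x z : P} (hz : z ∈ Subgroup.center P)
    (hx : x ^ orderOf z = 1) : x ∈ Subgroup.zpowers z := by
  let H := Subgroup.closure {x, z}
  have : IsMulCommutative H := Subgroup.isMulCommutative_closure <| by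
    have hxz := Subgroup.mem_center_iff.mp hz x
    rintro a (rfl | rfl) b (rfl | rfl) <;> simp only [hxz]
  have := hab H ‹_›
  let x' : H := ⟨x, Subgroup.subset_closure (Set.mem_insert x {z})⟩
  let z' : H := ⟨z, Subgroup.subset_closure (Set.mem_insert_of_mem x rfl)⟩
  have hz' : orderOf z' = orderOf z := Subgroup.orderOf_mk z _
  have hle : Subgroup.zpowers z' ≤ (powMonoidHom (orderOf z)).ker :=
    Subgroup.zpowers_le.mpr (hz' ▸ pow_orderOf_eq_one z')
  have heq := Subgroup.eq_of_le_of_card_ge hle <| by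
    rw [IsCyclic.card_powMonoidHom_ker, Nat.card_zpowers, hz']
    exact Nat.gcd_le_right _ (orderOf_pos z)
  have hmem : x' ∈ Subgroup.zpowers z' := heq ▸ Subtype.ext hx
  obtain ⟨n, hn⟩ := hmem
  exact ⟨n, congrArg Subtype.val hn⟩

variable {p : ℕ} [hp : Fact p.Prime] (hp2 : p ≠ 2) (hP : IsPGroup p P)
include hp2 hP

theorem isMulCommutative_of_commutator_le_center (hc : commutator P ≤ Subgroup.center P)
    (hpow : ∀ g : P, g ^ p ∈ Subgroup.center P) : IsMulCommutative P := by
  cases subsingleton_or_nontrivial P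
  · exact ⟨⟨fun a b => Subsingleton.elim _ _⟩⟩
  let φ : P →* Subgroup.center P := MonoidHom.mk' (fun g => ⟨g ^ p, hpow g⟩) fun a b => by
    have hpow_one : commutatorHom hc b a ^ p = 1 := by
      rw [← map_pow, commutatorHom_eq_one_iff]
      exact Subgroup.mem_center_iff.mp (hpow a) b
    obtain ⟨k, hk⟩ : p ∣ p.choose 2 :=
      hp.out.dvd_choose_self two_ne_zero (hp.out.two_le.lt_of_ne' hp2)
    refine Subtype.ext ((mul_pow_eq_mul_commutatorHom hc a b p).trans ?_)
    rw [← Subgroup.coe_pow, hk, pow_mul, hpow_one, one_pow, Subgroup.coe_one, mul_one]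
    rfl
  have := hP.center_nontrivial
  obtain ⟨z, hz⟩ := exists_prime_orderOf_dvd_card' (G := Subgroup.center P) p
    ((hP.to_subgroup _).card_eq_or_dvd.resolve_left Finite.one_lt_card.ne')
  have hker : φ.ker ≤ Subgroup.zpowers (z : P) := fun x hx =>
    mem_zpowers_of_pow_orderOf_eq_one hab z.2 (by
      rw [Subgroup.orderOf_coe, hz]
      exact congrArg Subtype.val hx)
  have hcard_ker : Nat.card φ.ker ∣ p := by
    rw [← hz, ← Subgroup.orderOf_coe, ← Nat.card_zpowers]
    exact Subgroup.card_dvd_of_le hker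
  have hindex : (Subgroup.center P).index ∣ p := by
    refine Nat.dvd_of_mul_dvd_mul_right (k := Nat.card (Subgroup.center P)) Nat.card_pos ?_
    rw [Subgroup.index_mul_card, ← φ.ker.card_mul_index, Subgroup.index_ker]
    exact mul_dvd_mul hcard_ker (Subgroup.card_subgroup_dvd_card φ.range)
  have : IsCyclic (P ⧸ Subgroup.center P) := isCyclic_of_card_dvd_prime hindex
  exact isMulCommutative_of_isCyclic_quotient_center_self P

theorem isCyclic_of_forall_isMulCommutative : IsCyclic P := by
  induction hcard : Nat.card P using Nat.strong_induction_on generalizing P with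
  | _ n ih =>
  have hsub : ∀ H : Subgroup P, H ≠ ⊤ → IsMulCommutative H := fun H hH => by
    have : IsCyclic H := ih (Nat.card H) ?_ (fun A hA => ?_) (hP.to_subgroup H) rfl
    · exact IsCyclic.isMulCommutative
    · rw [← hcard]
      exact H.card_le_card_group.lt_of_ne fun h => hH (H.eq_top_of_card_eq h)
    · have : IsCyclic (A.map H.subtype) := hab _ inferInstance
      exact isCyclic_of_surjective _ (A.equivMapOfInjective _ H.subtype_injective).symm.surjective
  obtain ⟨hc, hpow⟩ := commutator_le_center_and_pow_mem_center hP hsub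
  have := isMulCommutative_of_commutator_le_center hab hp2 hP hc hpow
  have := hab ⊤ inferInstance
  exact isCyclic_of_surjective _ Subgroup.topEquiv.surjective

end CyclicSubgroups

theorem IsFixedPointFree.isCyclic_of_odd {L V : Type*} [Group L] [Finite L] [Group.IsNilpotent L]
    [CommGroup V] [Finite V] [Nontrivial V] [MulDistribMulAction L V] (h : IsFixedPointFree L V)
    (hodd : Odd (Nat.card L)) : IsCyclic L := by
  have : IsZGroup L := by
    refine ⟨fun p hp P => ?_⟩
    have := Fact.mk hp
    cases subsingleton_or_nontrivial P
    · infer_instance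
    have hp2 : p ≠ 2 := by
      rintro rfl
      refine hodd.not_two_dvd_nat (dvd_trans ?_ (Subgroup.card_subgroup_dvd_card (P : Subgroup L)))
      exact P.isPGroup'.card_eq_or_dvd.resolve_left Finite.one_lt_card.ne'
    refine isCyclic_of_forall_isMulCommutative (fun A hA => ?_) hp2 P.isPGroup'
    have hfpf : IsFixedPointFree A V := fun a ha =>
      h (a : P) fun ha1 => ha (Subtype.ext (Subtype.ext ha1))
    exact hfpf.isCyclic_of_isMulCommutative
  infer_instance

theorem isGCStar_of_mulEquiv {G H : Type*} [Group G] [Group H] (e : G ≃* H) (h : IsGCStar G) :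
    IsGCStar H := by
  have hirr {χ : H → ℂ} (hχ : IsIrreducibleCharacter χ) : IsIrreducibleCharacter (χ ∘ e) := by
    obtain ⟨n, ρ, hρ, rfl⟩ := hχ
    exact ⟨n, ρ.comp e.toMonoidHom,
      isIrreducible_of_linearEquiv hρ (f := e.toMonoidHom) e.surjective (.refl ℂ _) fun _ _ => rfl,
      rfl⟩
  intro χ ψ hχ hψ h1 h2 h12
  rw [← map_one e] at h1 h2 h12
  obtain ⟨n, hn, hdvd, α, hα⟩ := h _ _ (hirr hχ) (hirr hψ) h1 h2 h12
  refine ⟨n, hn, Nat.card_congr e.toEquiv ▸ hdvd, α, fun x => ?_⟩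
  simpa only [Function.comp_apply, e.apply_symm_apply] using hα (e.symm x)

/-! ### Frobenius groups -/

section Frobenius

variable {G : Type*} [Group G] {K L : Subgroup G}

/-- The conjugation action of a subgroup `L` on a normal subgroup `K`. -/
abbrev conjAction (K L : Subgroup G) [K.Normal] : MulDistribMulAction L K :=
  MulDistribMulAction.compHom K ((MulAut.conjNormal (H := K)).comp L.subtype)

theorem coe_conjAction_smul [K.Normal] (l : L) (k : K) :
    let _ := conjAction K L
    ((l • k : K) : G) = l * k * (l : G)⁻¹ :=
  MulAut.conjNormal_apply (l : G) k

theorem _root_.IsFrobeniusGroup.disjoint (h : IsFrobeniusGroup K L) : Disjoint K L := by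
  refine Subgroup.disjoint_def.mpr fun {x} hxK hxL => ((h.mem_kernel x).mp hxK).resolve_right ?_
  exact fun hx => hx 1 ⟨x, hxL, by simp⟩

theorem _root_.IsFrobeniusGroup.compl_subset_range (h : IsFrobeniusGroup K L) :
    (K : Set G)ᶜ ⊆
      Set.range fun c : (G ⧸ L) × ({1}ᶜ : Set L) => c.1.out * (c.2.1 : G) * c.1.out⁻¹ := by
  intro x hx
  have hconj := mt (h.mem_kernel x).mpr hx
  push Not at hconj
  obtain ⟨hx1, g, l, hl, rfl⟩ := hconj
  obtain ⟨m, hm⟩ := QuotientGroup.mk_out_eq_mul L g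
  refine ⟨(g, ⟨m⁻¹ * ⟨l, hl⟩ * m⁻¹⁻¹, fun hl1 => hx1 ?_⟩), ?_⟩
  · obtain rfl : l = 1 := congrArg Subtype.val (conj_eq_one_iff.mp hl1 : (⟨l, hl⟩ : L) = 1)
    exact map_one _
  · change (g : G ⧸ L).out * ((m : G)⁻¹ * l * (m : G)⁻¹⁻¹) * ((g : G ⧸ L).out)⁻¹ = g * l * g⁻¹
    rw [hm]
    group

theorem _root_.IsFrobeniusGroup.index_le_card [Finite G] (h : IsFrobeniusGroup K L) :
    L.index ≤ Nat.card K := by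
  have hcompl : (K : Set G)ᶜ.ncard ≤ L.index * (Nat.card L - 1) := by
    refine (Set.ncard_le_ncard h.compl_subset_range).trans ?_
    rw [← Nat.card_coe_set_eq]
    refine (Finite.card_range_le _).trans_eq ?_
    rw [Nat.card_prod, Nat.card_coe_set_eq, Set.ncard_compl, Set.ncard_singleton]
    rfl
  have hG : L.index * (Nat.card L - 1) + L.index = (K : Set G).ncard + (K : Set G)ᶜ.ncard := by
    rw [← Nat.mul_succ, Nat.succ_eq_add_one, Nat.sub_add_cancel Nat.card_pos, L.index_mul_card,
      Set.ncard_add_ncard_compl]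
  have hK : (K : Set G).ncard = Nat.card K := (Nat.card_coe_set_eq _).symm
  omega

theorem _root_.IsFrobeniusGroup.isComplement' [Finite G] (h : IsFrobeniusGroup K L) :
    K.IsComplement' L := by
  refine Subgroup.isComplement'_of_card_mul_and_disjoint (le_antisymm ?_ ?_) h.disjoint
  · rw [← Nat.card_prod]
    exact Nat.card_le_card_of_injective _ (Subgroup.mul_injective_of_disjoint h.disjoint)
  · rw [← L.index_mul_card]
    exact Nat.mul_le_mul_right _ h.index_le_card

theorem _root_.IsFrobeniusGroup.nontrivial_kernel [Finite G] (h : IsFrobeniusGroup K L) :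
    Nontrivial K := by
  have hindex : L.index ≠ 1 := mt Subgroup.index_eq_one.mp h.ne_top
  have hindex_pos : L.index ≠ 0 := Subgroup.index_ne_zero_of_finite
  refine Finite.one_lt_card_iff_nontrivial.mp (lt_of_lt_of_le ?_ h.index_le_card)
  omega

theorem _root_.IsFrobeniusGroup.isFixedPointFree [K.Normal] (h : IsFrobeniusGroup K L) :
    let _ := conjAction K L
    IsFixedPointFree L K := by
  intro _ l hl k hk
  by_contra hk1
  have hconj : (l : G) * k * (l : G)⁻¹ = k := by
    rw [← coe_conjAction_smul, hk]
  have hkL : (k : G) ∉ L := fun hkL =>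
    hk1 (Subtype.ext (Subgroup.disjoint_def.mp h.disjoint k.2 hkL))
  have hmem : (l : G) ∈ L ⊓ L.map (MulAut.conj (k : G)).toMonoidHom :=
    ⟨l.2, l, l.2, mul_inv_eq_iff_eq_mul.mpr (mul_inv_eq_iff_eq_mul.mp hconj).symm⟩
  rw [h.inf_conj k hkL, Subgroup.mem_bot] at hmem
  exact hl (Subtype.ext hmem)

theorem _root_.IsFrobeniusGroup.isGaloisTransitive [Finite G] [K.Normal]
    (h : IsFrobeniusGroup K L) (hGC : IsGCStar G) :
    let _ := conjAction K L
    IsGaloisTransitive L K := by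
  intro _
  have : Nontrivial L := (Subgroup.nontrivial_iff_ne_bot _).mpr h.ne_bot
  let f : K ⋊[MulDistribMulAction.toMulAut L K] L →* G :=
    SemidirectProduct.lift K.subtype L.subtype fun l =>
      MonoidHom.ext (coe_conjAction_smul l)
  have hf : Function.Bijective f :=
    (show Function.Bijective fun x : K × L => (x.1 : G) * x.2 from h.isComplement').comp
      SemidirectProduct.equivProd.bijective
  exact isGaloisTransitive_of_isGCStar h.isFixedPointFree
    (isGCStar_of_mulEquiv (MulEquiv.ofBijective f hf).symm hGC)

end Frobenius

section NilpotentResidual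

variable (G : Type*) [Group G]

instance normal_nilpotentResidual : (nilpotentResidual G).Normal :=
  Subgroup.normal_iInf_normal fun _ => inferInstance

theorem exists_lowerCentralSeries_eq_nilpotentResidual [Finite G] :
    ∃ n, (⊤ : Subgroup G).lowerCentralSeries n = nilpotentResidual G := by
  have hanti := Subgroup.lowerCentralSeries_antitone (⊤ : Subgroup G)
  obtain ⟨n, hn⟩ := WellFoundedGT.monotone_chain_condition (α := (Subgroup G)ᵒᵈ) ⟨_, hanti⟩
  refine ⟨n, le_antisymm (le_iInf fun m => ?_) (iInf_le _ n)⟩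
  obtain hmn | hnm := le_total m n
  · exact hanti hmn
  · exact (hn m hnm).ge

variable {G}

theorem isNilpotent_of_disjoint_nilpotentResidual [Finite G] {L : Subgroup G}
    (h : Disjoint (nilpotentResidual G) L) : Group.IsNilpotent L := by
  obtain ⟨n, hn⟩ := exists_lowerCentralSeries_eq_nilpotentResidual G
  refine L.isNilpotent_iff_lowerCentralSeries.mpr ⟨n, eq_bot_iff.mpr (h ?_ ?_)⟩
  · exact (Subgroup.lowerCentralSeries_mono n le_top).trans_eq hn
  · exact L.lowerCentralSeries_antitone n.zero_le

end NilpotentResidual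

section Suzuki

variable {L K : Type*} [Group L] [Group K] [MulDistribMulAction L K] [Finite K]

namespace IsGaloisPGroup

variable (h : IsGaloisPGroup 2 L K) (hc : commutator K ≤ Subgroup.center K)
  (hne : commutator K ≠ ⊥)
include h hc hne

theorem orderOf_eq_two_iff {x : K} : orderOf x = 2 ↔ x ∈ commutator K ∧ x ≠ 1 := by
  rw [orderOf_eq_prime_iff]
  refine and_congr_left fun _ => ⟨fun hx => ?_, pow_eq_one_of_mem_commutator hc h.pow_mem⟩
  by_contra hxc
  exact h.sq_ne_one hc hne hxc hx

theorem card_eq_sq : Nat.card K = Nat.card (commutator K) ^ 2 := by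
  obtain ⟨x, -, hx1⟩ := (commutator K).bot_or_exists_ne_one.resolve_left hne
  have : Nontrivial K := ⟨x, 1, hx1⟩
  rw [← (commutator K).card_mul_index, h.index_commutator, ← h.card_commutator hc hne, sq]

theorem isSuzukiTwoGroup [Nontrivial L] [Group.IsSolvable L] : IsSuzukiTwoGroup K where
  isPGroup := h.isPGroup
  nonabelian := by
    by_contra! hcomm
    exact hne ((commutator_eq_bot_iff K).mpr ⟨⟨hcomm⟩⟩)
  involutions := by
    obtain ⟨x, hx, hx1⟩ := (commutator K).bot_or_exists_ne_one.resolve_left hne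
    obtain ⟨l, hl⟩ := exists_ne (1 : L)
    refine ⟨x, l • x, ?_, ?_, fun hlx => hx1 (h.isFixedPointFree l hl x hlx.symm)⟩
    · exact (h.orderOf_eq_two_iff hc hne).mpr ⟨hx, hx1⟩
    · exact (h.orderOf_eq_two_iff hc hne).mpr
        ⟨isInvariant_of_characteristic L (commutator K) l x hx, smul_ne_one l hx1⟩
  transitive := by
    refine ⟨(MulDistribMulAction.toMulAut L K).range, Group.isSolvable_of_surjective
      (MulDistribMulAction.toMulAut L K).rangeRestrict_surjective, fun x y hx hy => ?_⟩
    rw [h.orderOf_eq_two_iff hc hne] at hx hy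
    obtain ⟨l, hl⟩ := h.exists_smul_eq_of_mem_commutator hc hne hx.1 hy.1 hx.2 hy.2
    exact ⟨_, ⟨l, rfl⟩, hl⟩

end IsGaloisPGroup

theorem IsFixedPointFree.isCyclic_of_isNilpotent [Finite L] [Group.IsNilpotent L]
    (h : IsFixedPointFree L K) (hne : commutator K ≠ ⊥)
    (hc : commutator K ≤ Subgroup.center K) : IsCyclic L := by
  have : IsMulCommutative (commutator K) := isMulCommutative_of_le_center hc
  have : Nontrivial (commutator K) := (Subgroup.nontrivial_iff_ne_bot _).mpr hne
  have hinv := isInvariant_of_characteristic L (commutator K)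
  let _ := restrictAction hinv
  exact (h.restrict hinv).isCyclic_of_odd (h.odd_card hne)

end Suzuki

end GaloisFrobenius

theorem theorem3p6 {G : Type*} [Group G] [Finite G] (hsol : Group.IsSolvable G)
    (hGC : IsGCStar G) (K L : Subgroup G) (hfrob : IsFrobeniusGroup K L)
    (hK : K = nilpotentResidual G) :
    (∃ q : ℕ, q.Prime ∧ IsElementaryAbelian q K) ∨
      (IsSuzukiTwoGroup K ∧ Nat.card K = Nat.card (commutator K) ^ 2 ∧
        IsCyclic L ∧ Nat.card L = Nat.card (commutator K) - 1) := by
  have : K.Normal := hK ▸ inferInstance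
  have : Group.IsNilpotent L :=
    GaloisFrobenius.isNilpotent_of_disjoint_nilpotentResidual (hK ▸ hfrob.disjoint)
  have : Nontrivial L := (Subgroup.nontrivial_iff_ne_bot _).mpr hfrob.ne_bot
  have : Nontrivial K := hfrob.nontrivial_kernel
  let _ := GaloisFrobenius.conjAction K L
  obtain ⟨p, hp, h⟩ := GaloisFrobenius.IsGaloisTransitive.exists_isGaloisPGroup
    (hfrob.isGaloisTransitive hGC) hfrob.isFixedPointFree
  have := Fact.mk hp
  by_cases hne : commutator K = ⊥
  · have := (commutator_eq_bot_iff K).mp hne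
    refine .inl ⟨p, hp, mul_comm', fun x => ?_⟩
    rw [← Subgroup.mem_bot, ← hne]
    exact h.pow_mem x
  · obtain rfl := h.eq_two_of_commutator_ne_bot hne
    have hc := h.commutator_le_center
    refine .inr ⟨h.isSuzukiTwoGroup hc hne, h.card_eq_sq hc hne,
      h.isFixedPointFree.isCyclic_of_isNilpotent hne hc, ?_⟩
    rw [h.card_commutator hc hne, Nat.add_sub_cancel]
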